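/- Let $\mu\in(1/2,1)$, $f(u)=\ln\big((1-\mu)+\mu e^{u}\big)$, and let $\lambda_0\in(\mu,1)$ be rational. For a smooth function $g$ consider the system $$u_t+f(u)_x=0,\qquad v_t+\tfrac12 v_x+g(u)_x=0,$$ whose characteristic speeds satisfy $0<\tfrac12<f'(u)<1$ for all $u\ge 0$, and its Godunov (upwind) scheme with $\Delta t=\Delta x=1$, $$u^{n+1}_j=u^n_j-\big[f(u^n_j)-f(u^n_{j-1})\big],\qquad v^{n+1}_j=\tfrac12 v^n_{j-1}+\tfrac12 v^n_j-\big[g(u^n_j)-g(u^n_{j-1})\big],$$ where $u^0_j,v^0_j$ are the averages of the initial data over the cell $[j,j+1)$. The Godunov approximation is the function equal to $(u^n_j,v^n_j)$ for $(t,x)\in[n,n+1)\times[j,j+1)$. There are a state $u^->0$, with $f(u^-)-f(0)=\lambda_0u^-$ (so that the shock with left state $u^-$ and right state $u^+=0$ has speed $\lambda_0$), a function $g\in C^\infty_c(\mathbb R)$, smooth functions $\phi_\nu:\mathbb R\to\mathbb R$ with $u^-+\phi_\nu>0$ $(\nu\in\mathbb N)$, and times $T_\nu\to\infty$, such that $$\mathrm{Tot.Var.}\{\phi_\nu\}\to0\quad\text{and}\quad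 \|\phi_\nu\|_{C^k(\mathbb R)}\to0\ \text{ for every }k,\qquad\text{as }\nu\to\infty,$$ and such that the following holds for the initial data $$u_\nu(0,x)=\begin{cases}u^-+\phi_\nu(x)&x<0,\\ u^+=0&x>0,\end{cases}\qquad v_\nu(0,x)=0.$$ 1. There is a constant $C$ such that for every $\nu$ the Cauchy problem with these data has an exact (bounded, Kružkov entropy weak) solution $(U_\nu,V_\nu)$ with $\mathrm{Tot.Var.}\{U_\nu(t,\cdot)\}\le C$ and $\mathrm{Tot.Var.}\{V_\nu(t,\cdot)\}\le C$ for all $t\ge0$. 2. The Godunov approximations $(u_\nu,v_\nu)$ satisfy $\mathrm{Tot.Var.}\{v_\nu(T_\nu,\cdot)\}<\infty$ for every $\nu$, but $\mathrm{Tot.Var.}\{v_\nu(T_\nu,\cdot)\}\to\infty$. 3. Let $(\tilde u_\nu,\tilde v_\nu)$ be the Godunov approximations for the initial data shifted by one grid cell, $\big(u_\nu(0,x-1),0\big)$. Then $(\tilde u_\nu,\tilde v_\nu)(t,x)=(u_\nu,v_\nu)(t,x-1)$, the differences $u_\nu(0)-\tilde u_\nu(0)$ and $v_\nu(T_\nu)-\tilde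 v_\nu(T_\nu)$ of Godunov approximations are integrable, and $$\lim_{\nu\to\infty}\frac{\|v_\nu(T_\nu)-\tilde v_\nu(T_\nu)\|_{L^1}}{\|u_\nu(0)-\tilde u_\nu(0)\|_{L^1}}=\infty .$$ -/

import Mathlib

open Set Filter Topology MeasureTheory
open scoped ENNReal NNReal ContDiff

noncomputable section

/-- The flux `f(u) = ln ((1 - μ) + μ e^u)`. -/
def laxFlux (μ : ℝ) (u : ℝ) : ℝ := Real.log ((1 - μ) + μ * Real.exp u)

/-- The perturbed single shock: `uL + φ(x)` for `x < 0` and `uR` for `x > 0`. -/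
def shockData (uL uR : ℝ) (φ : ℝ → ℝ) (x : ℝ) : ℝ := if x < 0 then uL + φ x else uR

/-- The `C^k` norm on the real line, with values in `[0, ∞]`. -/
def ckNorm (k : ℕ) (φ : ℝ → ℝ) : ℝ≥0∞ :=
  ∑ i ∈ Finset.range (k + 1), ⨆ x : ℝ, ‖iteratedDeriv i φ x‖ₑ

/-- Total variation on the whole real line, with values in `[0, ∞]`. -/
def totVar (w : ℝ → ℝ) : ℝ≥0∞ := eVariationOn w Set.univ

/-! ### Exact solutions of `u_t + f(u)_x = 0`, `v_t + lam v_x + g(u)_x = 0` -/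

/-- Smooth compactly supported test functions on the `(t, x)` plane. They need not vanish at
`t = 0`, so the integral identities below also encode the initial condition. -/
structure IsTestFunction (η : ℝ × ℝ → ℝ) : Prop where
  smooth : ContDiff ℝ ∞ η
  compact : HasCompactSupport η

/-- `∂η/∂t` at `p = (t, x)`. -/
def dt (η : ℝ × ℝ → ℝ) (p : ℝ × ℝ) : ℝ := fderiv ℝ η p (1, 0)

/-- `∂η/∂x` at `p = (t, x)`. -/
def dx (η : ℝ × ℝ → ℝ) (p : ℝ × ℝ) : ℝ := fderiv ℝ η p (0, 1)

/-- The open half plane `t > 0`. -/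
def upperHalf : Set (ℝ × ℝ) := Set.Ioi (0 : ℝ) ×ˢ Set.univ

/-- `(U, V)` is a bounded entropy weak solution, on `t ≥ 0`, of the Cauchy problem
`u_t + f(u)_x = 0`, `v_t + lam v_x + g(u)_x = 0`, `(u, v)(0, ·) = (u₀, v₀)`.
The first component satisfies Kružkov's entropy inequalities; the second equation is linear in
`v`, so that `V` is determined by `U` and needs no further admissibility condition. -/
structure IsEntropySolution (f : ℝ → ℝ) (lam : ℝ) (g : ℝ → ℝ) (u₀ v₀ : ℝ → ℝ)
    (U V : ℝ → ℝ → ℝ) : Prop where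
  measurable_fst : Measurable fun p : ℝ × ℝ => U p.1 p.2
  measurable_snd : Measurable fun p : ℝ × ℝ => V p.1 p.2
  bounded : ∃ M : ℝ, ∀ t, 0 ≤ t → ∀ x, |U t x| ≤ M ∧ |V t x| ≤ M
  weak_fst : ∀ η, IsTestFunction η →
    (∫ p in upperHalf, (U p.1 p.2 * dt η p + f (U p.1 p.2) * dx η p))
      + ∫ x : ℝ, u₀ x * η (0, x) = 0
  weak_snd : ∀ η, IsTestFunction η →
    (∫ p in upperHalf,
        (V p.1 p.2 * dt η p + (lam * V p.1 p.2 + g (U p.1 p.2)) * dx η p))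
      + ∫ x : ℝ, v₀ x * η (0, x) = 0
  entropy : ∀ (k : ℝ) (η : ℝ × ℝ → ℝ), IsTestFunction η → (∀ p, 0 ≤ η p) →
    0 ≤ (∫ p in upperHalf,
        (|U p.1 p.2 - k| * dt η p
          + Real.sign (U p.1 p.2 - k) * (f (U p.1 p.2) - f k) * dx η p))
      + ∫ x : ℝ, |u₀ x - k| * η (0, x)

/-! ### The Godunov (upwind) scheme with `Δt = Δx = 1` and cells `[j, j + 1)` -/

/-- The grid values `u_j^n`; the initial values are the cell averages of the data. -/
def godunovGridU (f : ℝ → ℝ) (u₀ : ℝ → ℝ) : ℕ → ℤ → ℝ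
  | 0, j => ∫ x in (j : ℝ)..(j + 1 : ℝ), u₀ x
  | n + 1, j =>
      godunovGridU f u₀ n j - (f (godunovGridU f u₀ n j) - f (godunovGridU f u₀ n (j - 1)))

/-- The grid values `v_j^n`. -/
def godunovGridV (f : ℝ → ℝ) (lam : ℝ) (g : ℝ → ℝ) (u₀ v₀ : ℝ → ℝ) : ℕ → ℤ → ℝ
  | 0, j => ∫ x in (j : ℝ)..(j + 1 : ℝ), v₀ x
  | n + 1, j =>
      lam * godunovGridV f lam g u₀ v₀ n (j - 1) + (1 - lam) * godunovGridV f lam g u₀ v₀ n j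
        - (g (godunovGridU f u₀ n j) - g (godunovGridU f u₀ n (j - 1)))

/-- The Godunov approximation of `u` as a function of `(t, x)`: it equals `u_j^n` for
`t ∈ [n, n + 1)`, `x ∈ [j, j + 1)`. -/
def godunovU (f : ℝ → ℝ) (u₀ : ℝ → ℝ) (t x : ℝ) : ℝ := godunovGridU f u₀ ⌊t⌋₊ ⌊x⌋

/-- The Godunov approximation of `v` as a function of `(t, x)`. -/
def godunovV (f : ℝ → ℝ) (lam : ℝ) (g : ℝ → ℝ) (u₀ v₀ : ℝ → ℝ) (t x : ℝ) : ℝ :=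
  godunovGridV f lam g u₀ v₀ ⌊t⌋₊ ⌊x⌋

end

/-! For this flux the upwind scheme is linearized by a discrete Hopf-Cole transformation: if u_j =
log((1 + y_j)/(1 + y_{j+1})) and y solves y_j^{n+1} = (1-μ) y_j^n + μ y_{j-1}^n, then u solves the
nonlinear scheme (`godunovGridU_eq`). The exponentials exp(-t j + n f(t)) are exact solutions for y,
so the discrete shock from t to 0 is the explicit profile `shockProfile`, moving with speed f(t)/t.

The flux g is a bump supported strictly between 0 and the shock state. It vanishes on all values of
the exact solution, which therefore has V = 0. The numerical shock layer does take intermediate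
values, and acts as a source for v. If the layer moves with speed λ = λ0 - ε, where λ0 = p/q, its
position relative to the grid nearly repeats after q steps and drifts slowly, so the emitted signal
is modulated with frequency of order qε. The scheme for v carries it away as a wave of wave number
κ, where κ(λ - 1/2) = 2πqε. Over a time of order r the numerical viscosity damps only wave numbers
well above r^{-1/2}. Hence for ε of order r^{-1/2} a wave of amplitude of order κ survives on an
interval of length of order r, and its variation is of order κ² r, that is of order one, provided
the q-th Fourier coefficient of the source is not zero (`exists_resonantFlux`). This is made
rigorous by duality in `window_lower_bound`: the increments of v are tested with a modulated cutoff,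
the cutoff is evolved backwards, and the resulting sum over the source times is evaluated by
equidistribution (`exists_equidistribution_bound`).

To repeat this K times, take r_k = 10^k M and let the left state of the shock be t - r_k^{-1/2}
while the time remaining lies between r_k and r_{k+1}. The waves of different k end up in disjoint
windows, so the variation of v is at least K c0 with c0 independent of K, whereas the perturbation
has size M^{-1/2}, as small as desired (`exists_oscillating_data`). The states increase towards the
shock, so the data are the derivative of a smoothed maximum of affine functions. Accordingly y lies
below each of the pure exponentials, and exponential barriers show that it is close to the relevant
one near the shock (`linScheme_block_lower`, `IsBlockData.profile_close`).

Since the data increase to the left of the shock, the exact solution is a rarefaction given by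
characteristics, cut off where its potential becomes nonnegative; total variation and entropy
inequalities can be read off from the potential (`isEntropySolution_exactSol`). Finally, a shift by
one cell changes a grid function in L¹ by the sum of its jumps, which is large for v and at most
twice the shock state for u. -/

noncomputable section

/-! ### The flux -/

/-- The characteristic speed `f'(u)` of the flux `laxFlux μ`. -/
def laxSpeed (μ u : ℝ) : ℝ := μ * Real.exp u / ((1 - μ) + μ * Real.exp u)

section Flux

variable {μ : ℝ}

theorem lax_den_pos (h0 : 0 < μ) (h1 : μ < 1) (u : ℝ) : 0 < (1 - μ) + μ * Real.exp u := by
  have := mul_pos h0 (Real.exp_pos u); linarith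

theorem laxFlux_zero : laxFlux μ 0 = 0 := by simp [laxFlux]

theorem exp_laxFlux (h0 : 0 < μ) (h1 : μ < 1) (u : ℝ) :
    Real.exp (laxFlux μ u) = (1 - μ) + μ * Real.exp u :=
  Real.exp_log (lax_den_pos h0 h1 u)

theorem hasDerivAt_laxFlux (h0 : 0 < μ) (h1 : μ < 1) (u : ℝ) :
    HasDerivAt (laxFlux μ) (laxSpeed μ u) u := by
  have h := (((Real.hasDerivAt_exp u).const_mul μ).const_add (1 - μ)).log
    (lax_den_pos h0 h1 u).ne'
  exact h

theorem laxSpeed_pos (h0 : 0 < μ) (h1 : μ < 1) (u : ℝ) : 0 < laxSpeed μ u :=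
  div_pos (mul_pos h0 (Real.exp_pos u)) (lax_den_pos h0 h1 u)

theorem laxSpeed_lt_one (h0 : 0 < μ) (h1 : μ < 1) (u : ℝ) : laxSpeed μ u < 1 := by
  rw [laxSpeed, div_lt_one (lax_den_pos h0 h1 u)]; linarith

theorem laxSpeed_zero : laxSpeed μ 0 = μ := by simp [laxSpeed]

theorem hasDerivAt_laxSpeed (h0 : 0 < μ) (h1 : μ < 1) (u : ℝ) :
    HasDerivAt (laxSpeed μ) (laxSpeed μ u * (1 - laxSpeed μ u)) u := by
  have hp := lax_den_pos h0 h1 u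
  have h := ((Real.hasDerivAt_exp u).const_mul μ).div
    (((Real.hasDerivAt_exp u).const_mul μ).const_add (1 - μ)) hp.ne'
  refine h.congr_deriv ?_
  simp only [laxSpeed]
  field_simp

theorem strictMono_laxSpeed (h0 : 0 < μ) (h1 : μ < 1) : StrictMono (laxSpeed μ) := by
  apply strictMono_of_deriv_pos
  intro u
  rw [(hasDerivAt_laxSpeed h0 h1 u).deriv]
  exact mul_pos (laxSpeed_pos h0 h1 u) (by linarith [laxSpeed_lt_one h0 h1 u])

theorem continuous_laxSpeed (h0 : 0 < μ) (h1 : μ < 1) : Continuous (laxSpeed μ) :=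
  continuous_iff_continuousAt.2 fun u => (hasDerivAt_laxSpeed h0 h1 u).continuousAt

theorem continuous_laxFlux (h0 : 0 < μ) (h1 : μ < 1) : Continuous (laxFlux μ) :=
  continuous_iff_continuousAt.2 fun u => (hasDerivAt_laxFlux h0 h1 u).continuousAt

theorem strictMono_laxFlux (h0 : 0 < μ) (h1 : μ < 1) : StrictMono (laxFlux μ) := by
  apply strictMono_of_deriv_pos
  intro u
  rw [(hasDerivAt_laxFlux h0 h1 u).deriv]
  exact laxSpeed_pos h0 h1 u

/-- Here f'' = f'(1 - f') lies between 0 and 1. This gives the constant 1 in front of the quadratic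
remainders used throughout. -/
theorem laxSpeed_sub_le (h0 : 0 < μ) (h1 : μ < 1) {a b : ℝ} (hab : a ≤ b) :
    laxSpeed μ b - laxSpeed μ a ≤ b - a := by
  have hm : Monotone fun u => u - laxSpeed μ u := by
    apply monotone_of_hasDerivAt_nonneg
      (fun u => (hasDerivAt_id u).sub (hasDerivAt_laxSpeed h0 h1 u))
    intro u
    have h2 := laxSpeed_pos h0 h1 u
    have h3 := laxSpeed_lt_one h0 h1 u
    simp only [Pi.zero_apply]
    nlinarith
  have := hm hab
  simp only at this
  linarith

theorem laxFlux_mean_value (h0 : 0 < μ) (h1 : μ < 1) {a b : ℝ} (hab : a < b) :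
    ∃ c ∈ Ioo a b, laxFlux μ b - laxFlux μ a = laxSpeed μ c * (b - a) := by
  obtain ⟨c, hc, h⟩ := exists_hasDerivAt_eq_slope (laxFlux μ) (laxSpeed μ) hab
    (continuous_laxFlux h0 h1).continuousOn (fun x _ => hasDerivAt_laxFlux h0 h1 x)
  refine ⟨c, hc, ?_⟩
  rw [h]
  have : b - a ≠ 0 := by linarith
  field_simp

theorem laxFlux_tangent_le (h0 : 0 < μ) (h1 : μ < 1) (a b : ℝ) :
    laxFlux μ a + laxSpeed μ a * (b - a) ≤ laxFlux μ b := by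
  rcases lt_trichotomy a b with h | h | h
  · obtain ⟨c, hc, e⟩ := laxFlux_mean_value h0 h1 h
    have := (strictMono_laxSpeed h0 h1 hc.1).le
    nlinarith
  · subst h; simp
  · obtain ⟨c, hc, e⟩ := laxFlux_mean_value h0 h1 h
    have := (strictMono_laxSpeed h0 h1 hc.2).le
    nlinarith

theorem laxFlux_le_tangent_add_sq (h0 : 0 < μ) (h1 : μ < 1) (a b : ℝ) :
    laxFlux μ b ≤ laxFlux μ a + laxSpeed μ a * (b - a) + (b - a) ^ 2 := by
  rcases lt_trichotomy a b with h | h | h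
  · obtain ⟨c, hc, e⟩ := laxFlux_mean_value h0 h1 h
    have := laxSpeed_sub_le h0 h1 hc.1.le
    have := hc.2
    nlinarith
  · subst h; simp
  · obtain ⟨c, hc, e⟩ := laxFlux_mean_value h0 h1 h
    have := laxSpeed_sub_le h0 h1 hc.2.le
    have := hc.1
    nlinarith

/-- The tangent at k is evaluated at 0 and at u: for a convex flux vanishing at 0 the chord slope
f(u)/u is nondecreasing. This is the entropy condition for the shock to 0, tested against an
intermediate state k. -/
theorem laxFlux_chord (h0 : 0 < μ) (h1 : μ < 1) {k u : ℝ} (hk : 0 ≤ k) (hku : k ≤ u) :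
    u * laxFlux μ k ≤ k * laxFlux μ u := by
  have e1 := laxFlux_tangent_le h0 h1 k 0
  have e2 := laxFlux_tangent_le h0 h1 k u
  rw [laxFlux_zero] at e1
  nlinarith [mul_le_mul_of_nonneg_left e2 hk, mul_nonneg (sub_nonneg.2 hku) hk,
    mul_le_mul_of_nonneg_left e1 (sub_nonneg.2 hku)]

theorem abs_laxFlux_sub_le (h0 : 0 < μ) (h1 : μ < 1) (a b : ℝ) :
    |laxFlux μ a - laxFlux μ b| ≤ |a - b| := by
  wlog hab : b ≤ a generalizing a b
  · rw [abs_sub_comm, abs_sub_comm a]; exact this b a (by linarith)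
  rw [abs_of_nonneg (by linarith [(strictMono_laxFlux h0 h1).monotone hab]),
    abs_of_nonneg (by linarith)]
  have := laxFlux_tangent_le h0 h1 a b
  have := laxSpeed_lt_one h0 h1 a
  nlinarith

/-- The left state of a shock of speed `lam` with right state `0`. -/
theorem exists_shock_state (h0 : 0 < μ) (h1 : μ < 1) {lam : ℝ} (hl : μ < lam) (hl1 : lam < 1) :
    ∃ u : ℝ, 0 < u ∧ laxFlux μ u = lam * u ∧ lam < laxSpeed μ u := by
  -- The chord slope f(u)/u is at most μ + u, hence below lam at this a. For large u the bound f(u)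
  -- ≥ u + log μ pushes it above lam.
  set a : ℝ := (lam - μ) / 2 with ha
  have ha0 : 0 < a := by simp only [ha]; linarith
  have hneg : laxFlux μ a - lam * a < 0 := by
    have := laxFlux_le_tangent_add_sq h0 h1 0 a
    rw [laxFlux_zero, laxSpeed_zero] at this
    nlinarith
  have hlog : Real.log μ < 0 := Real.log_neg h0 h1
  set b : ℝ := a + (-Real.log μ) / (1 - lam) with hb
  have hq : 0 < (-Real.log μ) / (1 - lam) := div_pos (by linarith) (by linarith)
  have hpos : 0 ≤ laxFlux μ b - lam * b := by
    have h2 : Real.log μ + b ≤ laxFlux μ b := by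
      have : Real.log μ + b = Real.log (μ * Real.exp b) := by
        rw [Real.log_mul h0.ne' (Real.exp_pos b).ne', Real.log_exp]
      rw [this]
      exact Real.log_le_log (mul_pos h0 (Real.exp_pos b)) (by linarith)
    have h3 : (1 - lam) * ((-Real.log μ) / (1 - lam)) = -Real.log μ := by
      have : 1 - lam ≠ 0 := by linarith
      field_simp
    nlinarith
  have hab : a ≤ b := by linarith
  have hcont : ContinuousOn (fun x => laxFlux μ x - lam * x) (Icc a b) :=
    ((continuous_laxFlux h0 h1).sub (continuous_const.mul continuous_id)).continuousOn
  obtain ⟨u, hu, hu0⟩ := intermediate_value_Icc hab hcont ⟨hneg.le, hpos⟩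
  simp only at hu0
  have hu1 : 0 < u := by linarith [hu.1]
  refine ⟨u, hu1, by linarith, ?_⟩
  obtain ⟨c, hc, e⟩ := laxFlux_mean_value h0 h1 hu1
  have := strictMono_laxSpeed h0 h1 hc.2
  rw [laxFlux_zero] at e
  have e2 : laxSpeed μ c = lam := by
    have : laxSpeed μ c * u = lam * u := by linarith
    exact mul_right_cancel₀ hu1.ne' this
  linarith

/-- The shock speed depends on the left state to first order. -/
theorem shock_speed_bounds (h0 : 0 < μ) (h1 : μ < 1) {lam u η : ℝ} (hu : 0 < u)
    (hf : laxFlux μ u = lam * u) (hη : 0 < η) (hη1 : η ≤ u / 2)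
    (hη2 : η ≤ (laxSpeed μ u - lam) / 2) :
    (laxSpeed μ u - lam) / (2 * u) * η ≤ lam - laxFlux μ (u - η) / (u - η) ∧
      lam - laxFlux μ (u - η) / (u - η) ≤ 2 * (laxSpeed μ u - lam) / u * η := by
  have hp : 0 < u - η := by linarith
  have e1 := laxFlux_tangent_le h0 h1 u (u - η)
  have e2 := laxFlux_le_tangent_add_sq h0 h1 u (u - η)
  set d := laxSpeed μ u with hd
  -- The numerator is (f'(u) - lam) η up to an error η², which is absorbed because η is at most half
  -- of f'(u) - lam.
  have hk : lam - laxFlux μ (u - η) / (u - η) = (lam * (u - η) - laxFlux μ (u - η)) / (u - η) := by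
    field_simp
  rw [hk]
  constructor
  · rw [le_div_iff₀ hp, div_mul_eq_mul_div, div_mul_eq_mul_div, div_le_iff₀ (by linarith)]
    have : (d - lam) * η * (u - η) ≤ (d - lam) * η * u := by
      apply mul_le_mul_of_nonneg_left (by linarith)
      apply mul_nonneg (by linarith) hη.le
    have : (d - lam) / 2 * η ≤ lam * (u - η) - laxFlux μ (u - η) := by nlinarith
    nlinarith
  · rw [div_le_iff₀ hp, div_mul_eq_mul_div, div_mul_eq_mul_div, le_div_iff₀ hu]
    have h3 : lam * (u - η) - laxFlux μ (u - η) ≤ (d - lam) * η := by nlinarith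
    have : (d - lam) * η * u ≤ (d - lam) * η * (2 * (u - η)) := by
      apply mul_le_mul_of_nonneg_left (by linarith)
      apply mul_nonneg (by linarith) hη.le
    nlinarith

end Flux


/-! ### Equidistribution along a slowly drifting rational rotation -/

/-- B is the primitive of Γ minus its mean, and removing the mean makes it periodic. Thus h times
the centred function is a difference of a bounded function, up to a quadratic error. -/
theorem exists_bounded_antiderivative {Γ : ℝ → ℂ} {L : ℝ} (hper : Function.Periodic Γ 1)
    (hL : ∀ x y, ‖Γ x - Γ y‖ ≤ L * |x - y|) :
    ∃ (B : ℝ → ℂ) (C : ℝ), Function.Periodic B 1 ∧ (∀ x, ‖B x‖ ≤ C) ∧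
      ∀ x h, 0 ≤ h →
        ‖h • (Γ x - ∫ t in (0 : ℝ)..1, Γ t) - (B x - B (x - h))‖ ≤ L * h ^ 2 := by
  have hcont : Continuous Γ := by
    have : LipschitzWith (Real.toNNReal L) Γ := by
      apply LipschitzWith.of_dist_le_mul
      intro x y
      rw [dist_eq_norm, Real.dist_eq]
      exact (hL x y).trans (mul_le_mul_of_nonneg_right (Real.le_coe_toNNReal L) (abs_nonneg _))
    exact this.continuous
  set c := ∫ t in (0 : ℝ)..1, Γ t with hc
  set Γ0 : ℝ → ℂ := fun x => Γ x - c with hΓ0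
  have hc0 : Continuous Γ0 := hcont.sub continuous_const
  have hper0 : Function.Periodic Γ0 1 := fun x => by simp only [hΓ0, hper x]
  have hint : ∀ a b, IntervalIntegrable Γ0 volume a b := fun a b => hc0.intervalIntegrable a b
  set B : ℝ → ℂ := fun x => ∫ t in (0 : ℝ)..x, Γ0 t with hB
  have hmean : ∫ t in (0 : ℝ)..1, Γ0 t = 0 := by
    rw [hΓ0, intervalIntegral.integral_sub (hcont.intervalIntegrable _ _)
      (continuous_const.intervalIntegrable _ _)]
    simp [hc]
  have hBper : Function.Periodic B 1 := by
    intro x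
    simp only [hB]
    rw [← intervalIntegral.integral_add_adjacent_intervals (hint 0 x) (hint x (x + 1)),
      hper0.intervalIntegral_add_eq x 0]
    simp [hmean]
  have hBc : Continuous B := intervalIntegral.continuous_primitive hint 0
  obtain ⟨C, hC⟩ := isCompact_Icc.exists_bound_of_continuousOn
    (hBc.continuousOn (s := Icc (0 : ℝ) 1))
  refine ⟨B, C, hBper, ?_, ?_⟩
  · intro x
    obtain ⟨y, hy, e⟩ := hBper.exists_mem_Ico₀ one_pos x
    rw [e]
    exact hC y ⟨hy.1, hy.2.le⟩
  · intro x h hh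
    have e1 : B x - B (x - h) = ∫ t in (x - h)..x, Γ0 t :=
      intervalIntegral.integral_interval_sub_left (hint _ _) (hint _ _)
    have e2 : h • (Γ x - c) = ∫ t in (x - h)..x, Γ0 x := by
      rw [intervalIntegral.integral_const]
      simp [hΓ0]
    rw [e1, e2, ← intervalIntegral.integral_sub (intervalIntegrable_const) (hint _ _)]
    have := intervalIntegral.norm_integral_le_of_norm_le_const (a := x - h) (b := x)
      (f := fun t => Γ0 x - Γ0 t) (C := L * h) ?_
    · refine this.trans (le_of_eq ?_)
      rw [sub_sub_cancel, abs_of_nonneg hh]; ring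
    · intro t ht
      rw [uIoc_of_le (by linarith)] at ht
      have h1 : Γ0 x - Γ0 t = Γ x - Γ t := by simp [hΓ0]
      rw [h1]
      refine (hL x t).trans ?_
      have hL0 : 0 ≤ L := by
        have := (norm_nonneg _).trans (hL 0 1)
        simpa using this
      apply mul_le_mul_of_nonneg_left _ hL0
      rw [abs_of_nonneg (by linarith [ht.2])]
      linarith [ht.1]

theorem norm_sum_le_card_mul {ι E : Type*} [SeminormedAddCommGroup E] (s : Finset ι) (f : ι → E)
    {c : ℝ} (h : ∀ i ∈ s, ‖f i‖ ≤ c) : ‖∑ i ∈ s, f i‖ ≤ s.card * c := by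
  have := norm_sum_le_of_le s (f := f) (n := fun _ => c) h
  simpa using this

/-- A shift by q is q successive shifts by one, and each of these is an Abel summation which costs
two boundary terms and N increments of F. -/
theorem norm_sum_shift_le (F : ℕ → ℝ) (b : ℕ → ℂ) {C D : ℝ} (hF : ∀ m, |F m| ≤ 1)
    (hD : ∀ m, |F (m + 1) - F m| ≤ D) (hb : ∀ m, ‖b m‖ ≤ C) (N q : ℕ) :
    ‖∑ m ∈ Finset.range N, F m • (b m - b (m + q))‖ ≤ C * (2 * q + N * q * D) := by
  have hC : 0 ≤ C := (norm_nonneg _).trans (hb 0)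
  have hD0 : 0 ≤ D := (abs_nonneg _).trans (hD 0)
  induction q with
  | zero => simp
  | succ q ih =>
    have e : ∑ m ∈ Finset.range N, F m • (b m - b (m + (q + 1)))
        = ∑ m ∈ Finset.range N, F m • (b m - b (m + q))
          + ∑ m ∈ Finset.range N, F m • (b (m + q) - b (m + q + 1)) := by
      rw [← Finset.sum_add_distrib]
      refine Finset.sum_congr rfl fun m _ => ?_
      rw [← smul_add, ← add_assoc]
      congr 1; ring
    have e2 : ∀ n : ℕ, ∑ m ∈ Finset.range n, F m • (b (m + q) - b (m + q + 1))
        = F 0 • b q - F n • b (n + q)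
          + ∑ m ∈ Finset.range n, (F (m + 1) - F m) • b (m + q + 1) := by
      intro n
      induction n with
      | zero => simp
      | succ n ihn =>
        rw [Finset.sum_range_succ, Finset.sum_range_succ, ihn,
          show n + 1 + q = n + q + 1 by ring]
        simp only [smul_sub, sub_smul]
        ring
    rw [e, e2 N]
    have b1 : ‖F 0 • b q‖ ≤ C := by
      rw [norm_smul, Real.norm_eq_abs]
      calc _ ≤ 1 * C := mul_le_mul (hF 0) (hb q) (norm_nonneg _) zero_le_one
        _ = C := one_mul C
    have b2 : ‖F N • b (N + q)‖ ≤ C := by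
      rw [norm_smul, Real.norm_eq_abs]
      calc _ ≤ 1 * C := mul_le_mul (hF N) (hb _) (norm_nonneg _) zero_le_one
        _ = C := one_mul C
    have b3 : ‖∑ m ∈ Finset.range N, (F (m + 1) - F m) • b (m + q + 1)‖ ≤ N * (D * C) := by
      refine (norm_sum_le_card_mul _ _ (c := D * C) ?_).trans (by rw [Finset.card_range])
      intro m _
      rw [norm_smul, Real.norm_eq_abs]
      exact mul_le_mul (hD m) (hb _) (norm_nonneg _) hD0
    have := norm_add_le (∑ m ∈ Finset.range N, F m • (b m - b (m + q)))
      (F 0 • b q - F N • b (N + q) + ∑ m ∈ Finset.range N, (F (m + 1) - F m) • b (m + q + 1))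
    have := norm_add_le (F 0 • b q - F N • b (N + q))
      (∑ m ∈ Finset.range N, (F (m + 1) - F m) • b (m + q + 1))
    have := norm_sub_le (F 0 • b q) (F N • b (N + q))
    push_cast
    nlinarith

/-- After q steps the argument has moved by p - qε, that is by -qε modulo 1. Hence qε times the
centred Γ is, up to order ε², the q-step difference of a bounded function along the orbit. The
weighted sum telescopes, and dividing by qε gives the bound. -/
theorem exists_equidistribution_bound {Γ : ℝ → ℂ} {L : ℝ} (hper : Function.Periodic Γ 1)
    (hL : ∀ x y, ‖Γ x - Γ y‖ ≤ L * |x - y|) {q : ℕ} (hq : 0 < q) (p : ℤ) :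
    ∃ C : ℝ, 0 ≤ C ∧ ∀ (ε a D : ℝ) (N : ℕ) (F : ℕ → ℝ), 0 < ε → (∀ m, |F m| ≤ 1) →
      (∀ m, |F (m + 1) - F m| ≤ D) →
      ‖∑ m ∈ Finset.range N,
          F m • (Γ (((p : ℝ) / q - ε) * m + a) - ∫ t in (0 : ℝ)..1, Γ t)‖
        ≤ C * ((1 + N * D) / ε + N * ε) := by
  obtain ⟨B, CB, hBper, hCB, hBx⟩ := exists_bounded_antiderivative hper hL
  have hCB0 : 0 ≤ CB := (norm_nonneg _).trans (hCB 0)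
  have hL0 : 0 ≤ L := by
    have := (norm_nonneg _).trans (hL 0 1)
    simpa using this
  have hqR : (0 : ℝ) < q := Nat.cast_pos.2 hq
  refine ⟨2 * CB + L * q, by positivity, ?_⟩
  intro ε a D N F hε hF hD
  have hD0 : 0 ≤ D := (abs_nonneg _).trans (hD 0)
  set c := ∫ t in (0 : ℝ)..1, Γ t
  set x : ℕ → ℝ := fun m => ((p : ℝ) / q - ε) * m + a with hx
  set h : ℝ := q * ε with hh
  have hhpos : 0 < h := mul_pos hqR hε
  have hxq : ∀ m, B (x (m + q)) = B (x m - h) := by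
    intro m
    have : x (m + q) = x m - h + (p : ℤ) * (1 : ℝ) := by
      simp only [hx, hh]; push_cast; field_simp; ring
    rw [this]
    have := hBper.int_mul p (x m - h)
    exact this
  have key : ‖∑ m ∈ Finset.range N, F m • (h • (Γ (x m) - c))‖
      ≤ CB * (2 * q + N * q * D) + N * (L * h ^ 2) := by
    have e : ∑ m ∈ Finset.range N, F m • (h • (Γ (x m) - c))
        = ∑ m ∈ Finset.range N, F m • (B (x m) - B (x (m + q)))
          + ∑ m ∈ Finset.range N, F m • (h • (Γ (x m) - c) - (B (x m) - B (x m - h))) := by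
      rw [← Finset.sum_add_distrib]
      refine Finset.sum_congr rfl fun m _ => ?_
      rw [← smul_add, hxq]
      congr 1; ring
    rw [e]
    refine (norm_add_le _ _).trans (add_le_add ?_ ?_)
    · exact norm_sum_shift_le F (fun m => B (x m)) hF hD (fun m => hCB _) N q
    · refine (norm_sum_le_card_mul _ _ (c := L * h ^ 2) ?_).trans (by rw [Finset.card_range])
      intro m _
      rw [norm_smul, Real.norm_eq_abs]
      calc _ ≤ 1 * (L * h ^ 2) :=
            mul_le_mul (hF m) (hBx _ _ hhpos.le) (norm_nonneg _) zero_le_one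
        _ = _ := one_mul _
  have e3 : ∑ m ∈ Finset.range N, F m • (h • (Γ (x m) - c))
      = h • ∑ m ∈ Finset.range N, F m • (Γ (x m) - c) := by
    rw [Finset.smul_sum]
    exact Finset.sum_congr rfl fun m _ => smul_comm _ _ _
  rw [e3, norm_smul, Real.norm_eq_abs, abs_of_pos hhpos] at key
  have e4 : (2 * CB + L * q) * ((1 + N * D) / ε + N * ε)
      = ((2 * CB + L * q) * (q * (1 + N * D) + N * q * ε ^ 2)) / h := by
    rw [hh]; field_simp
  rw [e4, le_div_iff₀ hhpos, mul_comm]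
  refine key.trans ?_
  have hND : 0 ≤ N * D := by positivity
  have t1 : 0 ≤ CB * (q * (N * D)) := by positivity
  have t2 : 0 ≤ L * q * (q * (1 + N * D)) := by positivity
  have t3 : 0 ≤ CB * (N * q * ε ^ 2) := by positivity
  have t4 : L * h ^ 2 * N = L * q * (N * q * ε ^ 2) := by rw [hh]; ring
  nlinarith


/-! ### The averaging operator of the linear scheme -/

/-- The backward averaging operator `F ↦ (F j + F (j + 1)) / 2`. -/
def avg : Module.End ℂ (ℤ → ℂ) where
  toFun F j := (F j + F (j + 1)) / 2
  map_add' F G := by ext j; simp only [Pi.add_apply]; ring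
  map_smul' c F := by ext j; simp only [Pi.smul_apply, smul_eq_mul, RingHom.id_apply]; ring

theorem avg_apply (F : ℤ → ℂ) (j : ℤ) : avg F j = (F j + F (j + 1)) / 2 := rfl

theorem avg_pow_succ_apply (s : ℕ) (F : ℤ → ℂ) : (avg ^ (s + 1)) F = avg ((avg ^ s) F) := by
  rw [pow_succ', Module.End.mul_apply]

theorem norm_avg_le {F : ℤ → ℂ} {j : ℤ} {a b : ℝ} (h1 : ‖F j‖ ≤ a) (h2 : ‖F (j + 1)‖ ≤ b) :
    ‖avg F j‖ ≤ (a + b) / 2 := by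
  rw [avg_apply, norm_div]
  have := norm_add_le (F j) (F (j + 1))
  simp only [Complex.norm_ofNat]
  linarith

theorem norm_avg_pow_le {F : ℤ → ℂ} {C : ℝ} (h : ∀ j, ‖F j‖ ≤ C) (s : ℕ) (j : ℤ) :
    ‖(avg ^ s) F j‖ ≤ C := by
  induction s generalizing j with
  | zero => simpa using h j
  | succ s ih =>
    rw [avg_pow_succ_apply]
    exact (norm_avg_le (ih j) (ih (j + 1))).trans (by linarith)

/-- Exponentials are eigenfunctions of the averaging, with factor e^{τ/2} cosh(τ/2), and cosh(τ/2) ≤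
e^{τ²/8}. This is a Chernoff bound for the random walk with steps 0 and 1. -/
theorem norm_avg_pow_le_exp {F : ℤ → ℂ} {C τ : ℝ} (h : ∀ j : ℤ, ‖F j‖ ≤ C * Real.exp (τ * j))
    (s : ℕ) (j : ℤ) :
    ‖(avg ^ s) F j‖ ≤ C * Real.exp (τ * (j + s / 2) + τ ^ 2 * s / 8) := by
  have hC : 0 ≤ C := by
    have := (norm_nonneg _).trans (h 0)
    simpa using this
  induction s generalizing j with
  | zero => simpa using h j
  | succ s ih =>
    rw [avg_pow_succ_apply]
    refine (norm_avg_le (ih j) (ih (j + 1))).trans ?_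
    have h1 : Real.cosh (τ / 2) ≤ Real.exp ((τ / 2) ^ 2 / 2) := Real.cosh_le_exp_half_sq _
    have e : (C * Real.exp (τ * (j + s / 2) + τ ^ 2 * s / 8)
        + C * Real.exp (τ * ((j + 1 : ℤ) + s / 2) + τ ^ 2 * s / 8)) / 2
        = C * Real.exp (τ * (j + (s + 1) / 2) + τ ^ 2 * s / 8) * Real.cosh (τ / 2) := by
      rw [Real.cosh_eq]
      have e1 : τ * ((j : ℝ) + s / 2) + τ ^ 2 * s / 8
          = (τ * (j + (s + 1) / 2) + τ ^ 2 * s / 8) + -(τ / 2) := by ring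
      have e2 : τ * (((j + 1 : ℤ) : ℝ) + s / 2) + τ ^ 2 * s / 8
          = (τ * (j + (s + 1) / 2) + τ ^ 2 * s / 8) + τ / 2 := by push_cast; ring
      rw [e1, e2, Real.exp_add _ (-(τ / 2)), Real.exp_add _ (τ / 2)]
      ring
    rw [e]
    refine (mul_le_mul_of_nonneg_left h1 (by positivity)).trans (le_of_eq ?_)
    rw [mul_assoc, ← Real.exp_add]
    congr 2
    push_cast; ring

/-- Averaging is a contraction in the supremum norm, so the one-step errors of an approximate
solution simply add up. -/
theorem norm_avg_pow_sub_le {H : ℕ → ℤ → ℂ} {d : ℝ}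
    (h : ∀ s j, ‖avg (H s) j - H (s + 1) j‖ ≤ d) (s : ℕ) (j : ℤ) :
    ‖(avg ^ s) (H 0) j - H s j‖ ≤ s * d := by
  induction s generalizing j with
  | zero => simp
  | succ s ih =>
    have e : (avg ^ (s + 1)) (H 0) j - H (s + 1) j
        = avg ((avg ^ s) (H 0) - H s) j + (avg (H s) j - H (s + 1) j) := by
      rw [avg_pow_succ_apply, map_sub, Pi.sub_apply]; ring
    rw [e]
    refine (norm_add_le _ _).trans ?_
    have := norm_avg_le (F := (avg ^ s) (H 0) - H s) (ih j) (ih (j + 1))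
    have := h s j
    push_cast
    linarith

/-! ### Summation by parts against the linear scheme -/

/-- The forward difference. -/
def fwdDiffZ (a : ℤ → ℂ) (j : ℤ) : ℂ := a (j + 1) - a j

theorem avg_fwdDiffZ (a : ℤ → ℂ) : fwdDiffZ (avg a) = avg (fwdDiffZ a) := by
  ext j; simp only [fwdDiffZ, avg_apply]; ring

theorem finite_support_shift {a : ℤ → ℂ} (ha : (Function.support a).Finite) (k : ℤ) :
    (Function.support fun j => a (j + k)).Finite := by
  have : (Function.support fun j => a (j + k)) = (fun j => j + k) ⁻¹' Function.support a := rfl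
  rw [this]
  exact ha.preimage (add_left_injective k).injOn

theorem finite_support_avg {a : ℤ → ℂ} (ha : (Function.support a).Finite) :
    (Function.support (avg a)).Finite := by
  refine (ha.union (finite_support_shift ha 1)).subset ?_
  intro j hj
  by_contra hn
  simp only [mem_union, Function.mem_support, not_or, not_not] at hn
  exact hj (by simp [avg_apply, hn.1, hn.2])

theorem summable_mul_of_finite {a : ℤ → ℂ} (ha : (Function.support a).Finite) (v : ℤ → ℂ) :
    Summable fun j => a j * v j := by
  apply summable_of_hasFiniteSupport
  exact ha.subset (Function.support_mul_subset_left a v)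

/-- The scheme is moved onto the weights: `avg` is the transpose of the transport step, and the
forward difference is the transpose of minus the backward difference of the source. -/
theorem tsum_scheme_step {a : ℤ → ℂ} (ha : (Function.support a).Finite) (v G : ℤ → ℂ) :
    ∑' j, a j * (1 / 2 * v (j - 1) + (1 - 1 / 2) * v j - (G j - G (j - 1)))
      = ∑' j, avg a j * v j + ∑' j, fwdDiffZ a j * G j := by
  have ha1 := finite_support_shift ha 1
  have hs1 : ∀ w : ℤ → ℂ, ∑' j, a j * w (j - 1) = ∑' j, a (j + 1) * w j := by
    intro w
    rw [← (Equiv.addRight (1 : ℤ)).tsum_eq fun j => a j * w (j - 1)]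
    simp
  have s1 := fun w => summable_mul_of_finite ha w
  have s2 := fun w => summable_mul_of_finite ha1 w
  have e1 : ∀ j, a j * (1 / 2 * v (j - 1) + (1 - 1 / 2) * v j - (G j - G (j - 1)))
      = (1 / 2 * (a j * v (j - 1)) + 1 / 2 * (a j * v j))
        + (a j * G (j - 1) - a j * G j) := by intro j; ring
  have e2 : ∀ j, avg a j * v j = 1 / 2 * (a (j + 1) * v j) + 1 / 2 * (a j * v j) := by
    intro j; rw [avg_apply]; ring
  have e3 : ∀ j, fwdDiffZ a j * G j = a (j + 1) * G j - a j * G j := by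
    intro j; rw [fwdDiffZ]; ring
  simp_rw [e1, e2, e3]
  rw [Summable.tsum_add (((s1 fun j => v (j - 1)).mul_left _).add ((s1 v).mul_left _))
      ((s1 fun j => G (j - 1)).sub (s1 G)),
    Summable.tsum_add ((s1 fun j => v (j - 1)).mul_left _) ((s1 v).mul_left _),
    Summable.tsum_add ((s2 v).mul_left _) ((s1 v).mul_left _),
    Summable.tsum_sub (s1 fun j => G (j - 1)) (s1 G), Summable.tsum_sub (s2 G) (s1 G),
    tsum_mul_left, tsum_mul_left, tsum_mul_left, hs1 v, hs1 G]

/-- Duhamel's formula in dual form: the source at time m meets the weights after N - 1 - m backward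
steps. -/
theorem tsum_scheme (v G : ℕ → ℤ → ℝ) (hv0 : ∀ j, v 0 j = 0)
    (hv : ∀ n j, v (n + 1) j = 1 / 2 * v n (j - 1) + (1 - 1 / 2) * v n j
      - (G n j - G n (j - 1))) (N : ℕ) {a : ℤ → ℂ} (ha : (Function.support a).Finite) :
    ∑' j, a j * (v N j : ℂ) = ∑ m ∈ Finset.range N,
      ∑' j, (avg ^ (N - 1 - m)) (fwdDiffZ a) j * (G m j : ℂ) := by
  induction N generalizing a with
  | zero => simp [hv0]
  | succ N ih =>
    have e : ∀ j, (v (N + 1) j : ℂ) = 1 / 2 * (v N (j - 1) : ℂ) + (1 - 1 / 2) * (v N j : ℂ)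
        - ((G N j : ℂ) - (G N (j - 1) : ℂ)) := by
      intro j; rw [hv]; push_cast; ring
    simp_rw [e]
    rw [tsum_scheme_step ha (fun j => (v N j : ℂ)) (fun j => (G N j : ℂ)),
      ih (finite_support_avg ha), Finset.sum_range_succ]
    congr 1
    · refine Finset.sum_congr rfl fun m hm => ?_
      have hm' := Finset.mem_range.1 hm
      rw [avg_fwdDiffZ, show N + 1 - 1 - m = (N - 1 - m) + 1 by omega, pow_succ,
        Module.End.mul_apply]
    · simp

theorem tsum_mul_sub_eq {ψ : ℤ → ℂ} (hψ : (Function.support ψ).Finite) (v : ℤ → ℂ) :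
    ∑' j, ψ j * (v j - v (j - 1)) = ∑' j, (-fwdDiffZ ψ j) * v j := by
  have hs1 : ∑' j, ψ j * v (j - 1) = ∑' j, ψ (j + 1) * v j := by
    rw [← (Equiv.addRight (1 : ℤ)).tsum_eq fun j => ψ j * v (j - 1)]
    simp
  have e1 : ∀ j, ψ j * (v j - v (j - 1)) = ψ j * v j - ψ j * v (j - 1) := by intro j; ring
  have e2 : ∀ j, (-fwdDiffZ ψ j) * v j = ψ j * v j - ψ (j + 1) * v j := by
    intro j; rw [fwdDiffZ]; ring
  simp_rw [e1, e2]
  rw [Summable.tsum_sub (summable_mul_of_finite hψ v)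
      (summable_mul_of_finite hψ fun j => v (j - 1)),
    Summable.tsum_sub (summable_mul_of_finite hψ v)
      (summable_mul_of_finite (finite_support_shift hψ 1) v), hs1]

/-! ### Modulated cutoffs -/

/-- The unit complex number `e^{ix}`. -/
def ew (x : ℝ) : ℂ := Complex.exp (x * Complex.I)

theorem ew_add (x y : ℝ) : ew (x + y) = ew x * ew y := by
  simp only [ew]; rw [← Complex.exp_add]; push_cast; ring_nf

theorem norm_ew (x : ℝ) : ‖ew x‖ = 1 := Complex.norm_exp_ofReal_mul_I x

theorem norm_ew_sub_one_le (x : ℝ) : ‖ew x - 1‖ ≤ |x| := by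
  have := Real.norm_exp_I_mul_ofReal_sub_one_le (x := x)
  rw [ew, mul_comm]
  simpa using this

theorem norm_ew_sub_le (x y : ℝ) : ‖ew x - ew y‖ ≤ |x - y| := by
  have : ew x - ew y = ew y * (ew (x - y) - 1) := by
    rw [mul_sub, ← ew_add]; ring_nf
  rw [this, norm_mul, norm_ew, one_mul]
  exact norm_ew_sub_one_le _

theorem ew_zero : ew 0 = 1 := by simp [ew]

theorem one_add_ew (κ : ℝ) : (1 + ew κ) / 2 = ew (κ / 2) * (Real.cos (κ / 2) : ℂ) := by
  have h : ew κ = ew (κ / 2) * ew (κ / 2) := by rw [← ew_add]; ring_nf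
  have hc : (Real.cos (κ / 2) : ℂ) = (ew (κ / 2) + ew (-(κ / 2))) / 2 := by
    rw [Complex.ofReal_cos, Complex.cos, ew, ew]
    push_cast; ring_nf
  have h2 : ew (κ / 2) * ew (-(κ / 2)) = 1 := by rw [← ew_add]; simp [ew_zero]
  rw [hc, h]
  linear_combination (-1 / 2 : ℂ) * h2

theorem ew_pow (x : ℝ) (n : ℕ) : ew x ^ n = ew (n * x) := by
  rw [ew, ew, ← Complex.exp_nat_mul]; push_cast; ring_nf

/-- A cutoff function with first and second difference bounds. -/
structure IsCutoff (χ : ℝ → ℝ) (l L : ℝ) : Prop where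
  nonneg : ∀ x, 0 ≤ χ x
  le_one : ∀ x, χ x ≤ 1
  eq_one : ∀ x, |x| ≤ l / 2 → χ x = 1
  eq_zero : ∀ x, l ≤ |x| → χ x = 0
  lip : ∀ x y, |χ x - χ y| ≤ L * |x - y|
  second : ∀ x h, |χ (x + 2 * h) - 2 * χ (x + h) + χ x| ≤ L * h ^ 2

theorem exists_cutoff {l : ℝ} (hl : 0 < l) : ∃ (χ : ℝ → ℝ) (L : ℝ), 0 ≤ L ∧ IsCutoff χ l L := by
  let b : ContDiffBump (0 : ℝ) := ⟨l / 2, l, by linarith, by linarith⟩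
  have hb : ContDiff ℝ ∞ (b : ℝ → ℝ) := b.contDiff
  have hs : HasCompactSupport (b : ℝ → ℝ) := b.hasCompactSupport
  obtain ⟨L1, hL1⟩ := (hb.of_le (by exact_mod_cast le_top) :
    ContDiff ℝ 1 (b : ℝ → ℝ)).lipschitzWith_of_hasCompactSupport hs one_ne_zero
  have hb' : ContDiff ℝ 1 (deriv (b : ℝ → ℝ)) := by
    have h2 : ContDiff ℝ (1 + 1) (b : ℝ → ℝ) := hb.of_le (by norm_cast)
    exact (contDiff_succ_iff_deriv.1 h2).2.2
  obtain ⟨L2, hL2⟩ := hb'.lipschitzWith_of_hasCompactSupport hs.deriv one_ne_zero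
  have hdiff : Differentiable ℝ (b : ℝ → ℝ) := hb.differentiable (by simp)
  -- This Taylor estimate, used at the midpoint with increments h and -h, will give the bound on
  -- second differences.
  have htay : ∀ x h, |b (x + h) - b x - h * deriv b x| ≤ L2 * h ^ 2 := by
    intro x h
    have hder : ∀ t ∈ Icc (0 : ℝ) 1,
        HasDerivWithinAt (fun t => b (x + t * h) - t * (h * deriv b x))
          (h * (deriv b (x + t * h) - deriv b x)) (Icc 0 1) t := by
      intro t _
      have h1 : HasDerivAt (fun t : ℝ => x + t * h) h t := by
        simpa using ((hasDerivAt_id t).mul_const h).const_add x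
      have h2 := (hdiff (x + t * h)).hasDerivAt.comp t h1
      have h3 := h2.sub ((hasDerivAt_id t).mul_const (h * deriv b x))
      refine (h3.congr_deriv ?_).hasDerivWithinAt
      ring
    have := norm_image_sub_le_of_norm_deriv_le_segment_01' (C := L2 * h ^ 2) hder ?_
    · simp only [one_mul, zero_mul, add_zero, sub_zero, Real.norm_eq_abs] at this
      convert this using 2
      ring
    · intro t ht
      rw [Real.norm_eq_abs, abs_mul]
      have := hL2.dist_le_mul (x + t * h) x
      rw [Real.dist_eq, Real.dist_eq, add_sub_cancel_left, abs_mul, abs_of_nonneg ht.1] at this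
      calc |h| * |deriv b (x + t * h) - deriv b x| ≤ |h| * (L2 * (t * |h|)) := by gcongr
        _ = L2 * |h| ^ 2 * t := by ring
        _ ≤ L2 * |h| ^ 2 * 1 := by gcongr; exact ht.2.le
        _ = L2 * h ^ 2 := by rw [sq_abs, mul_one]
  refine ⟨b, max L1 (2 * L2), by positivity, fun x => b.nonneg, fun x => b.le_one, ?_, ?_, ?_, ?_⟩
  · intro x hx
    apply b.one_of_mem_closedBall
    simpa [Metric.mem_closedBall] using hx
  · intro x hx
    apply b.zero_of_le_dist
    simpa using hx
  · intro x y
    have := hL1.dist_le_mul x y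
    rw [Real.dist_eq, Real.dist_eq] at this
    exact this.trans (mul_le_mul_of_nonneg_right (le_max_left _ _) (abs_nonneg _))
  · intro x h
    have h1 := htay (x + h) h
    have h2 := htay (x + h) (-h)
    rw [show x + h + h = x + 2 * h by ring] at h1
    rw [show x + h + -h = x by ring] at h2
    have : L2 * h ^ 2 + L2 * (-h) ^ 2 ≤ max (L1 : ℝ) (2 * L2) * h ^ 2 := by
      have := mul_le_mul_of_nonneg_right (le_max_right (L1 : ℝ) (2 * L2)) (sq_nonneg h)
      nlinarith
    rw [abs_le] at h1 h2 ⊢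
    constructor <;> linarith [h1.1, h1.2, h2.1, h2.2]

/-- The modulated cutoff `χ((j + s/2 - c)/r) e^{iκj} ρ^s` with `ρ = (1 + e^{iκ})/2`. -/
def wavePacket (χ : ℝ → ℝ) (r c κ : ℝ) (s : ℕ) (j : ℤ) : ℂ :=
  (χ ((j + s / 2 - c) / r) : ℂ) * ew (κ * j) * ((1 + ew κ) / 2) ^ s

theorem norm_half_one_add_ew_le (κ : ℝ) : ‖(1 + ew κ) / 2‖ ≤ 1 := by
  rw [one_add_ew, norm_mul, norm_ew, one_mul, Complex.norm_real]
  exact Real.abs_cos_le_one _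

section Packet

variable {χ : ℝ → ℝ} {l L r c κ : ℝ}

theorem norm_wavePacket_le (hχ : IsCutoff χ l L) (s : ℕ) (j : ℤ) :
    ‖wavePacket χ r c κ s j‖ ≤ χ ((j + s / 2 - c) / r) := by
  rw [wavePacket, norm_mul, norm_mul, norm_ew, mul_one, Complex.norm_real, norm_pow,
    Real.norm_of_nonneg (hχ.nonneg _)]
  exact mul_le_of_le_one_right (hχ.nonneg _) (pow_le_one₀ (norm_nonneg _)
    (norm_half_one_add_ew_le κ))

/-- Averaging multiplies e^{iκj} by (1 + e^{iκ})/2 and moves the envelope by half a cell. What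
remains is a second difference of the envelope and, because e^{iκ} - 1 = O(κ), κ times a first
difference. -/
theorem norm_avg_wavePacket_sub_le (hχ : IsCutoff χ l L) (hL : 0 ≤ L) (hr : 0 < r) (hκ : 0 ≤ κ)
    (s : ℕ) (j : ℤ) :
    ‖avg (wavePacket χ r c κ s) j - wavePacket χ r c κ (s + 1) j‖ ≤ L / r ^ 2 + 2 * κ * L / r := by
  set x := ((j : ℝ) + s / 2 - c) / r with hx
  set h := 1 / (2 * r) with hh
  have hh0 : 0 < h := by positivity
  have e1 : (((j + 1 : ℤ) : ℝ) + s / 2 - c) / r = x + 2 * h := by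
    rw [hx, hh]; push_cast; field_simp; ring
  have e2 : ((j : ℝ) + ((s + 1 : ℕ) : ℝ) / 2 - c) / r = x + h := by
    rw [hx, hh]; push_cast; field_simp; ring
  have e3 : ew (κ * ((j + 1 : ℤ) : ℝ)) = ew (κ * j) * ew κ := by
    rw [← ew_add]; push_cast; ring_nf
  have key : avg (wavePacket χ r c κ s) j - wavePacket χ r c κ (s + 1) j
      = 1 / 2 * (ew (κ * j) * ((1 + ew κ) / 2) ^ s *
        (((χ (x + 2 * h) - 2 * χ (x + h) + χ x : ℝ) : ℂ)
          + (ew κ - 1) * ((χ (x + 2 * h) - χ (x + h) : ℝ) : ℂ))) := by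
    rw [avg_apply, wavePacket, wavePacket, wavePacket, e1, e2, e3, ← hx, pow_succ]
    push_cast
    ring
  rw [key, norm_mul, norm_mul, norm_mul, norm_ew, one_mul, norm_pow]
  have h1 : ‖(1 + ew κ) / 2‖ ^ s ≤ 1 := pow_le_one₀ (norm_nonneg _) (norm_half_one_add_ew_le κ)
  have h2 := hχ.second x h
  have h3 := hχ.lip (x + 2 * h) (x + h)
  rw [show x + 2 * h - (x + h) = h by ring, abs_of_pos hh0] at h3
  have h4 := norm_ew_sub_one_le κ
  rw [abs_of_nonneg hκ] at h4
  have h5 : ‖((χ (x + 2 * h) - 2 * χ (x + h) + χ x : ℝ) : ℂ)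
      + (ew κ - 1) * ((χ (x + 2 * h) - χ (x + h) : ℝ) : ℂ)‖ ≤ L * h ^ 2 + κ * (L * h) := by
    refine (norm_add_le _ _).trans (add_le_add ?_ ?_)
    · rw [Complex.norm_real]; exact h2
    · rw [norm_mul, Complex.norm_real]
      exact mul_le_mul h4 h3 (norm_nonneg _) hκ
  have h6 : ‖(1 / 2 : ℂ)‖ = 1 / 2 := by norm_num
  rw [h6]
  calc 1 / 2 * (‖(1 + ew κ) / 2‖ ^ s * _) ≤ 1 / 2 * (1 * (L * h ^ 2 + κ * (L * h))) := by gcongr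
    _ = L / (8 * r ^ 2) + κ * L / (4 * r) := by rw [hh]; field_simp; ring
    _ ≤ L / r ^ 2 + 2 * κ * L / r := by
      apply add_le_add
      · apply div_le_div_of_nonneg_left hL (by positivity); nlinarith [sq_nonneg r]
      · rw [div_le_div_iff₀ (by positivity) hr]
        nlinarith [mul_nonneg (mul_nonneg hκ hL) hr.le]

/-- One difference appears because the packet is tested against increments of v, the other because
the source enters the scheme as a difference. To leading order both fall on the exponential, which
produces the factor of order κ². -/
theorem norm_second_diff_wavePacket_le (hχ : IsCutoff χ l L) (hr : 0 < r)
    (hκ : 0 ≤ κ) (j : ℤ) :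
    ‖fwdDiffZ (fun i => -fwdDiffZ (wavePacket χ r c κ 0) i) j
      + (ew κ - 1) ^ 2 * wavePacket χ r c κ 0 j‖ ≤ L / r ^ 2 + 2 * κ * L / r := by
  set x := ((j : ℝ) - c) / r with hx
  set h := 1 / r with hh
  have hh0 : 0 < h := by positivity
  have e0 : ((j : ℝ) + ((0 : ℕ) : ℝ) / 2 - c) / r = x := by rw [hx]; simp
  have e1 : (((j + 1 : ℤ) : ℝ) + ((0 : ℕ) : ℝ) / 2 - c) / r = x + h := by
    rw [hx, hh]; push_cast; field_simp; ring
  have e2 : (((j + 1 + 1 : ℤ) : ℝ) + ((0 : ℕ) : ℝ) / 2 - c) / r = x + 2 * h := by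
    rw [hx, hh]; push_cast; field_simp; ring
  have e3 : ew (κ * ((j + 1 : ℤ) : ℝ)) = ew (κ * j) * ew κ := by
    rw [← ew_add]; push_cast; ring_nf
  have e4 : ew (κ * ((j + 1 + 1 : ℤ) : ℝ)) = ew (κ * j) * ew κ * ew κ := by
    rw [← ew_add, ← ew_add]; push_cast; ring_nf
  have key : fwdDiffZ (fun i => -fwdDiffZ (wavePacket χ r c κ 0) i) j
      + (ew κ - 1) ^ 2 * wavePacket χ r c κ 0 j
      = -(ew (κ * j) * (ew κ * ew κ * ((χ (x + 2 * h) - 2 * χ (x + h) + χ x : ℝ) : ℂ)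
        + 2 * ew κ * (ew κ - 1) * ((χ (x + h) - χ x : ℝ) : ℂ))) := by
    simp only [fwdDiffZ, wavePacket]
    rw [e0, e1, e2, e3, e4]
    push_cast
    ring
  rw [key, norm_neg, norm_mul, norm_ew, one_mul]
  have h2 := hχ.second x h
  have h3 := hχ.lip (x + h) x
  rw [show x + h - x = h by ring, abs_of_pos hh0] at h3
  have h4 := norm_ew_sub_one_le κ
  rw [abs_of_nonneg hκ] at h4
  refine (norm_add_le _ _).trans (add_le_add ?_ ?_)
  · rw [norm_mul, norm_mul, norm_ew, one_mul, one_mul, Complex.norm_real]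
    refine h2.trans (le_of_eq ?_)
    rw [hh]; field_simp
  · rw [norm_mul, norm_mul, norm_mul, norm_ew, Complex.norm_real, mul_one, Complex.norm_ofNat]
    calc 2 * ‖ew κ - 1‖ * ‖χ (x + h) - χ x‖ ≤ 2 * κ * (L * h) := by
          exact mul_le_mul (by linarith) h3 (abs_nonneg _) (by linarith)
      _ = 2 * κ * L / r := by rw [hh]; field_simp

/-- The evolved second difference of a wave packet is the wave packet times `-(e^{iκ} - 1)²`. -/
theorem norm_avg_pow_second_diff_le (hχ : IsCutoff χ l L) (hL : 0 ≤ L) (hr : 0 < r)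
    (hκ : 0 ≤ κ) (s : ℕ) (j : ℤ) :
    ‖(avg ^ s) (fwdDiffZ fun i => -fwdDiffZ (wavePacket χ r c κ 0) i) j
      + (ew κ - 1) ^ 2 * wavePacket χ r c κ s j‖
      ≤ (1 + κ ^ 2 * s) * (L / r ^ 2 + 2 * κ * L / r) := by
  set d := L / r ^ 2 + 2 * κ * L / r with hd
  have hd0 : 0 ≤ d := by positivity
  set b := fwdDiffZ fun i => -fwdDiffZ (wavePacket χ r c κ 0) i with hb
  have e : (avg ^ s) b j + (ew κ - 1) ^ 2 * wavePacket χ r c κ s j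
      = (avg ^ s) (b + (ew κ - 1) ^ 2 • wavePacket χ r c κ 0) j
        - (ew κ - 1) ^ 2 * ((avg ^ s) (wavePacket χ r c κ 0) j - wavePacket χ r c κ s j) := by
    rw [map_add, map_smul, Pi.add_apply, Pi.smul_apply, smul_eq_mul]; ring
  rw [e]
  refine (norm_sub_le _ _).trans ?_
  have h1 : ‖(avg ^ s) (b + (ew κ - 1) ^ 2 • wavePacket χ r c κ 0) j‖ ≤ d := by
    apply norm_avg_pow_le
    intro i
    exact norm_second_diff_wavePacket_le hχ hr hκ i
  have h2 := norm_avg_pow_sub_le (H := wavePacket χ r c κ) (d := d)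
    (norm_avg_wavePacket_sub_le hχ hL hr hκ) s j
  have h4 := norm_ew_sub_one_le κ
  rw [abs_of_nonneg hκ] at h4
  have h5 : ‖(ew κ - 1) ^ 2 * ((avg ^ s) (wavePacket χ r c κ 0) j - wavePacket χ r c κ s j)‖
      ≤ κ ^ 2 * (s * d) := by
    rw [norm_mul, norm_pow]
    gcongr
  nlinarith

theorem finite_support_wavePacket (hχ : IsCutoff χ l L) (hr : 0 < r) (s : ℕ) :
    (Function.support (wavePacket χ r c κ s)).Finite := by
  refine (Set.finite_Icc ⌊c - s / 2 - l * r⌋ ⌈c - s / 2 + l * r⌉).subset ?_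
  intro j hj
  have h1 : |((j : ℝ) + s / 2 - c) / r| < l := by
    by_contra hn
    apply hj
    simp [wavePacket, hχ.eq_zero _ (not_lt.1 hn)]
  rw [abs_lt, lt_div_iff₀ hr, div_lt_iff₀ hr] at h1
  constructor
  · have : (⌊c - s / 2 - l * r⌋ : ℝ) ≤ j := (Int.floor_le _).trans (by linarith [h1.1])
    exact_mod_cast this
  · have : (j : ℝ) ≤ ⌈c - s / 2 + l * r⌉ := le_trans (by linarith [h1.2]) (Int.le_ceil _)
    exact_mod_cast this

end Packet


/-! ### The periodized source and its resonant Fourier coefficient -/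

/-- The 1-periodization of a function supported in `(-1/2, 1/2)`, modulated by `e^{-2πiqb}`. -/
def resonantSource (h : ℝ → ℝ) (q : ℕ) (b : ℝ) : ℂ :=
  (h (round b - b) : ℂ) * ew (-(2 * Real.pi * q * b))

theorem ew_two_pi_int (n : ℤ) : ew (2 * Real.pi * n) = 1 := by
  rw [ew]
  have : ((2 * Real.pi * n : ℝ) : ℂ) * Complex.I = n * (2 * Real.pi * Complex.I) := by
    push_cast; ring
  rw [this, Complex.exp_int_mul_two_pi_mul_I]

theorem half_le_abs_int_sub {j : ℤ} {b : ℝ} (hj : j ≠ round b) : 1 / 2 ≤ |(j : ℝ) - b| := by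
  have h1 := abs_sub_round b
  have h2 : (1 : ℝ) ≤ |(j : ℝ) - round b| := by
    have : (1 : ℤ) ≤ |j - round b| := Int.one_le_abs (sub_ne_zero.2 hj)
    exact_mod_cast this
  have h3 : |(j : ℝ) - round b| ≤ |(j : ℝ) - b| + |b - round b| := abs_sub_le _ _ _
  linarith

section Source

variable {h : ℝ → ℝ} {Lh Ch : ℝ} (hsupp : ∀ y, 1 / 2 ≤ |y| → h y = 0)
  (hLip : ∀ x y, |h x - h y| ≤ Lh * |x - y|)

include hsupp in
-- The support of h is contained in an interval of length one, so only the cell nearest to the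
-- centre carries the source.
theorem sum_shift_eq (S : Finset ℤ) (b : ℝ) (hS : round b ∈ S) (X : ℤ → ℂ) :
    ∑ j ∈ S, X j * (h (j - b) : ℂ) = X (round b) * (h (round b - b) : ℂ) := by
  apply Finset.sum_eq_single_of_mem _ hS
  intro j _ hj
  rw [hsupp _ (half_le_abs_int_sub hj)]
  simp

theorem periodic_resonantSource (q : ℕ) : Function.Periodic (resonantSource h q) 1 := by
  intro b
  simp only [resonantSource]
  rw [round_add_one]
  have e1 : ((round b + 1 : ℤ) : ℝ) - (b + 1) = round b - b := by push_cast; ring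
  have e2 : -(2 * Real.pi * q * (b + 1)) = -(2 * Real.pi * q * b) + 2 * Real.pi * (-(q : ℤ) : ℤ) := by
    push_cast; ring
  rw [e1, e2, ew_add, ew_two_pi_int, mul_one]

include hsupp hLip in
-- If the two roundings differ, h vanishes at each point when taken with the rounding of the other
-- one. Both values are then compared with zero, hence the factor 2.
theorem abs_round_sub_le (b b' : ℝ) :
    |h (round b - b) - h (round b' - b')| ≤ 2 * Lh * |b - b'| := by
  have hL0 : 0 ≤ Lh := by
    have := (abs_nonneg _).trans (hLip 0 1)
    simpa using this
  by_cases hr : round b = round b'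
  · rw [hr]
    refine (hLip _ _).trans ?_
    rw [sub_sub_sub_cancel_left, abs_sub_comm]
    nlinarith [mul_nonneg hL0 (abs_nonneg (b - b'))]
  · have h1 := hLip (round b - b) (round b - b')
    rw [hsupp (round b - b') (half_le_abs_int_sub hr), sub_sub_sub_cancel_left,
      abs_sub_comm b' b, sub_zero] at h1
    have h2 := hLip (round b' - b') (round b' - b)
    rw [hsupp (round b' - b) (half_le_abs_int_sub (Ne.symm hr)), sub_sub_sub_cancel_left,
      sub_zero] at h2
    have := abs_sub (h (round b - b)) (h (round b' - b'))
    linarith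

include hsupp hLip in
theorem resonantSource_lipschitz (hC : ∀ x, |h x| ≤ Ch) (q : ℕ) (b b' : ℝ) :
    ‖resonantSource h q b - resonantSource h q b'‖
      ≤ (2 * Lh + Ch * (2 * Real.pi * q)) * |b - b'| := by
  have hC0 : 0 ≤ Ch := (abs_nonneg _).trans (hC 0)
  have e : resonantSource h q b - resonantSource h q b'
      = ((h (round b - b) - h (round b' - b') : ℝ) : ℂ) * ew (-(2 * Real.pi * q * b))
        + (h (round b' - b') : ℂ)
          * (ew (-(2 * Real.pi * q * b)) - ew (-(2 * Real.pi * q * b'))) := by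
    simp only [resonantSource]; push_cast; ring
  rw [e]
  refine (norm_add_le _ _).trans ?_
  rw [norm_mul, norm_mul, norm_ew, mul_one, Complex.norm_real, Complex.norm_real, add_mul]
  refine add_le_add (abs_round_sub_le hsupp hLip b b') ?_
  have h1 := norm_ew_sub_le (-(2 * Real.pi * q * b)) (-(2 * Real.pi * q * b'))
  have e2 : -(2 * Real.pi * q * b) - -(2 * Real.pi * q * b') = -(2 * Real.pi * q) * (b - b') := by
    ring
  rw [e2, abs_mul, abs_neg, abs_of_nonneg (by positivity : 0 ≤ 2 * Real.pi * (q : ℝ))] at h1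
  exact (mul_le_mul (hC _) h1 (norm_nonneg _) hC0).trans (le_of_eq (by ring))

include hsupp in
-- By periodicity the period may be centred at 0. There the rounding is zero, except possibly at the
-- endpoints, where h vanishes.
theorem integral_resonantSource (q : ℕ) :
    ∫ b in (0 : ℝ)..1, resonantSource h q b
      = ∫ b in (-(1 / 2) : ℝ)..(1 / 2), (h (-b) : ℂ) * ew (-(2 * Real.pi * q * b)) := by
  have h1 := (periodic_resonantSource (h := h) q).intervalIntegral_add_eq 0 (-(1 / 2))
  rw [zero_add, show (-(1 / 2) + 1 : ℝ) = 1 / 2 by norm_num] at h1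
  rw [h1]
  apply intervalIntegral.integral_congr
  intro b hb
  rw [uIcc_of_le (by norm_num)] at hb
  simp only [resonantSource]
  congr 2
  by_cases hr : round b = 0
  · rw [hr]; simp
  · have h2 := half_le_abs_int_sub (Ne.symm hr)
    have h3 : |b| ≤ 1 / 2 := abs_le.2 hb
    have h4 : 1 / 2 ≤ |-b| := by simpa using h2
    rw [hsupp _ h4]
    apply hsupp
    have h5 : (1 : ℝ) ≤ |(round b : ℝ)| := by
      have : (1 : ℤ) ≤ |round b| := Int.one_le_abs hr
      exact_mod_cast this
    have h6 : |(round b : ℝ)| ≤ |(round b : ℝ) - b| + |b| := by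
      have := abs_add_le ((round b : ℝ) - b) b
      simpa using this
    linarith

end Source

/-! ### Source terms outside and inside the window -/

section Window

variable {χ : ℝ → ℝ} {l L r c κ : ℝ}

/-- The test weights obtained from a wave packet by two summations by parts. -/
def packetWeight (χ : ℝ → ℝ) (r c κ : ℝ) : ℤ → ℂ :=
  fwdDiffZ fun i => -fwdDiffZ (wavePacket χ r c κ 0) i

theorem norm_packetWeight_le (hχ : IsCutoff χ l L) (hr : 0 < r) (hκ : 0 ≤ κ) (j : ℤ) :
    ‖packetWeight χ r c κ j‖ ≤ κ ^ 2 + (L / r ^ 2 + 2 * κ * L / r) := by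
  have h1 := norm_second_diff_wavePacket_le (c := c) hχ hr hκ j
  have h2 : ‖(ew κ - 1) ^ 2 * wavePacket χ r c κ 0 j‖ ≤ κ ^ 2 := by
    rw [norm_mul, norm_pow]
    have h4 := norm_ew_sub_one_le κ
    rw [abs_of_nonneg hκ] at h4
    have h5 := (norm_wavePacket_le (r := r) (c := c) (κ := κ) hχ 0 j).trans (hχ.le_one _)
    calc _ ≤ κ ^ 2 * 1 := by gcongr
      _ = κ ^ 2 := mul_one _
  have h3 := norm_sub_le (packetWeight χ r c κ j + (ew κ - 1) ^ 2 * wavePacket χ r c κ 0 j)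
    ((ew κ - 1) ^ 2 * wavePacket χ r c κ 0 j)
  rw [add_sub_cancel_right] at h3
  have h1' : ‖packetWeight χ r c κ j + (ew κ - 1) ^ 2 * wavePacket χ r c κ 0 j‖
      ≤ L / r ^ 2 + 2 * κ * L / r := h1
  linarith

theorem packetWeight_eq_zero (hχ : IsCutoff χ l L) (hr : 0 < r) {j : ℤ}
    (hj : (j : ℝ) < c - l * r - 2 ∨ c + l * r < j) : packetWeight χ r c κ j = 0 := by
  have hz : ∀ i : ℤ, ((i : ℝ) ≤ c - l * r ∨ c + l * r ≤ i) → wavePacket χ r c κ 0 i = 0 := by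
    intro i hi
    have : χ (((i : ℝ) + ((0 : ℕ) : ℝ) / 2 - c) / r) = 0 := by
      apply hχ.eq_zero
      rw [le_abs, ← neg_div, le_div_iff₀ hr, le_div_iff₀ hr]
      push_cast
      rcases hi with hi | hi
      · right; linarith
      · left; linarith
    rw [wavePacket, this]; simp
  simp only [packetWeight, fwdDiffZ]
  rw [hz j, hz (j + 1), hz (j + 1 + 1)]
  · simp
  · push_cast; rcases hj with hj | hj
    · left; linarith
    · right; linarith
  · push_cast; rcases hj with hj | hj
    · left; linarith
    · right; linarith
  · rcases hj with hj | hj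
    · left; linarith
    · right; linarith

/-- The weights vanish to the right of c + l r, so they lie below an exponential of any rate
anchored there, to which the Chernoff bound applies. -/
theorem norm_avg_pow_packetWeight_right (hχ : IsCutoff χ l L) (hr : 0 < r)
    {τ : ℝ} (hτ : 0 ≤ τ) {B : ℝ} (hB : ∀ j, ‖packetWeight χ r c κ j‖ ≤ B) (s : ℕ) (j : ℤ) :
    ‖(avg ^ s) (packetWeight χ r c κ) j‖
      ≤ B * Real.exp (-τ * (j + s / 2 - c - l * r) + τ ^ 2 * s / 8) := by
  have hB0 : 0 ≤ B := (norm_nonneg _).trans (hB 0)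
  have h1 := norm_avg_pow_le_exp (F := packetWeight χ r c κ) (τ := -τ)
    (C := B * Real.exp (τ * (c + l * r))) ?_ s j
  · refine h1.trans (le_of_eq ?_)
    rw [mul_assoc, ← Real.exp_add]
    congr 2; ring
  · intro i
    by_cases hi : c + l * r < i
    · rw [packetWeight_eq_zero hχ hr (Or.inr hi), norm_zero]; positivity
    · rw [mul_assoc, ← Real.exp_add]
      refine (hB i).trans (le_mul_of_one_le_right hB0 (Real.one_le_exp ?_))
      nlinarith

theorem norm_avg_pow_packetWeight_left (hχ : IsCutoff χ l L) (hr : 0 < r)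
    {τ : ℝ} (hτ : 0 ≤ τ) {B : ℝ} (hB : ∀ j, ‖packetWeight χ r c κ j‖ ≤ B) (s : ℕ) (j : ℤ) :
    ‖(avg ^ s) (packetWeight χ r c κ) j‖
      ≤ B * Real.exp (τ * (j + s / 2 - c + l * r + 2) + τ ^ 2 * s / 8) := by
  have hB0 : 0 ≤ B := (norm_nonneg _).trans (hB 0)
  have h1 := norm_avg_pow_le_exp (F := packetWeight χ r c κ) (τ := τ)
    (C := B * Real.exp (-τ * (c - l * r - 2))) ?_ s j
  · refine h1.trans (le_of_eq ?_)
    rw [mul_assoc, ← Real.exp_add]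
    congr 2; ring
  · intro i
    by_cases hi : (i : ℝ) < c - l * r - 2
    · rw [packetWeight_eq_zero hχ hr (Or.inl hi), norm_zero]; positivity
    · rw [mul_assoc, ← Real.exp_add]
      refine (hB i).trans (le_mul_of_one_le_right hB0 (Real.one_le_exp ?_))
      nlinarith

/-- Away from the window the evolved weight is exponentially small near the shock. -/
theorem norm_avg_pow_packetWeight_far (hχ : IsCutoff χ l L) (hl : 0 < l) (hr : 0 < r)
    {B : ℝ} (hB : ∀ j, ‖packetWeight χ r c κ j‖ ≤ B) {lam0 C1 R JN Jm : ℝ} (hC1 : 0 ≤ C1)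
    (hl0 : l = lam0 - 1 / 2) (hc : c = JN - 4 * l * r) (s : ℕ)
    (hJ : |Jm - JN + lam0 * (s + 1)| ≤ l / 12 * (s + 1) + C1) (j : ℤ) (hj : |j - Jm| ≤ R)
    (hs : (s : ℝ) + 1 ≤ 2 * r ∨ 6 * r ≤ s + 1) :
    ‖(avg ^ s) (packetWeight χ r c κ) j‖
      ≤ B * Real.exp (-(l ^ 2 / 12 * r) + l * (C1 + R + 3)) := by
  have hB0 : 0 ≤ B := (norm_nonneg _).trans (hB 0)
  have hs0 : (0 : ℝ) ≤ s := Nat.cast_nonneg s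
  have hR : 0 ≤ R := (abs_nonneg _).trans hj
  rw [abs_le] at hJ hj
  have hls : 0 ≤ l * s := by positivity
  have hlr : 0 ≤ l * r := by positivity
  have hlls : 0 ≤ l ^ 2 * s := by positivity
  have hllr : 0 ≤ l ^ 2 * r := by positivity
  have hlR : 0 ≤ l * R := by positivity
  -- After s backward steps the packet is centred where j + s/2 = c, while the shock has j + s/2 - c
  -- close to 4 l r - l (s + 1). It meets the packet only for s + 1 roughly between 3r and 5r. For s
  -- + 1 ≤ 2r it is well to the right, for s + 1 ≥ 6r well to the left, and the rates l and l/3 keep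
  -- the quadratic term below the linear gain.
  rcases hs with hs | hs
  · refine (norm_avg_pow_packetWeight_right hχ hr hl.le hB s j).trans ?_
    apply mul_le_mul_of_nonneg_left _ hB0
    apply Real.exp_le_exp.2
    have e0 : l * (s + 1) ≤ l * (2 * r) := mul_le_mul_of_nonneg_left hs hl.le
    have e1 : 3 / 4 * l * r - (C1 + R + 3) ≤ j + s / 2 - c - l * r := by
      rw [hc]
      have : lam0 = l + 1 / 2 := by linarith
      rw [this] at hJ
      nlinarith [hJ.1, hj.1]
    have e2 := mul_le_mul_of_nonneg_left e1 hl.le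
    have e3 : l ^ 2 * s ≤ l ^ 2 * (2 * r) := by
      apply mul_le_mul_of_nonneg_left (by linarith) (sq_nonneg l)
    nlinarith
  · refine (norm_avg_pow_packetWeight_left hχ hr (τ := l / 3) (by positivity) hB s j).trans ?_
    apply mul_le_mul_of_nonneg_left _ hB0
    apply Real.exp_le_exp.2
    have e0 : l * (6 * r) ≤ l * (s + 1) := mul_le_mul_of_nonneg_left hs hl.le
    have e1 : j + s / 2 - c + l * r + 2 ≤ -(l / 12) * (s + 1) + (C1 + R + 3) := by
      rw [hc]
      have : lam0 = l + 1 / 2 := by linarith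
      rw [this] at hJ
      nlinarith [hJ.2, hj.2]
    have e2 := mul_le_mul_of_nonneg_left e1 (by positivity : 0 ≤ l / 3)
    have e3 : l ^ 2 * (6 * r) ≤ l ^ 2 * (s + 1) := mul_le_mul_of_nonneg_left hs (sq_nonneg l)
    have : l / 3 * (C1 + R + 3) ≤ l * (C1 + R + 3) := by nlinarith
    nlinarith

/-- Near the shock the evolved weight is the explicit wave packet. -/
theorem norm_avg_pow_packetWeight_near (hχ : IsCutoff χ l L) (hL : 0 ≤ L) (hr : 0 < r)
    (hκ : 0 ≤ κ) (s : ℕ) (γ : ℝ) :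
    ‖(avg ^ s) (packetWeight χ r c κ) (round γ)
      + (ew κ - 1) ^ 2 * ((χ ((γ + s / 2 - c) / r) * Real.cos (κ / 2) ^ s : ℝ) : ℂ)
        * ew (κ * (γ + s / 2))‖
      ≤ (1 + κ ^ 2 * s) * (L / r ^ 2 + 2 * κ * L / r) + κ ^ 2 * (L / r + κ) := by
  have h1 := norm_avg_pow_second_diff_le (c := c) hχ hL hr hκ s (round γ)
  have h4 := norm_ew_sub_one_le κ
  rw [abs_of_nonneg hκ] at h4
  have hρ : ((1 + ew κ) / 2) ^ s = ew (κ * (s / 2)) * ((Real.cos (κ / 2) ^ s : ℝ) : ℂ) := by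
    rw [one_add_ew, mul_pow, ew_pow]
    push_cast
    congr 2
    ring
  have hround : |(round γ : ℝ) - γ| ≤ 1 / 2 := by
    rw [abs_sub_comm]; exact abs_sub_round γ
  -- Replacing the nearest integer by γ itself displaces the envelope and the phase by at most half
  -- a cell.
  have h2 : ‖wavePacket χ r c κ s (round γ)
      - ((χ ((γ + s / 2 - c) / r) * Real.cos (κ / 2) ^ s : ℝ) : ℂ) * ew (κ * (γ + s / 2))‖
      ≤ L / r + κ := by
    have e : wavePacket χ r c κ s (round γ)
        - ((χ ((γ + s / 2 - c) / r) * Real.cos (κ / 2) ^ s : ℝ) : ℂ) * ew (κ * (γ + s / 2))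
        = ((1 + ew κ) / 2) ^ s * (((χ ((round γ + s / 2 - c) / r)
            - χ ((γ + s / 2 - c) / r) : ℝ) : ℂ) * ew (κ * round γ)
          + (χ ((γ + s / 2 - c) / r) : ℂ) * (ew (κ * round γ) - ew (κ * γ))) := by
      have e3 : ew (κ * (γ + s / 2)) = ew (κ * γ) * ew (κ * (s / 2)) := by
        rw [← ew_add]; ring_nf
      rw [wavePacket, hρ, e3]
      push_cast
      ring
    rw [e, norm_mul, norm_pow]
    have h5 : ‖(1 + ew κ) / 2‖ ^ s ≤ 1 :=
      pow_le_one₀ (norm_nonneg _) (norm_half_one_add_ew_le κ)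
    refine (mul_le_of_le_one_left (norm_nonneg _) h5).trans ?_
    refine (norm_add_le _ _).trans (add_le_add ?_ ?_)
    · rw [norm_mul, norm_ew, mul_one, Complex.norm_real]
      refine (hχ.lip _ _).trans ?_
      rw [div_eq_mul_inv L]
      apply mul_le_mul_of_nonneg_left _ hL
      rw [← sub_div, abs_div, abs_of_pos hr, div_eq_mul_inv]
      apply mul_le_of_le_one_left (inv_nonneg.2 hr.le)
      rw [show ((round γ : ℝ) + s / 2 - c - (γ + s / 2 - c)) = round γ - γ by ring]
      linarith
    · rw [norm_mul, Complex.norm_real, Real.norm_of_nonneg (hχ.nonneg _)]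
      have h6 := norm_ew_sub_le (κ * round γ) (κ * γ)
      rw [← mul_sub, abs_mul, abs_of_nonneg hκ] at h6
      calc _ ≤ 1 * (κ * 1) := by
            apply mul_le_mul (hχ.le_one _) _ (norm_nonneg _) zero_le_one
            exact h6.trans (mul_le_mul_of_nonneg_left (by linarith) hκ)
        _ = κ := by ring
  have e : (avg ^ s) (packetWeight χ r c κ) (round γ)
      + (ew κ - 1) ^ 2 * ((χ ((γ + s / 2 - c) / r) * Real.cos (κ / 2) ^ s : ℝ) : ℂ)
        * ew (κ * (γ + s / 2))
      = ((avg ^ s) (packetWeight χ r c κ) (round γ)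
        + (ew κ - 1) ^ 2 * wavePacket χ r c κ s (round γ))
        - (ew κ - 1) ^ 2 * (wavePacket χ r c κ s (round γ)
          - ((χ ((γ + s / 2 - c) / r) * Real.cos (κ / 2) ^ s : ℝ) : ℂ)
            * ew (κ * (γ + s / 2))) := by ring
  rw [e]
  refine (norm_sub_le _ _).trans (add_le_add h1 ?_)
  rw [norm_mul, norm_pow]
  gcongr

end Window


/-! ### Lower bound for the variation produced in one window -/

/-- The real amplitude with which the source at time `m` enters the window. -/
def packetAmp (χ : ℝ → ℝ) (r c κ lam a : ℝ) (N m : ℕ) : ℝ :=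
  χ ((lam * m + a + ((N - 1 - m : ℕ) : ℝ) / 2 - c) / r) * Real.cos (κ / 2) ^ (N - 1 - m)

section Amp

variable {χ : ℝ → ℝ} {l L r c κ lam a : ℝ} {N : ℕ}

theorem cos_half_nonneg (hκ : 0 ≤ κ) (hκ1 : κ ≤ 1) : 0 ≤ Real.cos (κ / 2) := by
  apply Real.cos_nonneg_of_neg_pi_div_two_le_of_le <;> linarith [Real.pi_gt_three]

theorem packetAmp_nonneg (hχ : IsCutoff χ l L) (hκ : 0 ≤ κ) (hκ1 : κ ≤ 1) (m : ℕ) :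
    0 ≤ packetAmp χ r c κ lam a N m :=
  mul_nonneg (hχ.nonneg _) (pow_nonneg (cos_half_nonneg hκ hκ1) _)

theorem abs_packetAmp_le (hχ : IsCutoff χ l L) (hκ : 0 ≤ κ) (hκ1 : κ ≤ 1) (m : ℕ) :
    |packetAmp χ r c κ lam a N m| ≤ 1 := by
  rw [abs_of_nonneg (packetAmp_nonneg hχ hκ hκ1 m)]
  exact mul_le_one₀ (hχ.le_one _) (pow_nonneg (cos_half_nonneg hκ hκ1) _)
    (pow_le_one₀ (cos_half_nonneg hκ hκ1) (Real.cos_le_one _))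

/-- One step in m moves the argument of the envelope by at most 1/r and changes the damping factor
by at most 1 - cos(κ/2). This slow variation is what allows the Abel summation against the resonant
source. -/
theorem abs_packetAmp_sub_le (hχ : IsCutoff χ l L) (hL : 0 ≤ L) (hr : 0 < r) (hκ : 0 ≤ κ)
    (hκ1 : κ ≤ 1) (hlam : 0 ≤ lam) (hlam1 : lam ≤ 1) (m : ℕ) :
    |packetAmp χ r c κ lam a N (m + 1) - packetAmp χ r c κ lam a N m| ≤ L / r + κ ^ 2 / 8 := by
  set C := Real.cos (κ / 2) with hC
  have hC0 : 0 ≤ C := cos_half_nonneg hκ hκ1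
  have hC1 : C ≤ 1 := Real.cos_le_one _
  have hC2 : 1 - C ≤ κ ^ 2 / 8 := by
    have := Real.one_sub_sq_div_two_le_cos (x := κ / 2)
    nlinarith
  set s := N - 1 - m with hs
  set s' := N - 1 - (m + 1) with hs'
  set A := (lam * m + a + (s : ℝ) / 2 - c) / r with hA
  set A' := (lam * ((m + 1 : ℕ) : ℝ) + a + (s' : ℝ) / 2 - c) / r with hA'
  -- The second case is due to truncated subtraction: both exponents are 0 when m + 1 ≥ N.
  have hss : s = s' + 1 ∨ s = s' := by omega
  have hAA : |A' - A| ≤ 1 / r := by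
    have e : A' - A = (lam + ((s' : ℝ) - s) / 2) / r := by
      rw [hA, hA']; push_cast; field_simp; ring
    rw [e, abs_div, abs_of_pos hr]
    apply div_le_div_of_nonneg_right _ hr.le
    rcases hss with h | h
    · rw [h]; push_cast; rw [abs_le]; constructor <;> linarith
    · rw [h, abs_le]; constructor <;> linarith
  have hpow : |C ^ s' - C ^ s| ≤ κ ^ 2 / 8 := by
    rcases hss with h | h
    · rw [h, pow_succ, show C ^ s' - C ^ s' * C = C ^ s' * (1 - C) by ring,
        abs_of_nonneg (mul_nonneg (pow_nonneg hC0 _) (by linarith))]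
      exact (mul_le_of_le_one_left (by linarith) (pow_le_one₀ hC0 hC1)).trans hC2
    · rw [h]; simp; positivity
  have e : packetAmp χ r c κ lam a N (m + 1) - packetAmp χ r c κ lam a N m
      = (χ A' - χ A) * C ^ s' + χ A * (C ^ s' - C ^ s) := by
    simp only [packetAmp]; ring
  rw [e]
  refine (abs_add_le _ _).trans (add_le_add ?_ ?_)
  · rw [abs_mul, abs_of_nonneg (pow_nonneg hC0 s')]
    refine (mul_le_of_le_one_right (abs_nonneg _) (pow_le_one₀ hC0 hC1)).trans ?_
    refine (hχ.lip _ _).trans ((mul_le_mul_of_nonneg_left hAA hL).trans (le_of_eq ?_))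
    ring
  · rw [abs_mul, abs_of_nonneg (hχ.nonneg _)]
    exact (mul_le_of_le_one_left (abs_nonneg _) (hχ.le_one _)).trans hpow

/-- Over times of order κ^{-2} the numerical viscosity leaves a fixed fraction of the wave. This
fixes the relation between wave number and duration. -/
theorem exp_le_cos_half_pow (hκ1 : κ ≤ 1) (hκ : 0 ≤ κ) (s : ℕ) :
    Real.exp (-(κ ^ 2 * s / 4)) ≤ Real.cos (κ / 2) ^ s := by
  have h1 : Real.exp (-(κ ^ 2 / 4)) ≤ Real.cos (κ / 2) := by
    have h2 := Real.one_sub_sq_div_two_le_cos (x := κ / 2)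
    have h3 : Real.exp (-(κ ^ 2 / 4)) ≤ 1 / (1 + κ ^ 2 / 4) := by
      rw [Real.exp_neg, ← one_div]
      apply one_div_le_one_div_of_le (by positivity)
      linarith [Real.add_one_le_exp (κ ^ 2 / 4)]
    have h4 : 1 / (1 + κ ^ 2 / 4) ≤ 1 - κ ^ 2 / 8 := by
      rw [div_le_iff₀ (by positivity)]
      nlinarith [sq_nonneg κ, mul_nonneg (sq_nonneg κ) (by nlinarith : 0 ≤ 1 - κ ^ 2)]
    nlinarith
  calc Real.exp (-(κ ^ 2 * s / 4)) = Real.exp (-(κ ^ 2 / 4)) ^ s := by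
        rw [← Real.exp_nat_mul]; congr 1; ring
    _ ≤ _ := pow_le_pow_left₀ (Real.exp_pos _).le h1 s

/-- Along the shock the phase of the packet grows by κ(lam - 1/2) = 2πqε per step. Since q lam = p -
qε, so does -2πq times the shock position modulo 2π. The packet therefore singles out the q-th
Fourier mode of the source. -/
theorem resonant_phase {h : ℝ → ℝ} {q : ℕ} (hq : 0 < q) {p : ℤ} {ε : ℝ}
    (hlam : lam = (p : ℝ) / q - ε) (hres : κ * (lam - 1 / 2) = 2 * Real.pi * q * ε) {m : ℕ}
    (hm : m < N) :
    ew (κ * (lam * m + a + ((N - 1 - m : ℕ) : ℝ) / 2))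
        * (h (round (lam * m + a) - (lam * m + a)) : ℂ)
      = ew (κ * (a + ((N : ℝ) - 1) / 2) + 2 * Real.pi * q * a)
        * resonantSource h q (lam * m + a) := by
  have hqR : (q : ℝ) ≠ 0 := by positivity
  have e1 : ((N - 1 - m : ℕ) : ℝ) = (N : ℝ) - 1 - m := by
    rw [show N - 1 - m = N - (1 + m) by omega, Nat.cast_sub (by omega)]; push_cast; ring
  rw [resonantSource, mul_comm (h _ : ℂ), ← mul_assoc, ← ew_add, e1]
  congr 1
  have e2 : κ * (lam * m + a + ((N : ℝ) - 1 - m) / 2)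
      = κ * (a + ((N : ℝ) - 1) / 2) + 2 * Real.pi * q * a + -(2 * Real.pi * q * (lam * m + a))
        + 2 * Real.pi * ((p * m : ℤ) : ℝ) := by
    have : κ * (lam * m + a + ((N : ℝ) - 1 - m) / 2)
        = κ * (lam - 1 / 2) * m + κ * (a + ((N : ℝ) - 1) / 2) := by ring
    rw [this, hres, hlam]
    push_cast
    field_simp
    ring
  rw [e2, ew_add _ (2 * Real.pi * ((p * m : ℤ) : ℝ)), ew_two_pi_int, mul_one]

theorem half_mul_le_norm_ew_sub_one (hκ : 0 ≤ κ) (hκ1 : κ ≤ 1) : κ / 2 ≤ ‖ew κ - 1‖ := by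
  have h1 : |(ew κ - 1).im| ≤ ‖ew κ - 1‖ := Complex.abs_im_le_norm _
  have h2 : (ew κ - 1).im = Real.sin κ := by
    rw [ew, Complex.sub_im, Complex.exp_ofReal_mul_I_im]; simp
  rw [h2] at h1
  have h3 : 2 / Real.pi * κ ≤ Real.sin κ :=
    Real.mul_le_sin hκ (by linarith [Real.pi_gt_three])
  have h4 : κ / 2 ≤ 2 / Real.pi * κ := by
    have := Real.pi_le_four
    rw [div_mul_eq_mul_div, div_le_div_iff₀ (by norm_num) Real.pi_pos]
    nlinarith
  linarith [le_abs_self (Real.sin κ)]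

/-- The linear phase of the amplitude, measured from the centre of the window. -/
theorem packetAmp_window (hχ : IsCutoff χ l L) {lam0 C1 R : ℝ} {JN Jm : ℝ} {rn : ℕ}
    (hl : 0 < l) (hl0 : l = lam0 - 1 / 2) (hr : 0 < rn) (hN : 6 * rn ≤ N) (hκ : 0 ≤ κ)
    (hκ1 : κ ≤ 1) (hc : c = JN - 4 * l * rn)
    (hlam : 3 / 4 * l ≤ lam - 1 / 2) (hlam1 : lam - 1 / 2 ≤ l)
    (hJ : |Jm - JN + lam0 * (4 * rn)| ≤ l / 12 * (4 * rn) + C1)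
    (hγ : |Jm - (lam * ((N - 4 * rn : ℕ) : ℝ) + a)| ≤ R)
    (hsmall : C1 + R + 1 ≤ l / 48 * rn) :
    (∀ m < N, (N < m + 2 * rn ∨ m + 6 * rn < N) → packetAmp χ rn c κ lam a N m = 0) ∧
    Real.exp (-(2 * κ ^ 2 * rn)) * (rn / 8) ≤ ∑ m ∈ Finset.range N, packetAmp χ rn c κ lam a N m := by
  have hrR : (0 : ℝ) < rn := Nat.cast_pos.2 hr
  set A : ℕ → ℝ := fun m => (lam * m + a + ((N - 1 - m : ℕ) : ℝ) / 2 - c) / rn with hA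
  have hcast : ∀ m < N, ((N - 1 - m : ℕ) : ℝ) = (N : ℝ) - 1 - m := by
    intro m hm
    rw [show N - 1 - m = N - (1 + m) by omega, Nat.cast_sub (by omega)]; push_cast; ring
  have h4 : ((N - 4 * rn : ℕ) : ℝ) = N - 4 * rn := by
    rw [Nat.cast_sub (by omega)]; push_cast; ring
  rw [h4] at hγ
  -- The argument of the envelope is affine in m with slope (lam - 1/2)/r and is small at m = N -
  -- 4r: the error l/3 is the speed tolerance l/12 accumulated over 4r steps, and l/48 covers the
  -- additive constants.
  have hAm : ∀ m < N, |A m - (lam - 1 / 2) * (m - (N - 4 * rn)) / rn| ≤ l / 3 + l / 48 := by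
    intro m hm
    have e : A m - (lam - 1 / 2) * (m - (N - 4 * rn)) / rn
        = (lam * (N - 4 * rn) + a + (4 * rn - 1) / 2 - JN + 4 * l * rn) / rn := by
      simp only [hA]; rw [hcast m hm, hc]; field_simp; ring
    rw [e, abs_div, abs_of_pos hrR, div_le_iff₀ hrR]
    rw [abs_le] at hJ hγ ⊢
    have : lam0 = l + 1 / 2 := by linarith
    rw [this] at hJ
    constructor <;> nlinarith [hJ.1, hJ.2, hγ.1, hγ.2]
  constructor
  · intro m hm hout
    have hz : χ (A m) = 0 := by
      apply hχ.eq_zero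
      have h1 := hAm m hm
      have h2 : 2 * (lam - 1 / 2) ≤ |(lam - 1 / 2) * (m - (N - 4 * rn)) / rn| := by
        rw [abs_div, abs_of_pos hrR, le_div_iff₀ hrR, abs_mul,
          abs_of_nonneg (by linarith : (0 : ℝ) ≤ lam - 1 / 2)]
        have : 2 * (rn : ℝ) ≤ |(m : ℝ) - (N - 4 * rn)| := by
          rw [le_abs]
          rcases hout with ho | ho
          · left
            have : (N : ℝ) < m + 2 * rn := by exact_mod_cast ho
            linarith
          · right
            have : (m : ℝ) + 6 * rn < N := by exact_mod_cast ho
            linarith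
        nlinarith
      have h3 : |(lam - 1 / 2) * (m - (N - 4 * rn)) / rn|
          ≤ |A m| + |A m - (lam - 1 / 2) * (m - (N - 4 * rn)) / rn| := by
        have := abs_sub (A m) (A m - (lam - 1 / 2) * (m - (N - 4 * rn)) / rn)
        rwa [sub_sub_cancel] at this
      linarith
    rw [packetAmp, show (lam * (m : ℝ) + a + ((N - 1 - m : ℕ) : ℝ) / 2 - c) / rn = A m from rfl, hz,
      zero_mul]
  -- On this stretch of about r/8 times the argument is at most l/8 + l/3 + l/48 < l/2, so the
  -- cutoff equals one.
  · set S := Finset.Icc (N - 4 * rn) (N - 4 * rn + rn / 8) with hS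
    have hsub : S ⊆ Finset.range N := by
      intro m hm
      rw [hS, Finset.mem_Icc] at hm
      rw [Finset.mem_range]; omega
    have hcard : (rn : ℝ) / 8 ≤ S.card := by
      rw [hS, Nat.card_Icc]
      have : rn < 8 * (N - 4 * rn + rn / 8 + 1 - (N - 4 * rn)) := by omega
      have h' : (rn : ℝ) < 8 * ((N - 4 * rn + rn / 8 + 1 - (N - 4 * rn) : ℕ) : ℝ) := by
        exact_mod_cast this
      linarith
    have hlow : ∀ m ∈ S, Real.exp (-(2 * κ ^ 2 * rn)) ≤ packetAmp χ rn c κ lam a N m := by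
      intro m hm
      have hmN := Finset.mem_range.1 (hsub hm)
      rw [hS, Finset.mem_Icc] at hm
      have hone : χ (A m) = 1 := by
        apply hχ.eq_one
        have h1 := hAm m hmN
        have h2 : |(lam - 1 / 2) * (m - (N - 4 * rn)) / rn| ≤ l / 8 := by
          rw [abs_div, abs_of_pos hrR, div_le_iff₀ hrR, abs_mul,
            abs_of_nonneg (by linarith : (0 : ℝ) ≤ lam - 1 / 2)]
          have : |(m : ℝ) - (N - 4 * rn)| ≤ rn / 8 := by
            have a1 : ((N - 4 * rn : ℕ) : ℝ) ≤ m := by exact_mod_cast hm.1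
            have a2 : (m : ℝ) ≤ ((N - 4 * rn : ℕ) : ℝ) + ((rn / 8 : ℕ) : ℝ) := by
              exact_mod_cast hm.2
            have a3 : ((rn / 8 : ℕ) : ℝ) ≤ rn / 8 := by
              have := @Nat.cast_div_le ℝ _ _ _ rn 8; simpa using this
            rw [h4] at a1 a2
            rw [abs_le]; constructor <;> linarith
          calc _ ≤ l * (rn / 8) := mul_le_mul hlam1 this (abs_nonneg _) hl.le
            _ = _ := by ring
        have h3 : |A m| ≤ |A m - (lam - 1 / 2) * (m - (N - 4 * rn)) / rn|
            + |(lam - 1 / 2) * (m - (N - 4 * rn)) / rn| := by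
          have := abs_add_le (A m - (lam - 1 / 2) * (m - (N - 4 * rn)) / rn)
            ((lam - 1 / 2) * (m - (N - 4 * rn)) / rn)
          rwa [sub_add_cancel] at this
        linarith
      rw [packetAmp, show (lam * (m : ℝ) + a + ((N - 1 - m : ℕ) : ℝ) / 2 - c) / rn = A m from rfl,
        hone, one_mul]
      refine le_trans ?_ (exp_le_cos_half_pow hκ1 hκ _)
      apply Real.exp_le_exp.2
      have : ((N - 1 - m : ℕ) : ℝ) ≤ 4 * rn := by
        have : N - 1 - m ≤ 4 * rn := by omega
        exact_mod_cast this
      nlinarith [sq_nonneg κ, mul_le_mul_of_nonneg_left this (sq_nonneg κ),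
        mul_nonneg (sq_nonneg κ) hrR.le]
    calc Real.exp (-(2 * κ ^ 2 * rn)) * (rn / 8) ≤ S.card • Real.exp (-(2 * κ ^ 2 * rn)) := by
          rw [nsmul_eq_mul, mul_comm]
          exact mul_le_mul_of_nonneg_right hcard (Real.exp_pos _).le
      _ ≤ ∑ m ∈ S, packetAmp χ rn c κ lam a N m := Finset.card_nsmul_le_sum _ _ _ hlow
      _ ≤ _ := Finset.sum_le_sum_of_subset_of_nonneg hsub
          (fun m _ _ => packetAmp_nonneg hχ hκ hκ1 m)

end Amp


theorem tsum_eq_sum_near {X : ℤ → ℂ} {G : ℤ → ℝ} {J : ℤ} {R : ℕ}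
    (hG : ∀ j, G j ≠ 0 → |j - J| ≤ R) :
    ∑' j, X j * (G j : ℂ) = ∑ j ∈ Finset.Icc (J - (R + 1)) (J + (R + 1)), X j * (G j : ℂ) := by
  apply tsum_eq_sum
  intro j hj
  by_contra hne
  apply hj
  have : G j ≠ 0 := by
    intro h0; apply hne; simp [h0]
  have := abs_le.1 (hG j this)
  rw [Finset.mem_Icc]
  omega

theorem card_near (J : ℤ) (R : ℕ) :
    ((Finset.Icc (J - (R + 1)) (J + (R + 1))).card : ℝ) = 2 * R + 3 := by
  rw [Int.card_Icc]
  have : (J + (R + 1) + 1 - (J - (R + 1))).toNat = 2 * R + 3 := by omega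
  rw [this]; push_cast; ring

/-- The contribution of a source at one time inside the window. -/
theorem norm_source_near_le {h : ℝ → ℝ} {Ch : ℝ} (hsupp : ∀ y, 1 / 2 ≤ |y| → h y = 0)
    (hC : ∀ y, |h y| ≤ Ch) {X : ℤ → ℂ} {W : ℂ} {B E e γ : ℝ} {G : ℤ → ℝ} {J : ℤ} {R : ℕ}
    (hG : ∀ j, G j ≠ 0 → |j - J| ≤ R) (hX : ∀ j, ‖X j‖ ≤ B) (hW : ‖X (round γ) + W‖ ≤ E)
    (hγ : |J - γ| ≤ R) (he : ∀ j : ℤ, |G j - h (j - γ)| ≤ e) :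
    ‖∑' j, X j * (G j : ℂ) + W * (h (round γ - γ) : ℂ)‖ ≤ (2 * R + 3) * (B * e) + E * Ch := by
  have hB0 : 0 ≤ B := (norm_nonneg _).trans (hX 0)
  have hE0 : 0 ≤ E := (norm_nonneg _).trans hW
  rw [tsum_eq_sum_near hG]
  set S := Finset.Icc (J - (R + 1)) (J + (R + 1)) with hS
  have hmem : round γ ∈ S := by
    have h1 := abs_le.1 (abs_sub_round γ)
    have h2 := abs_le.1 hγ
    rw [hS, Finset.mem_Icc]
    constructor
    · have : ((J - (R + 1) : ℤ) : ℝ) ≤ (round γ : ℤ) := by push_cast; linarith [h1.1, h1.2, h2.2]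
      exact_mod_cast this
    · have : ((round γ : ℤ) : ℝ) ≤ ((J + (R + 1) : ℤ) : ℝ) := by push_cast; linarith [h1.1, h2.1]
      exact_mod_cast this
  have e1 : ∑ j ∈ S, X j * (G j : ℂ) + W * (h (round γ - γ) : ℂ)
      = ∑ j ∈ S, X j * ((G j - h (j - γ) : ℝ) : ℂ)
        + (X (round γ) + W) * (h (round γ - γ) : ℂ) := by
    rw [add_mul, ← sum_shift_eq hsupp S γ hmem X, ← add_assoc, ← Finset.sum_add_distrib]
    congr 1
    refine Finset.sum_congr rfl fun j _ => ?_
    push_cast; ring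
  rw [e1]
  refine (norm_add_le _ _).trans (add_le_add ?_ ?_)
  · rw [← card_near J R]
    apply norm_sum_le_card_mul
    intro j _
    rw [norm_mul, Complex.norm_real]
    exact mul_le_mul (hX j) (he j) (norm_nonneg _) hB0
  · rw [norm_mul, Complex.norm_real]
    exact mul_le_mul hW (hC _) (norm_nonneg _) hE0

/-- The contribution of a source at one time outside the window. -/
theorem norm_source_far_le {X : ℤ → ℂ} {B Cg : ℝ} (hB : 0 ≤ B) {G : ℤ → ℝ} {J : ℤ} {R : ℕ}
    (hG : ∀ j, G j ≠ 0 → |j - J| ≤ R) (hGC : ∀ j, |G j| ≤ Cg)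
    (hX : ∀ j : ℤ, |j - J| ≤ R → ‖X j‖ ≤ B) :
    ‖∑' j, X j * (G j : ℂ)‖ ≤ (2 * R + 3) * (B * Cg) := by
  have hC0 : 0 ≤ Cg := (abs_nonneg _).trans (hGC 0)
  rw [tsum_eq_sum_near hG, ← card_near J R]
  apply norm_sum_le_card_mul
  intro j _
  rw [norm_mul, Complex.norm_real]
  by_cases hj : |j - J| ≤ R
  · exact mul_le_mul (hX j hj) (hGC j) (norm_nonneg _) hB
  · have : G j = 0 := by
      by_contra h0; exact hj (hG j h0)
    rw [this]; simp; positivity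

theorem norm_tsum_packet_le {χ : ℝ → ℝ} {l L r c κ : ℝ} (hχ : IsCutoff χ l L) (hr : 0 < r)
    (v : ℤ → ℝ) (S : Finset ℤ) (hS : ∀ j : ℤ, |(j : ℝ) - c| < l * r → j ∈ S) :
    ‖∑' j, wavePacket χ r c κ 0 j * ((v j : ℂ) - (v (j - 1) : ℂ))‖
      ≤ ∑ j ∈ S, |v j - v (j - 1)| := by
  have hz : ∀ j ∉ S, wavePacket χ r c κ 0 j * ((v j : ℂ) - (v (j - 1) : ℂ)) = 0 := by
    intro j hj
    have h1 : l ≤ |((j : ℝ) + ((0 : ℕ) : ℝ) / 2 - c) / r| := by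
      rw [abs_div, abs_of_pos hr, le_div_iff₀ hr]
      push_cast
      rw [zero_div, add_zero]
      by_contra hn
      exact hj (hS j (not_le.1 hn))
    rw [wavePacket, hχ.eq_zero _ h1]; simp
  rw [tsum_eq_sum hz]
  refine norm_sum_le_of_le _ fun j _ => ?_
  rw [norm_mul, ← Complex.ofReal_sub, Complex.norm_real]
  exact mul_le_of_le_one_left (norm_nonneg _) ((norm_wavePacket_le hχ 0 j).trans (hχ.le_one _))

theorem resonant_freq_bounds {Q l x c1 c2 ρ ε : ℝ} (hQ : 0 < Q) (hl : 0 < l)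
    (hx1 : 3 / 4 * l ≤ x) (hx2 : x ≤ l) (hc1 : 0 ≤ c1) (hc2 : 0 ≤ c2) (hρ : 0 ≤ ρ)
    (h1 : c1 * ρ ≤ ε) (h2 : ε ≤ c2 * ρ) :
    Q * c1 / l * ρ ≤ Q * ε / x ∧ Q * ε / x ≤ Q * c2 / (3 / 4 * l) * ρ := by
  have hx : 0 < x := by linarith
  have hε : 0 ≤ ε := (mul_nonneg hc1 hρ).trans h1
  constructor
  · calc Q * c1 / l * ρ = Q * (c1 * ρ) / l := by ring
      _ ≤ Q * ε / x := by gcongr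
  · calc Q * ε / x ≤ Q * (c2 * ρ) / (3 / 4 * l) := by gcongr
      _ = Q * c2 / (3 / 4 * l) * ρ := by ring

set_option maxHeartbeats 1600000 in
/-- One window: the scheme for `v`, driven by a source which travels at a speed slightly below
the rational speed `lam0`, produces a fixed amount of variation. -/
theorem window_lower_bound {h : ℝ → ℝ} {Lh Ch : ℝ} (hsupp : ∀ y, 1 / 2 ≤ |y| → h y = 0)
    (hLip : ∀ x y, |h x - h y| ≤ Lh * |x - y|) (hCh : ∀ y, |h y| ≤ Ch)
    {q : ℕ} (hq : 0 < q) {p : ℤ} {lam0 : ℝ} (hlam0 : lam0 = (p : ℝ) / q) (h12 : 1 / 2 < lam0)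
    (hlam1 : lam0 < 1) (hcoef : ∫ b in (0 : ℝ)..1, resonantSource h q b ≠ 0)
    (R : ℕ) {Cg C1 c1 c2 : ℝ} (hC1 : 0 ≤ C1) (hc1 : 0 < c1) (hc2 : 0 < c2) :
    ∃ c0 > 0, ∀ CK : ℝ, ∃ e0 > 0, ∃ ρ0 > 0, ∀ (r N : ℕ) (ρ ε a : ℝ) (J : ℕ → ℤ)
      (G v : ℕ → ℤ → ℝ), 0 < r → 6 * r ≤ N → (N : ℝ) ≤ CK * r → 0 < ρ → ρ ≤ ρ0 →
      ρ ^ 2 * r = 1 → c1 * ρ ≤ ε → ε ≤ c2 * ρ →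
      (∀ m j, |G m j| ≤ Cg) → (∀ m j, G m j ≠ 0 → |j - J m| ≤ R) →
      (∀ m ≤ N, |(J m : ℝ) - J N + lam0 * ((N : ℝ) - m)|
        ≤ (lam0 - 1 / 2) / 12 * ((N : ℝ) - m) + C1) →
      (∀ m, m + 2 * r ≤ N → N ≤ m + 6 * r → |(J m : ℝ) - ((lam0 - ε) * m + a)| ≤ R ∧
        ∀ j : ℤ, |G m j - h (j - ((lam0 - ε) * m + a))| ≤ e0) →
      (∀ j, v 0 j = 0) →
      (∀ n j, v (n + 1) j = 1 / 2 * v n (j - 1) + (1 - 1 / 2) * v n j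
        - (G n j - G n (j - 1))) →
      ∀ S : Finset ℤ, (∀ j : ℤ, 3 * (lam0 - 1 / 2) * r ≤ (J N : ℝ) - j →
        (J N : ℝ) - j ≤ 5 * (lam0 - 1 / 2) * r → j ∈ S) →
      c0 ≤ ∑ j ∈ S, |v N j - v N (j - 1)| := by
  set l := lam0 - 1 / 2 with hl
  have hl0 : 0 < l := by linarith
  obtain ⟨χ, L, hL, hχ⟩ := exists_cutoff hl0
  obtain ⟨Ce, hCe, hequi⟩ := exists_equidistribution_bound (periodic_resonantSource (h := h) q)
    (resonantSource_lipschitz hsupp hLip hCh q) hq p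
  set cf := ∫ b in (0 : ℝ)..1, resonantSource h q b with hcf
  have hcf0 : 0 < ‖cf‖ := norm_pos_iff.2 hcoef
  have hqR : (0 : ℝ) < q := Nat.cast_pos.2 hq
  have hCh0 : 0 ≤ Ch := (abs_nonneg _).trans (hCh 0)
  set k1 := 2 * Real.pi * q * c1 / l with hk1
  set k2 := 2 * Real.pi * q * c2 / (3 / 4 * l) with hk2
  have hpi := Real.pi_pos
  have hk1p : 0 < k1 := by positivity
  have hk2p : 0 < k2 := by positivity
  -- The three factors are the lower bounds for |e^{iκ} - 1|², for the sum of the amplitudes and for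
  -- the Fourier coefficient, combined through ρ² r = 1. After halving, the main term is at least 2
  -- c0 up to the equidistribution error, and all the errors together will cost at most c0. The
  -- constant is fixed before CK, so it does not depend on how long the scheme runs.
  set c0 := k1 ^ 2 / 4 * (Real.exp (-(2 * k2 ^ 2)) * (1 / 8) * ‖cf‖) / 2 with hc0
  have hc0p : 0 < c0 := by positivity
  refine ⟨c0, hc0p, fun CK => ?_⟩
  set CK' := max CK 1 with hCK'
  have hCKp : 0 < CK' := lt_of_lt_of_le one_pos (le_max_right _ _)
  -- Cd ρ³ bounds the consistency error of the packet and B0 ρ² its weights. In the estimate for a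
  -- single time A1 belongs to the error in the source profile, B1 to the other errors inside the
  -- window and B2 to the tails outside it; B3 comes from equidistribution.
  set Cd := L + 2 * k2 * L with hCd
  have hCdp : 0 ≤ Cd := by positivity
  set B0 := k2 ^ 2 + Cd with hB0
  have hB0p : 0 < B0 := by positivity
  set A1 := (2 * R + 3 : ℝ) * B0 with hA1
  have hA1p : 0 < A1 := by positivity
  set B1 := ((1 + 6 * k2 ^ 2) * Cd + k2 ^ 2 * (L + k2)) * Ch with hB1
  have hB1p : 0 ≤ B1 := by positivity
  set Cg' := max Cg 0 with hCg'
  set B2 := (2 * R + 3 : ℝ) * (B0 * (Real.exp (l * (C1 + R + 3)) * (12 / l ^ 2)) * Cg') with hB2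
  have hCgp : 0 ≤ Cg' := le_max_right _ _
  have hB2p : 0 ≤ B2 := by positivity
  set B3 := k2 ^ 2 * (Ce * ((1 + CK' * (L + k2 ^ 2)) / c1 + CK' * c2)) with hB3
  have hB3p : 0 ≤ B3 := by positivity
  set BB := CK' * (B1 + B2) + B3 + 1 with hBB
  have hBBp : 0 < BB := by positivity
  -- The tolerance e0 makes the profile errors of all times add up to c0/2. The threshold on ρ gives
  -- κ ≤ 1, a speed staying well above 1/2, a window long compared with the constants, and another
  -- c0/2 for the remaining errors.
  refine ⟨c0 / 2 / (CK' * A1), by positivity,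
    min (min 1 (1 / k2)) (min (l / 4 / c2) (min (l / 48 / (C1 + R + 1)) (c0 / 2 / BB))),
    by positivity, ?_⟩
  intro r N ρ ε a J G v hr hN hNC hρ hρ0 hρr hε1 hε2 hGC hG hJ hwin hv0 hv S hS
  clear_value k1 k2 c0 CK' Cd B0 A1 B1 Cg' B2 B3 BB
  have hrR : (0 : ℝ) < r := Nat.cast_pos.2 hr
  have hρ1 : ρ ≤ 1 := hρ0.trans ((min_le_left _ _).trans (min_le_left _ _))
  have hρk : ρ * k2 ≤ 1 := by
    have := hρ0.trans ((min_le_left _ _).trans (min_le_right _ _))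
    rwa [le_div_iff₀ hk2p] at this
  have hρc : c2 * ρ ≤ l / 4 := by
    have := hρ0.trans ((min_le_right _ _).trans (min_le_left _ _))
    rw [le_div_iff₀ hc2] at this; linarith
  have hρl : ρ * (C1 + R + 1) ≤ l / 48 := by
    have := hρ0.trans ((min_le_right _ _).trans ((min_le_right _ _).trans (min_le_left _ _)))
    rwa [le_div_iff₀ (by positivity)] at this
  have hρB : ρ * BB ≤ c0 / 2 := by
    have := hρ0.trans ((min_le_right _ _).trans ((min_le_right _ _).trans (min_le_right _ _)))
    rwa [le_div_iff₀ hBBp] at this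
  have hNC' : (N : ℝ) ≤ CK' * r :=
    hNC.trans (mul_le_mul_of_nonneg_right (hCK' ▸ le_max_left _ _) hrR.le)
  have hrinv : 1 / (r : ℝ) = ρ ^ 2 := by
    rw [div_eq_iff hrR.ne', hρr]
  have hεp : 0 < ε := lt_of_lt_of_le (by positivity) hε1
  set lam := lam0 - ε with hlam
  have hlamε : lam = (p : ℝ) / q - ε := by rw [hlam, hlam0]
  have hlam34 : 3 / 4 * l ≤ lam - 1 / 2 := by rw [hlam]; linarith
  have hlaml : lam - 1 / 2 ≤ l := by rw [hlam]; linarith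
  have hlp : 0 < lam - 1 / 2 := by linarith
  set κ := 2 * Real.pi * q * ε / (lam - 1 / 2) with hκ
  have hres : κ * (lam - 1 / 2) = 2 * Real.pi * q * ε := by rw [hκ]; exact div_mul_cancel₀ _ hlp.ne'
  obtain ⟨hκ1, hκ2⟩ := resonant_freq_bounds (Q := 2 * Real.pi * q) (by positivity) hl0 hlam34
    hlaml hc1.le hc2.le hρ.le hε1 hε2
  rw [← hκ, ← hk1] at hκ1
  rw [← hκ, ← hk2] at hκ2
  have hκp : 0 < κ := lt_of_lt_of_le (by positivity) hκ1
  have hκ1' : κ ≤ 1 := by linarith [mul_comm ρ k2]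
  have hκsq : κ ^ 2 ≤ k2 ^ 2 * ρ ^ 2 := by
    rw [← mul_pow]; exact pow_le_pow_left₀ hκp.le hκ2 2
  set c := (J N : ℝ) - 4 * l * r with hc
  have hd : L / (r : ℝ) ^ 2 + 2 * κ * L / r ≤ Cd * ρ ^ 3 := by
    have e1 : L / (r : ℝ) ^ 2 = L * ρ ^ 4 := by
      rw [div_eq_mul_one_div, ← one_div_pow, hrinv]; ring
    have e2 : 2 * κ * L / r = 2 * κ * L * ρ ^ 2 := by rw [div_eq_mul_one_div, hrinv]
    rw [e1, e2, hCd, add_mul]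
    have t1 : ρ ^ 4 ≤ ρ ^ 3 := pow_le_pow_of_le_one hρ.le hρ1 (by norm_num)
    have t2 : κ * (L * ρ ^ 2) ≤ k2 * ρ * (L * ρ ^ 2) := by gcongr
    linarith [mul_le_mul_of_nonneg_left t1 hL]
  have hρ21 : ρ ^ 2 ≤ ρ := pow_le_of_le_one hρ.le hρ1 two_ne_zero
  have hρ32 : ρ ^ 3 ≤ ρ ^ 2 := pow_le_pow_of_le_one hρ.le hρ1 (by norm_num)
  have hB : ∀ j, ‖packetWeight χ r c κ j‖ ≤ B0 * ρ ^ 2 := by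
    intro j
    refine (norm_packetWeight_le hχ hrR hκp.le j).trans ?_
    rw [hB0, add_mul]
    linarith [mul_le_mul_of_nonneg_left hρ32 hCdp]
  -- the functional
  set Ts : ℕ → ℂ := fun m => ∑' j, (avg ^ (N - 1 - m)) (packetWeight χ r c κ) j * (G m j : ℂ)
    with hTs
  have hfun : ∑' j, wavePacket χ r c κ 0 j * ((v N j : ℂ) - (v N (j - 1) : ℂ))
      = ∑ m ∈ Finset.range N, Ts m := by
    have hfs := finite_support_wavePacket (c := c) (κ := κ) hχ hrR 0
    rw [tsum_mul_sub_eq hfs (fun j => (v N j : ℂ))]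
    have hfs2 : (Function.support fun j => -fwdDiffZ (wavePacket χ r c κ 0) j).Finite := by
      refine (hfs.union (finite_support_shift hfs 1)).subset ?_
      intro j hj
      by_contra hn
      simp only [mem_union, Function.mem_support, not_or, not_not] at hn
      exact hj (by simp [fwdDiffZ, hn.1, hn.2])
    exact tsum_scheme v G hv0 hv N hfs2
  have hle := norm_tsum_packet_le (κ := κ) hχ hrR (v N) S (c := c) (by
    intro j hj
    rw [abs_lt] at hj
    apply hS j
    · rw [hc] at hj; linarith [hj.2]
    · rw [hc] at hj; linarith [hj.1])
  rw [hfun] at hle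
  refine le_trans ?_ hle
  -- the main part
  set U := ew (κ * (a + ((N : ℝ) - 1) / 2) + 2 * Real.pi * q * a) with hU
  set F : ℕ → ℝ := packetAmp χ r c κ lam a N with hF
  set Ms : ℕ → ℂ := fun m => (ew κ - 1) ^ 2 * U * (F m • resonantSource h q (lam * m + a)) with hMs
  have hsmall : C1 + R + 1 ≤ l / 48 * r := by
    have h1 : ρ ^ 2 * (C1 + R + 1) ≤ l / 48 := by
      exact (mul_le_mul_of_nonneg_right hρ21 (by positivity)).trans hρl
    calc C1 + R + 1 = ρ ^ 2 * (C1 + R + 1) * r := by linear_combination -(C1 + R + 1) * hρr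
      _ ≤ l / 48 * r := mul_le_mul_of_nonneg_right h1 hrR.le
  have hJ4 := hJ (N - 4 * r) (by omega)
  have h4 : ((N - 4 * r : ℕ) : ℝ) = N - 4 * r := by
    rw [Nat.cast_sub (by omega)]; push_cast; ring
  rw [h4, sub_sub_cancel] at hJ4
  obtain ⟨hout, hsumF⟩ := packetAmp_window (N := N) (a := a) hχ hl0 hl hr hN hκp.le hκ1' hc
    hlam34 hlaml hJ4 (hwin (N - 4 * r) (by omega) (by omega)).1 hsmall
  have hdiff : ∀ m ∈ Finset.range N, ‖Ts m + Ms m‖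
      ≤ A1 * (c0 / 2 / (CK' * A1)) * ρ ^ 2 + (B1 + B2) * ρ ^ 3 := by
    intro m hm
    rw [Finset.mem_range] at hm
    have hcast : ((N - 1 - m : ℕ) : ℝ) + 1 = (N : ℝ) - m := by
      have : N - 1 - m + 1 = N - m := by omega
      rw [← Nat.cast_sub hm.le, ← this]; push_cast; ring
    -- Outside the window the main term is zero and the weight near the shock is exponentially
    -- small; inside, the weight is the explicit wave.
    by_cases hw : N < m + 2 * r ∨ m + 6 * r < N
    · have hM0 : Ms m = 0 := by
        simp only [hMs, hF]; rw [hout m hm hw]; simp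
      rw [hM0, add_zero]
      have hfar : ∀ j : ℤ, |j - J m| ≤ R →
          ‖(avg ^ (N - 1 - m)) (packetWeight χ r c κ) j‖
            ≤ B0 * ρ ^ 2 * Real.exp (-(l ^ 2 / 12 * r) + l * (C1 + R + 3)) := by
        intro j hj
        refine norm_avg_pow_packetWeight_far hχ hl0 hrR hB hC1 hl hc (Jm := J m) (N - 1 - m)
          ?_ j ?_ ?_
        · rw [hcast]; exact hJ m hm.le
        · exact_mod_cast hj
        · rw [hcast]
          rcases hw with hw | hw
          · left
            have : (N : ℝ) < m + 2 * r := by exact_mod_cast hw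
            linarith
          · right
            have : (m : ℝ) + 6 * r < N := by exact_mod_cast hw
            linarith
      have h1 := norm_source_far_le (by positivity) (hG m)
        (fun j => (hGC m j).trans (hCg' ▸ le_max_left Cg 0)) hfar
      have h2 : Real.exp (-(l ^ 2 / 12 * r) + l * (C1 + R + 3))
          ≤ Real.exp (l * (C1 + R + 3)) * (12 / l ^ 2) * ρ := by
        rw [Real.exp_add, mul_comm, mul_assoc]
        apply mul_le_mul_of_nonneg_left _ (Real.exp_pos _).le
        have hx : 0 < l ^ 2 / 12 * r := by positivity
        have : Real.exp (-(l ^ 2 / 12 * r)) ≤ 1 / (l ^ 2 / 12 * r) := by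
          rw [Real.exp_neg, ← one_div]
          exact one_div_le_one_div_of_le hx (by linarith [Real.add_one_le_exp (l ^ 2 / 12 * r)])
        refine this.trans ?_
        have e : 1 / (l ^ 2 / 12 * r) = 12 / l ^ 2 * ρ ^ 2 := by
          rw [← hrinv]; field_simp
        rw [e]
        exact mul_le_mul_of_nonneg_left hρ21 (by positivity)
      calc ‖Ts m‖ ≤ (2 * R + 3) * (B0 * ρ ^ 2
              * Real.exp (-(l ^ 2 / 12 * r) + l * (C1 + R + 3)) * Cg') := h1
        _ ≤ (2 * R + 3) * (B0 * ρ ^ 2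
              * (Real.exp (l * (C1 + R + 3)) * (12 / l ^ 2) * ρ) * Cg') := by gcongr
        _ = B2 * ρ ^ 3 := by rw [hB2]; ring
        _ ≤ _ := by
          have : 0 ≤ A1 * (c0 / 2 / (CK' * A1)) * ρ ^ 2 := by positivity
          have : 0 ≤ B1 * ρ ^ 3 := by positivity
          linarith
    · push Not at hw
      obtain ⟨hw1, hw2⟩ := hwin m hw.1 hw.2
      have hnear := norm_avg_pow_packetWeight_near (c := c) hχ hL hrR hκp.le (N - 1 - m)
        (lam * m + a)
      have h1 := norm_source_near_le hsupp hCh (hG m)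
        (fun j => norm_avg_pow_le hB (N - 1 - m) j) hnear hw1 hw2
      have e : Ms m = (ew κ - 1) ^ 2 * ((χ ((lam * m + a + ((N - 1 - m : ℕ) : ℝ) / 2 - c) / r)
          * Real.cos (κ / 2) ^ (N - 1 - m) : ℝ) : ℂ)
          * ew (κ * (lam * m + a + ((N - 1 - m : ℕ) : ℝ) / 2))
          * (h (round (lam * m + a) - (lam * m + a)) : ℂ) := by
        rw [mul_assoc _ (ew _), resonant_phase hq hlamε hres hm]
        simp only [hMs, hF, packetAmp, Complex.real_smul]
        ring
      rw [← e] at h1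
      have hs6 : ((N - 1 - m : ℕ) : ℝ) ≤ 6 * r := by
        have : N - 1 - m ≤ 6 * r := by omega
        exact_mod_cast this
      have hκs : κ ^ 2 * ((N - 1 - m : ℕ) : ℝ) ≤ 6 * k2 ^ 2 := by
        calc κ ^ 2 * ((N - 1 - m : ℕ) : ℝ) ≤ k2 ^ 2 * ρ ^ 2 * (6 * r) := by gcongr
          _ = 6 * k2 ^ 2 := by linear_combination 6 * k2 ^ 2 * hρr
      have hE : (1 + κ ^ 2 * ((N - 1 - m : ℕ) : ℝ)) * (L / (r : ℝ) ^ 2 + 2 * κ * L / r)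
          + κ ^ 2 * (L / r + κ) ≤ ((1 + 6 * k2 ^ 2) * Cd + k2 ^ 2 * (L + k2)) * ρ ^ 3 := by
        have t1 : (1 + κ ^ 2 * ((N - 1 - m : ℕ) : ℝ)) * (L / (r : ℝ) ^ 2 + 2 * κ * L / r)
            ≤ (1 + 6 * k2 ^ 2) * (Cd * ρ ^ 3) := by
          gcongr
        have t2 : L / r + κ ≤ (L + k2) * ρ := by
          rw [div_eq_mul_one_div, hrinv, add_mul]
          linarith [mul_le_mul_of_nonneg_left hρ21 hL]
        have t3 : κ ^ 2 * (L / r + κ) ≤ k2 ^ 2 * ρ ^ 2 * ((L + k2) * ρ) := by gcongr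
        linarith [show (1 + 6 * k2 ^ 2) * (Cd * ρ ^ 3) + k2 ^ 2 * ρ ^ 2 * ((L + k2) * ρ)
          = ((1 + 6 * k2 ^ 2) * Cd + k2 ^ 2 * (L + k2)) * ρ ^ 3 by ring]
      refine h1.trans ?_
      have t4 := mul_le_mul_of_nonneg_right hE hCh0
      have t5 : 0 ≤ B2 * ρ ^ 3 := by positivity
      have t6 : ((1 + 6 * k2 ^ 2) * Cd + k2 ^ 2 * (L + k2)) * ρ ^ 3 * Ch = B1 * ρ ^ 3 := by
        rw [hB1]; ring
      have t7 : (2 * R + 3 : ℝ) * (B0 * ρ ^ 2 * (c0 / 2 / (CK' * A1)))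
          = A1 * (c0 / 2 / (CK' * A1)) * ρ ^ 2 := by rw [hA1]; ring
      linarith
  have hsumdiff : ‖∑ m ∈ Finset.range N, Ts m + ∑ m ∈ Finset.range N, Ms m‖
      ≤ c0 / 2 + CK' * (B1 + B2) * ρ := by
    rw [← Finset.sum_add_distrib]
    refine (norm_sum_le_card_mul _ _ hdiff).trans ?_
    rw [Finset.card_range]
    calc (N : ℝ) * (A1 * (c0 / 2 / (CK' * A1)) * ρ ^ 2 + (B1 + B2) * ρ ^ 3)
        ≤ CK' * r * (A1 * (c0 / 2 / (CK' * A1)) * ρ ^ 2 + (B1 + B2) * ρ ^ 3) := by gcongr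
      _ = (c0 / 2 + CK' * (B1 + B2) * ρ) * (ρ ^ 2 * r) := by field_simp
      _ = _ := by rw [hρr, mul_one]
  -- lower bound of the main part
  have hD : ∀ m, |F (m + 1) - F m| ≤ (L + k2 ^ 2) * ρ ^ 2 := by
    intro m
    refine (abs_packetAmp_sub_le hχ hL hrR hκp.le hκ1' (by linarith) (by linarith) m).trans ?_
    rw [div_eq_mul_one_div, hrinv, add_mul]
    linarith [sq_nonneg κ]
  have heq := hequi ε a ((L + k2 ^ 2) * ρ ^ 2) N F hεp (abs_packetAmp_le hχ hκp.le hκ1') hD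
  rw [← hlamε] at heq
  have hND : (N : ℝ) * ((L + k2 ^ 2) * ρ ^ 2) ≤ CK' * (L + k2 ^ 2) := by
    calc (N : ℝ) * ((L + k2 ^ 2) * ρ ^ 2) ≤ CK' * r * ((L + k2 ^ 2) * ρ ^ 2) := by gcongr
      _ = CK' * (L + k2 ^ 2) * (ρ ^ 2 * r) := by ring
      _ = _ := by rw [hρr, mul_one]
  have hNε : (N : ℝ) * ε ≤ CK' * c2 / ρ := by
    rw [le_div_iff₀ hρ]
    calc (N : ℝ) * ε * ρ ≤ CK' * r * (c2 * ρ) * ρ := by gcongr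
      _ = CK' * c2 * (ρ ^ 2 * r) := by ring
      _ = _ := by rw [hρr, mul_one]
  have heq2 : κ ^ 2 * ‖∑ m ∈ Finset.range N, F m • (resonantSource h q (lam * m + a) - cf)‖
      ≤ B3 * ρ := by
    calc κ ^ 2 * ‖∑ m ∈ Finset.range N, F m • (resonantSource h q (lam * m + a) - cf)‖
        ≤ k2 ^ 2 * ρ ^ 2 * (Ce * ((1 + CK' * (L + k2 ^ 2)) / (c1 * ρ) + CK' * c2 / ρ)) := by
          apply mul_le_mul hκsq _ (norm_nonneg _) (by positivity)
          refine heq.trans ?_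
          gcongr
      _ = B3 * ρ := by rw [hB3]; field_simp
  have hMsum : ∑ m ∈ Finset.range N, Ms m = (ew κ - 1) ^ 2 * U *
      ((∑ m ∈ Finset.range N, F m : ℝ) • cf
        + ∑ m ∈ Finset.range N, F m • (resonantSource h q (lam * m + a) - cf)) := by
    rw [Finset.sum_smul, ← Finset.sum_add_distrib, Finset.mul_sum]
    refine Finset.sum_congr rfl fun m _ => ?_
    rw [← smul_add, add_sub_cancel]
  set σ := ∑ m ∈ Finset.range N, F m with hσ
  have hσ0 : 0 ≤ σ := Finset.sum_nonneg fun m _ => packetAmp_nonneg hχ hκp.le hκ1' m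
  have hσl : Real.exp (-(2 * k2 ^ 2)) * (r / 8) ≤ σ := by
    refine le_trans ?_ hsumF
    apply mul_le_mul_of_nonneg_right _ (by positivity)
    apply Real.exp_le_exp.2
    have : κ ^ 2 * r ≤ k2 ^ 2 := by
      calc κ ^ 2 * r ≤ k2 ^ 2 * ρ ^ 2 * r := by gcongr
        _ = k2 ^ 2 * (ρ ^ 2 * r) := by ring
        _ = _ := by rw [hρr, mul_one]
    linarith
  have hmain : 2 * c0 - B3 * ρ ≤ ‖∑ m ∈ Finset.range N, Ms m‖ := by
    rw [hMsum, norm_mul, norm_mul, norm_ew, mul_one, norm_pow]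
    set Q := ∑ m ∈ Finset.range N, F m • (resonantSource h q (lam * m + a) - cf)
    have h1 : σ * ‖cf‖ - ‖Q‖ ≤ ‖σ • cf + Q‖ := by
      have := norm_sub_le (σ • cf + Q) Q
      rw [add_sub_cancel_right, norm_smul, Real.norm_of_nonneg hσ0] at this
      linarith
    have h2 := half_mul_le_norm_ew_sub_one hκp.le hκ1'
    have h3 := norm_ew_sub_one_le κ
    rw [abs_of_pos hκp] at h3
    have h4 : κ ^ 2 / 4 ≤ ‖ew κ - 1‖ ^ 2 := by
      calc κ ^ 2 / 4 = (κ / 2) ^ 2 := by ring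
        _ ≤ _ := pow_le_pow_left₀ (by positivity) h2 2
    have h5 : ‖ew κ - 1‖ ^ 2 ≤ κ ^ 2 := pow_le_pow_left₀ (norm_nonneg _) h3 2
    have h6 : 2 * c0 ≤ κ ^ 2 / 4 * (σ * ‖cf‖) := by
      calc 2 * c0 = (k1 * ρ) ^ 2 / 4 * (Real.exp (-(2 * k2 ^ 2)) * (r / 8) * ‖cf‖) := by
            rw [hc0]
            linear_combination (-(k1 ^ 2 / 4 * (Real.exp (-(2 * k2 ^ 2)) * (1 / 8) * ‖cf‖))) * hρr
        _ ≤ κ ^ 2 / 4 * (σ * ‖cf‖) := by gcongr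
    calc 2 * c0 - B3 * ρ ≤ κ ^ 2 / 4 * (σ * ‖cf‖) - κ ^ 2 * ‖Q‖ := by linarith
      _ ≤ ‖ew κ - 1‖ ^ 2 * (σ * ‖cf‖) - ‖ew κ - 1‖ ^ 2 * ‖Q‖ := by gcongr
      _ = ‖ew κ - 1‖ ^ 2 * (σ * ‖cf‖ - ‖Q‖) := by ring
      _ ≤ _ := by gcongr
  have hfin : ‖∑ m ∈ Finset.range N, Ms m‖ ≤ ‖∑ m ∈ Finset.range N, Ts m‖
      + ‖∑ m ∈ Finset.range N, Ts m + ∑ m ∈ Finset.range N, Ms m‖ := by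
    have := norm_sub_le (∑ m ∈ Finset.range N, Ts m + ∑ m ∈ Finset.range N, Ms m)
      (∑ m ∈ Finset.range N, Ts m)
    rw [add_sub_cancel_left] at this
    linarith
  have : CK' * (B1 + B2) * ρ + B3 * ρ ≤ c0 / 2 := by
    have : ρ * BB = CK' * (B1 + B2) * ρ + B3 * ρ + ρ := by rw [hBB]; ring
    linarith
  linarith


/-! ### The linearizing transformation of the scheme for `u` -/

/-- The linear scheme `y^{n+1}_j = (1 - μ) y^n_j + μ y^n_{j-1}`. -/
def linScheme (μ : ℝ) (y0 : ℤ → ℝ) : ℕ → ℤ → ℝ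
  | 0, j => y0 j
  | n + 1, j => (1 - μ) * linScheme μ y0 n j + μ * linScheme μ y0 n (j - 1)

/-- The grid function `log ((1 + y_j) / (1 + y_{j+1}))`. -/
def logRatio (y : ℤ → ℝ) (j : ℤ) : ℝ := Real.log (1 + y j) - Real.log (1 + y (j + 1))

section Scheme

variable {μ : ℝ} {y0 : ℤ → ℝ}

theorem linScheme_nonneg (h0 : 0 < μ) (h1 : μ < 1) (hy : ∀ j, 0 ≤ y0 j) (n : ℕ) (j : ℤ) :
    0 ≤ linScheme μ y0 n j := by
  induction n generalizing j with
  | zero => exact hy j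
  | succ n ih =>
    exact add_nonneg (mul_nonneg (by linarith) (ih j)) (mul_nonneg h0.le (ih _))

/-- The flux is the logarithm of a convex combination of 1 + y_j and 1 + y_{j+1}, relative to 1 +
y_{j+1}. Hence f(u_j) is exactly the increment in time of log(1 + y) at j + 1. -/
theorem laxFlux_logRatio (h0 : 0 < μ) (h1 : μ < 1) {y : ℤ → ℝ} (hy : ∀ j, 0 ≤ y j) (j : ℤ) :
    laxFlux μ (logRatio y j)
      = Real.log (1 + ((1 - μ) * y (j + 1) + μ * y j)) - Real.log (1 + y (j + 1)) := by
  have p1 : 0 < 1 + y j := by linarith [hy j]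
  have p2 : 0 < 1 + y (j + 1) := by linarith [hy (j + 1)]
  rw [laxFlux, logRatio, Real.exp_sub, Real.exp_log p1, Real.exp_log p2, ← Real.log_div _ p2.ne']
  · congr 1; field_simp; ring
  · have := mul_nonneg (by linarith : 0 ≤ 1 - μ) (hy (j + 1))
    have := mul_nonneg h0.le (hy j)
    linarith

/-- Discrete Hopf-Cole transformation: f(u_{j-1}) and f(u_j) are the time increments of log(1 + y)
at j and j + 1, so the scheme for u is the difference of two identities. Working with y instead of 1
+ y removes the constant solution, which corresponds to the right state 0. -/
theorem godunovGridU_eq (h0 : 0 < μ) (h1 : μ < 1) (hy : ∀ j, 0 ≤ y0 j) {u₀ : ℝ → ℝ}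
    (hu : ∀ j : ℤ, ∫ x in (j : ℝ)..(j + 1 : ℝ), u₀ x = logRatio y0 j) (n : ℕ) (j : ℤ) :
    godunovGridU (laxFlux μ) u₀ n j = logRatio (linScheme μ y0 n) j := by
  induction n generalizing j with
  | zero => rw [godunovGridU, hu]; rfl
  | succ n ih =>
    have hp := linScheme_nonneg h0 h1 hy n
    rw [godunovGridU, ih, ih, laxFlux_logRatio h0 h1 hp, laxFlux_logRatio h0 h1 hp]
    simp only [logRatio, linScheme]
    rw [show j - 1 + 1 = j by ring, show j + 1 - 1 = j by ring]
    ring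

/-- Each exp(B - s j + n f(s)) solves the linear scheme exactly, since e^{f(s)} = 1 - μ + μ e^s, and
the scheme is monotone, so comparison persists in time. One main exponential and three corrections
are what the barrier for an affine piece requires. -/
theorem linScheme_exp_lower (h0 : 0 < μ) (h1 : μ < 1) {A A1 A2 A3 t t1 t2 t3 : ℝ}
    (h : ∀ j : ℤ, Real.exp (A - t * j) - Real.exp (A1 - t1 * j) - Real.exp (A2 - t2 * j)
      - Real.exp (A3 - t3 * j) ≤ y0 j) (n : ℕ) (j : ℤ) :
    Real.exp (A - t * j + n * laxFlux μ t) - Real.exp (A1 - t1 * j + n * laxFlux μ t1)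
      - Real.exp (A2 - t2 * j + n * laxFlux μ t2) - Real.exp (A3 - t3 * j + n * laxFlux μ t3)
      ≤ linScheme μ y0 n j := by
  induction n generalizing j with
  | zero => simpa [linScheme] using h j
  | succ n ih =>
    have key : ∀ B s : ℝ, Real.exp (B - s * j + (n + 1 : ℕ) * laxFlux μ s)
        = (1 - μ) * Real.exp (B - s * j + n * laxFlux μ s)
          + μ * Real.exp (B - s * (j - 1 : ℤ) + n * laxFlux μ s) := by
      intro B s
      have e1 : B - s * j + (n + 1 : ℕ) * laxFlux μ s
          = (B - s * j + n * laxFlux μ s) + laxFlux μ s := by push_cast; ring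
      have e2 : B - s * (j - 1 : ℤ) + n * laxFlux μ s = (B - s * j + n * laxFlux μ s) + s := by
        push_cast; ring
      rw [e1, e2, Real.exp_add _ (laxFlux μ s), exp_laxFlux h0 h1, Real.exp_add _ s]
      ring
    rw [key, key, key, key, linScheme]
    have i1 := mul_le_mul_of_nonneg_left (ih j) (by linarith : 0 ≤ 1 - μ)
    have i2 := mul_le_mul_of_nonneg_left (ih (j - 1)) h0.le
    linarith

theorem linScheme_exp_upper (h0 : 0 < μ) (h1 : μ < 1) {A t : ℝ}
    (h : ∀ j : ℤ, y0 j ≤ Real.exp (A - t * j)) (n : ℕ) (j : ℤ) :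
    linScheme μ y0 n j ≤ Real.exp (A - t * j + n * laxFlux μ t) := by
  induction n generalizing j with
  | zero => simpa [linScheme] using h j
  | succ n ih =>
    have e1 : A - t * j + (n + 1 : ℕ) * laxFlux μ t
        = (A - t * j + n * laxFlux μ t) + laxFlux μ t := by push_cast; ring
    have e2 : A - t * (j - 1 : ℤ) + n * laxFlux μ t = (A - t * j + n * laxFlux μ t) + t := by
      push_cast; ring
    have i1 := mul_le_mul_of_nonneg_left (ih j) (by linarith : 0 ≤ 1 - μ)
    have i2 := mul_le_mul_of_nonneg_left (ih (j - 1)) h0.le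
    rw [e2, Real.exp_add] at i2
    rw [e1, Real.exp_add, exp_laxFlux h0 h1, linScheme]
    linarith

/-! ### Localization of the discrete shock -/

/-- Two-sided bounds on the exponential growth of a grid function to the left. -/
structure IsShockProfile (a b : ℝ) (y : ℤ → ℝ) : Prop where
  nonneg : ∀ j, 0 ≤ y j
  lower : ∀ j, Real.exp a * y j ≤ y (j - 1)
  upper : ∀ j, 1 + y (j - 1) ≤ Real.exp b * (1 + y j)

/-- The growth bounds are linear inequalities between neighbouring values of y or of 1 + y, hence
stable under a translation invariant convex combination. -/
theorem IsShockProfile.linScheme (h0 : 0 < μ) (h1 : μ < 1) {a b : ℝ}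
    (h : IsShockProfile a b y0) (n : ℕ) : IsShockProfile a b (linScheme μ y0 n) := by
  have hm : 0 ≤ 1 - μ := by linarith
  induction n with
  | zero => exact h
  | succ n ih =>
    refine ⟨fun j => linScheme_nonneg h0 h1 h.nonneg _ j, fun j => ?_, fun j => ?_⟩
    · have e1 := mul_le_mul_of_nonneg_left (ih.lower j) hm
      have e2 := mul_le_mul_of_nonneg_left (ih.lower (j - 1)) h0.le
      simp only [_root_.linScheme]
      nlinarith
    · have e1 := mul_le_mul_of_nonneg_left (ih.upper j) hm
      have e2 := mul_le_mul_of_nonneg_left (ih.upper (j - 1)) h0.le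
      simp only [_root_.linScheme]
      nlinarith

variable {a b : ℝ} {y : ℤ → ℝ}

theorem IsShockProfile.exp_mul_le (h : IsShockProfile a b y) (i : ℕ) (j : ℤ) :
    Real.exp (a * i) * y j ≤ y (j - i) := by
  induction i with
  | zero => simp
  | succ i ih =>
    have := h.lower (j - i)
    have e : Real.exp (a * (i + 1 : ℕ)) = Real.exp a * Real.exp (a * i) := by
      rw [← Real.exp_add]; push_cast; ring_nf
    rw [e, mul_assoc, show j - ((i + 1 : ℕ) : ℤ) = j - i - 1 by push_cast; ring]
    exact (mul_le_mul_of_nonneg_left ih (Real.exp_pos a).le).trans this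

theorem IsShockProfile.one_add_le (h : IsShockProfile a b y) (i : ℕ) (j : ℤ) :
    1 + y (j - i) ≤ Real.exp (b * i) * (1 + y j) := by
  induction i with
  | zero => simp
  | succ i ih =>
    have := h.upper (j - i)
    have e : Real.exp (b * (i + 1 : ℕ)) = Real.exp b * Real.exp (b * i) := by
      rw [← Real.exp_add]; push_cast; ring_nf
    rw [e, mul_assoc, show j - ((i + 1 : ℕ) : ℤ) = j - i - 1 by push_cast; ring]
    exact this.trans (mul_le_mul_of_nonneg_left ih (Real.exp_pos b).le)

theorem IsShockProfile.antitone (h : IsShockProfile a b y) (ha : 0 ≤ a) {i j : ℤ} (hij : i ≤ j) :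
    y j ≤ y i := by
  obtain ⟨k, hk⟩ := Int.eq_ofNat_of_zero_le (sub_nonneg.2 hij)
  have h1 := h.exp_mul_le k j
  rw [show j - (k : ℤ) = i by omega] at h1
  exact (le_mul_of_one_le_left (h.nonneg j) (Real.one_le_exp (by positivity))).trans h1

theorem IsShockProfile.exists_crossing (h : IsShockProfile a b y) (ha : 0 < a) {j₁ j₂ : ℤ}
    (hj₁ : 0 < y j₁) (hj₂ : y j₂ < 1) : ∃ J : ℤ, 1 ≤ y J ∧ y (J + 1) < 1 := by
  obtain ⟨i, hi⟩ : ∃ i : ℕ, 1 ≤ Real.exp (a * i) * y j₁ := by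
    obtain ⟨i, hi⟩ := exists_nat_ge (1 / y j₁ / a)
    refine ⟨i, ?_⟩
    rw [div_le_iff₀ ha, div_le_iff₀ hj₁] at hi
    have := Real.add_one_le_exp (a * i)
    nlinarith
  have hne : ∃ j : ℤ, 1 ≤ y j := ⟨_, hi.trans (h.exp_mul_le i j₁)⟩
  obtain ⟨J, hJ1, hJ2⟩ := Int.exists_greatest_of_bdd (P := fun j => 1 ≤ y j)
    ⟨j₂, fun z hz => by
      by_contra hn
      exact absurd (hz.trans (h.antitone ha.le (not_le.1 hn).le)) (not_le.2 hj₂)⟩ hne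
  exact ⟨J, hJ1, by
    by_contra hn
    have := hJ2 (J + 1) (not_lt.1 hn)
    omega⟩

theorem IsShockProfile.logRatio_le (h : IsShockProfile a b y) (j : ℤ) : logRatio y j ≤ y j := by
  have h1 := h.nonneg j
  have h2 := h.nonneg (j + 1)
  have h3 := Real.log_le_sub_one_of_pos (by linarith : 0 < 1 + y j)
  have h4 : 0 ≤ Real.log (1 + y (j + 1)) := Real.log_nonneg (by linarith)
  rw [logRatio]; linarith

theorem IsShockProfile.le_logRatio (h : IsShockProfile a b y) {j : ℤ} (hj : 0 < y (j + 1)) :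
    a - 1 / y (j + 1) ≤ logRatio y j := by
  have h1 := h.lower (j + 1)
  rw [add_sub_cancel_right] at h1
  have h2 : a + Real.log (y (j + 1)) ≤ Real.log (1 + y j) := by
    have : a + Real.log (y (j + 1)) = Real.log (Real.exp a * y (j + 1)) := by
      rw [Real.log_mul (Real.exp_pos a).ne' hj.ne', Real.log_exp]
    rw [this]
    exact Real.log_le_log (by positivity) (by linarith)
  have h3 : Real.log (1 + y (j + 1)) - Real.log (y (j + 1)) ≤ 1 / y (j + 1) := by
    rw [← Real.log_div (by linarith) hj.ne']
    have := Real.log_le_sub_one_of_pos (by positivity : 0 < (1 + y (j + 1)) / y (j + 1))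
    have e : (1 + y (j + 1)) / y (j + 1) - 1 = 1 / y (j + 1) := by field_simp; ring
    linarith
  rw [logRatio]; linarith

/-- A source vanishing near the end states acts only near the shock. -/
theorem IsShockProfile.source_localized (h : IsShockProfile a b y) {a0 g1 g2 : ℝ} (ha0 : 0 < a0)
    (ha : a0 ≤ a) {g : ℝ → ℝ} (hg : ∀ u, g u ≠ 0 → g1 < u ∧ u < g2) {R : ℕ}
    (hR1 : Real.exp (-(a0 * R)) ≤ g1) (hR2 : Real.exp (-(a0 * R)) ≤ a0 - g2) {J : ℤ}
    (hJ1 : 1 ≤ y J) (hJ2 : y (J + 1) < 1) (j : ℤ) (hj : g (logRatio y j) ≠ 0) :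
    |j - J| ≤ R := by
  have ha' : 0 ≤ a := by linarith
  obtain ⟨hu1, hu2⟩ := hg _ hj
  have hmul : a0 * R ≤ a * R := mul_le_mul_of_nonneg_right ha (Nat.cast_nonneg R)
  rw [abs_le]
  -- More than R cells behind the crossing y is at least e^{a0 R}, which forces u above g2. More
  -- than R cells ahead u ≤ y ≤ e^{-a0 R} ≤ g1. The source vanishes in both cases.
  constructor
  · by_contra hn
    have h1 : j + 1 ≤ J - R := by omega
    have h2 := h.exp_mul_le R J
    have h3 := h.antitone ha' h1
    have h4 : Real.exp (a0 * R) ≤ y (j + 1) :=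
      calc Real.exp (a0 * R) ≤ Real.exp (a * R) := Real.exp_le_exp.2 hmul
        _ ≤ Real.exp (a * R) * y J := le_mul_of_one_le_right (Real.exp_pos _).le hJ1
        _ ≤ _ := h2.trans h3
    have hpos : 0 < y (j + 1) := lt_of_lt_of_le (Real.exp_pos _) h4
    have h5 := h.le_logRatio hpos
    have h6 : 1 / y (j + 1) ≤ Real.exp (-(a0 * R)) := by
      rw [Real.exp_neg, ← one_div]
      exact one_div_le_one_div_of_le (Real.exp_pos _) h4
    linarith
  · by_contra hn
    have h1 : J + 1 + R ≤ j := by omega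
    have h2 := h.exp_mul_le R (J + 1 + R)
    rw [add_sub_cancel_right] at h2
    have h3 := h.antitone ha' h1
    have h4 := h.logRatio_le j
    have h5 : y (J + 1 + R) ≤ Real.exp (-(a0 * R)) := by
      have h6 : Real.exp (a0 * R) * y (J + 1 + R) ≤ 1 :=
        (mul_le_mul_of_nonneg_right (Real.exp_le_exp.2 hmul) (h.nonneg _)).trans
          (h2.trans hJ2.le)
      rw [Real.exp_neg, ← one_div, le_div_iff₀ (Real.exp_pos _)]
      linarith
    linarith

/-- The discrete shock moves with nearly constant speed. -/
theorem crossing_speed (h0 : 0 < μ) (h1 : μ < 1) (h : IsShockProfile a b y0) (ha : 0 < a)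
    (hb : 0 < b) {J : ℕ → ℤ} (hJ1 : ∀ n, 1 ≤ linScheme μ y0 n (J n))
    (hJ2 : ∀ n, linScheme μ y0 n (J n + 1) < 1) (m k : ℕ) :
    laxFlux μ a / b * k - (1 / b + 1) ≤ (J (m + k) : ℝ) - J m ∧
      (J (m + k) : ℝ) - J m ≤ laxFlux μ b / a * k + (1 / a + 1) := by
  set y := linScheme μ y0 with hy
  have hprof : ∀ n, IsShockProfile a b (y n) := fun n => h.linScheme h0 h1 n
  have hfa : 0 < laxFlux μ a := by
    have := strictMono_laxFlux h0 h1 ha; rwa [laxFlux_zero] at this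
  have hfb : 0 < laxFlux μ b := by
    have := strictMono_laxFlux h0 h1 hb; rwa [laxFlux_zero] at this
  -- One time step multiplies y by at least e^{f(a)} and 1 + y by at most e^{f(b)}; these rates,
  -- divided by the spatial rates, bound the speed.
  have g1 : ∀ (k : ℕ) j, Real.exp (laxFlux μ a * k) * y m j ≤ y (m + k) j := by
    intro k j
    induction k with
    | zero => simp
    | succ k ih =>
      have e : Real.exp (laxFlux μ a * (k + 1 : ℕ))
          = Real.exp (laxFlux μ a) * Real.exp (laxFlux μ a * k) := by
        rw [← Real.exp_add]; push_cast; ring_nf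
      rw [e, mul_assoc]
      refine (mul_le_mul_of_nonneg_left ih (Real.exp_pos _).le).trans ?_
      have e2 : y (m + (k + 1)) j = (1 - μ) * y (m + k) j + μ * y (m + k) (j - 1) := rfl
      rw [e2, exp_laxFlux h0 h1]
      nlinarith [(hprof (m + k)).lower j]
  have g2 : ∀ (k : ℕ) j, 1 + y (m + k) j ≤ Real.exp (laxFlux μ b * k) * (1 + y m j) := by
    intro k j
    induction k with
    | zero => simp
    | succ k ih =>
      have e : Real.exp (laxFlux μ b * (k + 1 : ℕ))
          = Real.exp (laxFlux μ b) * Real.exp (laxFlux μ b * k) := by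
        rw [← Real.exp_add]; push_cast; ring_nf
      rw [e, mul_assoc]
      refine le_trans ?_ (mul_le_mul_of_nonneg_left ih (Real.exp_pos _).le)
      have e2 : y (m + (k + 1)) j = (1 - μ) * y (m + k) j + μ * y (m + k) (j - 1) := rfl
      rw [e2, exp_laxFlux h0 h1]
      nlinarith [(hprof (m + k)).upper j]
  have hlog2 : Real.exp 1 ≥ 2 := by linarith [Real.add_one_le_exp (1 : ℝ)]
  constructor
  · have hk1 := g1 k (J m)
    -- For short times the growth does not yet compensate the 1 in 1 + y, but then it suffices that
    -- the crossing does not move backwards.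
    by_cases hsmall : laxFlux μ a * k < 1
    · have h3 : 1 ≤ y (m + k) (J m) :=
        (hJ1 m).trans ((le_mul_of_one_le_left ((hprof m).nonneg _)
          (Real.one_le_exp (by positivity))).trans hk1)
      have h4 : J m ≤ J (m + k) := by
        by_contra hn
        have := (hprof (m + k)).antitone ha.le (by omega : J (m + k) + 1 ≤ J m)
        linarith [hJ2 (m + k)]
      have h5 : (J m : ℝ) ≤ J (m + k) := by exact_mod_cast h4
      have h6 : laxFlux μ a / b * k ≤ 1 / b := by
        rw [div_mul_eq_mul_div]; exact div_le_div_of_nonneg_right hsmall.le hb.le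
      linarith
    · push Not at hsmall
      -- Moving i cells ahead costs at most a factor e^{b i}, and a factor e ≥ 2 is kept in reserve
      -- to pass from 1 + y to y.
      set i := ⌊(laxFlux μ a * k - 1) / b⌋₊ with hi
      have hi1 : (i : ℝ) ≤ (laxFlux μ a * k - 1) / b := Nat.floor_le (by
        apply div_nonneg _ hb.le; linarith)
      have hi2 := Nat.lt_floor_add_one ((laxFlux μ a * k - 1) / b)
      rw [← hi] at hi2
      have h3 := (hprof (m + k)).one_add_le i (J m + i)
      rw [add_sub_cancel_right] at h3
      have h4 : Real.exp (laxFlux μ a * k) ≤ 1 + y (m + k) (J m) := by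
        have := le_mul_of_one_le_right (Real.exp_pos (laxFlux μ a * k)).le (hJ1 m)
        linarith
      have h5 : 1 ≤ y (m + k) (J m + i) := by
        have h6 : Real.exp 1 * Real.exp (b * i) ≤ Real.exp (laxFlux μ a * k) := by
          rw [← Real.exp_add]
          apply Real.exp_le_exp.2
          rw [le_div_iff₀ hb] at hi1
          linarith
        have h7 : Real.exp (b * i) * Real.exp 1
            ≤ Real.exp (b * i) * (1 + y (m + k) (J m + i)) := by linarith
        have h8 := le_of_mul_le_mul_left h7 (Real.exp_pos _)
        linarith
      have h6 : J m + i ≤ J (m + k) := by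
        by_contra hn
        have := (hprof (m + k)).antitone ha.le (by omega : J (m + k) + 1 ≤ J m + i)
        linarith [hJ2 (m + k)]
      have h7 : (J m : ℝ) + i ≤ J (m + k) := by exact_mod_cast h6
      have h8 : (laxFlux μ a * k - 1) / b = laxFlux μ a / b * k - 1 / b := by ring
      linarith
  · set i := ⌈(laxFlux μ b * k + 1) / a⌉₊ with hi
    have hi1 : (laxFlux μ b * k + 1) / a ≤ i := Nat.le_ceil _
    have hi2 := Nat.ceil_lt_add_one (by positivity : 0 ≤ (laxFlux μ b * k + 1) / a)
    rw [← hi] at hi2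
    have h3 := (hprof (m + k)).exp_mul_le i (J m + 1 + i)
    rw [add_sub_cancel_right] at h3
    have h4 := g2 k (J m + 1)
    have h5 : y (m + k) (J m + 1 + i) < 1 := by
      rw [div_le_iff₀ ha] at hi1
      have h6 : Real.exp (laxFlux μ b * k) * 2 ≤ Real.exp (a * i) := by
        calc Real.exp (laxFlux μ b * k) * 2 ≤ Real.exp (laxFlux μ b * k) * Real.exp 1 := by gcongr
          _ = Real.exp (laxFlux μ b * k + 1) := (Real.exp_add _ _).symm
          _ ≤ _ := Real.exp_le_exp.2 (by linarith)
      have h7 : Real.exp (laxFlux μ b * k) * (1 + y m (J m + 1))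
          ≤ Real.exp (laxFlux μ b * k) * 2 := by
        apply mul_le_mul_of_nonneg_left _ (Real.exp_pos _).le
        linarith [hJ2 m]
      have h8 : Real.exp (a * i) * y (m + k) (J m + 1 + i) < Real.exp (a * i) * 1 := by linarith
      exact lt_of_mul_lt_mul_left h8 (Real.exp_pos _).le
    have h6 : J (m + k) < J m + 1 + i := by
      by_contra hn
      have := (hprof (m + k)).antitone ha.le (not_lt.1 hn)
      linarith [hJ1 (m + k)]
    have h7 : (J (m + k) : ℝ) ≤ J m + i := by
      have : J (m + k) ≤ J m + i := by omega
      exact_mod_cast this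
    have h8 : (laxFlux μ b * k + 1) / a = laxFlux μ b / a * k + 1 / a := by ring
    linarith

/-! ### Comparison with the travelling profile -/

/-- The travelling discrete shock profile with left state `t`. -/
def shockProfile (t x : ℝ) : ℝ :=
  Real.log (1 + Real.exp (-(t * x))) - Real.log (1 + Real.exp (-(t * (x + 1))))

theorem abs_softplus_sub_le (x z : ℝ) :
    |Real.log (1 + Real.exp x) - Real.log (1 + Real.exp z)| ≤ |x - z| := by
  wlog hxz : z ≤ x generalizing x z
  · rw [abs_sub_comm, abs_sub_comm x]; exact this z x (by linarith)
  have p1 := Real.exp_pos x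
  have p2 := Real.exp_pos z
  rw [abs_of_nonneg (sub_nonneg.2 (Real.log_le_log (by linarith)
    (by linarith [Real.exp_le_exp.2 hxz]))), abs_of_nonneg (sub_nonneg.2 hxz)]
  have h1 : 1 + Real.exp x ≤ Real.exp (x - z) * (1 + Real.exp z) := by
    rw [mul_add, ← Real.exp_add, mul_one, sub_add_cancel]
    linarith [Real.one_le_exp (sub_nonneg.2 hxz)]
  have h2 := Real.log_le_log (by linarith) h1
  rw [Real.log_mul (Real.exp_pos _).ne' (by linarith), Real.log_exp] at h2
  linarith

theorem abs_shockProfile_sub_le (t t' x : ℝ) :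
    |shockProfile t x - shockProfile t' x| ≤ (|x| + |x + 1|) * |t - t'| := by
  have h1 := abs_softplus_sub_le (-(t * x)) (-(t' * x))
  have h2 := abs_softplus_sub_le (-(t * (x + 1))) (-(t' * (x + 1)))
  rw [show -(t * x) - -(t' * x) = -(x * (t - t')) by ring, abs_neg, abs_mul] at h1
  rw [show -(t * (x + 1)) - -(t' * (x + 1)) = -((x + 1) * (t - t')) by ring, abs_neg, abs_mul]
    at h2
  have e : shockProfile t x - shockProfile t' x
      = (Real.log (1 + Real.exp (-(t * x))) - Real.log (1 + Real.exp (-(t' * x))))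
        - (Real.log (1 + Real.exp (-(t * (x + 1)))) - Real.log (1 + Real.exp (-(t' * (x + 1))))) := by
    simp only [shockProfile]; ring
  rw [e]
  refine (abs_sub _ _).trans ?_
  linarith

theorem abs_log_one_add_sub_le {x z e : ℝ} (hx : 0 ≤ z) (h1 : z * (1 - e) ≤ x) (h2 : x ≤ z)
    (he : 0 ≤ e) (he2 : e ≤ 1 / 2) :
    |Real.log (1 + x) - Real.log (1 + z)| ≤ 2 * e := by
  have hx0 : 0 ≤ x := (mul_nonneg hx (by linarith)).trans h1
  rw [abs_sub_comm, abs_of_nonneg (sub_nonneg.2 (Real.log_le_log (by linarith) (by linarith)))]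
  have h3 : (1 - e) * (1 + z) ≤ 1 + x := by nlinarith
  have h4 := Real.log_le_log (mul_pos (by linarith) (by linarith)) h3
  rw [Real.log_mul (by linarith) (by linarith)] at h4
  have h5 : -(2 * e) ≤ Real.log (1 - e) := by
    have h6 := Real.one_sub_inv_le_log_of_pos (by linarith : 0 < 1 - e)
    have h7 : (1 - e)⁻¹ ≤ 1 + 2 * e := by
      rw [inv_le_iff_one_le_mul₀ (by linarith)]
      nlinarith
    linarith
  linarith

/-- If `y` is close to a pure exponential near the point where that equals one, then the source
is close to the one of the travelling profile. -/
theorem IsShockProfile.source_close (h : IsShockProfile a b y) {a0 t t0 γ e Lg : ℝ} (ha0 : 0 < a0)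
    (ha : a0 ≤ a) (hat : a0 ≤ t) {g : ℝ → ℝ} (hLg : ∀ u w, |g u - g w| ≤ Lg * |u - w|)
    {R : ℕ} (hR : 1 / a0 + 2 ≤ R) {J : ℤ} (hJ1 : 1 ≤ y J) (hJ2 : y (J + 1) < 1)
    (hloc : ∀ j, g (logRatio y j) ≠ 0 → |j - J| ≤ R)
    (hsupp : ∀ x, 1 / 2 ≤ |x| → g (shockProfile t0 x) = 0)
    (hup : ∀ j : ℤ, y j ≤ Real.exp (-(t * (j - γ)))) (he : 0 ≤ e) (he2 : e ≤ 1 / 2)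
    (hlo : ∀ j : ℤ, |(j : ℝ) - γ| ≤ 2 * R + 1 → Real.exp (-(t * (j - γ))) * (1 - e) ≤ y j) :
    |(J : ℝ) - γ| ≤ R ∧ ∀ j : ℤ, |g (logRatio y j) - g (shockProfile t0 (j - γ))|
      ≤ Lg * (4 * e + (4 * R + 1) * |t - t0|) := by
  have hLg0 : 0 ≤ Lg := by
    have := (abs_nonneg _).trans (hLg 0 1)
    simpa using this
  have hR0 : 0 < 1 / a0 := by positivity
  have ht0 : 0 < t := by linarith
  -- At the last integer before γ - 1/a0 the lower bound gives y ≥ e^1/2 ≥ 1, while the upper bound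
  -- gives y < 1 to the right of γ. This locates the crossing.
  have hJγ : |(J : ℝ) - γ| ≤ 1 / a0 + 1 := by
    rw [abs_le]
    constructor
    · set j0 := ⌊γ - 1 / a0⌋ with hj0
      have f1 := Int.floor_le (γ - 1 / a0)
      have f2 := Int.lt_floor_add_one (γ - 1 / a0)
      rw [← hj0] at f1 f2
      have h3 := hlo j0 (by rw [abs_le]; constructor <;> linarith)
      have h4 : Real.exp 1 ≤ Real.exp (-(t * (j0 - γ))) := by
        apply Real.exp_le_exp.2
        have e1 : 1 / a0 * t ≤ (γ - j0) * t := mul_le_mul_of_nonneg_right (by linarith) ht0.le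
        have e2 : 1 ≤ 1 / a0 * t := by
          rw [one_div, inv_mul_eq_div, le_div_iff₀ ha0]; linarith
        linarith
      have h5 : 1 ≤ y j0 := by
        have h6 := Real.add_one_le_exp (1 : ℝ)
        nlinarith
      have h6 : j0 ≤ J := by
        by_contra hn
        have := h.antitone (by linarith) (by omega : J + 1 ≤ j0)
        linarith
      have h7 : (j0 : ℝ) ≤ J := by exact_mod_cast h6
      linarith
    · have h3 := hJ1.trans (hup J)
      rw [← Real.exp_zero, Real.exp_le_exp] at h3
      have : (J : ℝ) - γ ≤ 0 := by
        by_contra hn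
        push Not at hn
        have := mul_pos ht0 hn
        linarith
      linarith
  refine ⟨by linarith, fun j => ?_⟩
  -- Farther from the crossing both sources vanish, so the comparison of exponentials is only needed
  -- on a bounded set of cells.
  by_cases hj : |j - J| ≤ R
  · have hjR : |(j : ℝ) - J| ≤ R := by exact_mod_cast hj
    have hjγ : |(j : ℝ) - γ| ≤ 2 * R - 1 := by
      have := abs_sub_le (j : ℝ) J γ
      linarith
    have hjγ1 : |((j + 1 : ℤ) : ℝ) - γ| ≤ 2 * R := by
      have : ((j + 1 : ℤ) : ℝ) - γ = (j - γ) + 1 := by push_cast; ring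
      rw [this]
      have := abs_add_le ((j : ℝ) - γ) 1
      rw [abs_one] at this
      linarith
    refine (hLg _ _).trans (mul_le_mul_of_nonneg_left ?_ hLg0)
    have l1 := abs_log_one_add_sub_le (Real.exp_pos _).le (hlo j (by linarith)) (hup j) he he2
    have l2 := abs_log_one_add_sub_le (Real.exp_pos _).le (hlo (j + 1) (by linarith))
      (hup (j + 1)) he he2
    have e1 : logRatio y j - shockProfile t (j - γ)
        = (Real.log (1 + y j) - Real.log (1 + Real.exp (-(t * (j - γ)))))
          - (Real.log (1 + y (j + 1)) - Real.log (1 + Real.exp (-(t * ((j + 1 : ℤ) - γ))))) := by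
      simp only [logRatio, shockProfile]
      rw [show ((j + 1 : ℤ) : ℝ) - γ = j - γ + 1 by push_cast; ring]
      ring
    have l3 : |logRatio y j - shockProfile t (j - γ)| ≤ 4 * e := by
      rw [e1]
      refine (abs_sub _ _).trans ?_
      linarith
    have l4 := abs_shockProfile_sub_le t t0 (j - γ)
    have l5 : |(j : ℝ) - γ| + |(j : ℝ) - γ + 1| ≤ 4 * R + 1 := by
      rw [show (j : ℝ) - γ + 1 = ((j + 1 : ℤ) : ℝ) - γ by push_cast; ring]
      linarith
    have l6 := mul_le_mul_of_nonneg_right l5 (abs_nonneg (t - t0))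
    have l7 := abs_sub_le (logRatio y j) (shockProfile t (j - γ)) (shockProfile t0 (j - γ))
    linarith
  · have z1 : g (logRatio y j) = 0 := by
      by_contra hn; exact hj (hloc j hn)
    have z2 : g (shockProfile t0 (j - γ)) = 0 := by
      apply hsupp
      push Not at hj
      have hjR : (R : ℝ) + 1 ≤ |(j : ℝ) - J| := by exact_mod_cast hj
      have := abs_sub_le (j : ℝ) γ J
      rw [abs_sub_comm γ] at this
      linarith
    rw [z1, z2, sub_zero, abs_zero]
    positivity

end Scheme


/-! ### A smooth positive part -/

/-- `sp` is a smooth convex approximation of `max y 0`, exact outside `(-1, 1)`, with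
derivative `st`. -/
structure IsSmoothPos (st sp : ℝ → ℝ) : Prop where
  smooth : ContDiff ℝ ∞ st
  mono : Monotone st
  nonneg : ∀ y, 0 ≤ st y
  le_one : ∀ y, st y ≤ 1
  hasDeriv : ∀ y, HasDerivAt sp (st y) y
  left : ∀ y, y ≤ -1 → sp y = 0
  right : ∀ y, 1 ≤ y → sp y = y
  pos : ∀ y, 0 ≤ sp y
  ge : ∀ y, y ≤ sp y
  bounded : ∀ i : ℕ, ∃ C : ℝ, ∀ y, |iteratedDeriv i st y| ≤ C

theorem bounded_iteratedDeriv_of_step {st : ℝ → ℝ} (hs : ContDiff ℝ ∞ st) {C : ℝ}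
    (hC : ∀ y, |st y| ≤ C) (h0 : ∀ y, y ≤ -1 → st y = 0) (h1 : ∀ y, 1 ≤ y → st y = 1) (i : ℕ) :
    ∃ C : ℝ, ∀ y, |iteratedDeriv i st y| ≤ C := by
  have hd : HasCompactSupport (deriv st) := by
    apply HasCompactSupport.of_support_subset_isCompact (isCompact_Icc (a := (-1 : ℝ)) (b := 1))
    intro y hy
    by_contra hn
    rw [mem_Icc, not_and_or, not_le, not_le] at hn
    apply hy
    rcases hn with hn | hn
    · have : st =ᶠ[𝓝 y] fun _ => 0 := by
        filter_upwards [Iio_mem_nhds hn] with z hz using h0 z (le_of_lt hz)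
      rw [this.deriv_eq]; simp
    · have : st =ᶠ[𝓝 y] fun _ => 1 := by
        filter_upwards [Ioi_mem_nhds hn] with z hz using h1 z (le_of_lt hz)
      rw [this.deriv_eq]; simp
  have hds : ContDiff ℝ ∞ (deriv st) := (contDiff_infty_iff_deriv.1 hs).2
  cases i with
  | zero => exact ⟨C, by simpa using hC⟩
  | succ i =>
    have hcs : HasCompactSupport (iteratedDeriv i (deriv st)) := by
      induction i with
      | zero => simpa using hd
      | succ i ih => rw [iteratedDeriv_succ]; exact ih.deriv
    have hcont : Continuous (iteratedDeriv i (deriv st)) :=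
      hds.continuous_iteratedDeriv i (by exact_mod_cast le_top)
    obtain ⟨C', hC'⟩ := hcont.bounded_above_of_compact_support hcs
    exact ⟨C', fun y => by rw [iteratedDeriv_succ']; exact hC' y⟩

theorem exists_smoothPos : ∃ st sp : ℝ → ℝ, IsSmoothPos st sp := by
  set S := Real.smoothTransition with hS
  have hSc : Continuous S := Real.smoothTransition.continuous
  have hSi : ∀ a b, IntervalIntegrable S volume a b := fun a b => hSc.intervalIntegrable a b
  -- The step is translated so that its integral over [-1, 1] is exactly one; its primitive is then
  -- y itself beyond 1, with no additive constant.
  set z := ∫ t in (0 : ℝ)..1, (1 - S t) with hz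
  have hz0 : 0 ≤ z := intervalIntegral.integral_nonneg (by norm_num) fun t _ => by
    linarith [Real.smoothTransition.le_one t]
  have hz1 : z ≤ 1 := by
    have : z ≤ ∫ t in (0 : ℝ)..1, (1 : ℝ) := intervalIntegral.integral_mono_on (by norm_num)
      ((continuous_const.sub hSc).intervalIntegrable _ _) intervalIntegrable_const
      fun t _ => by linarith [Real.smoothTransition.nonneg t]
    simpa using this
  set st : ℝ → ℝ := fun y => S (y + z) with hst
  have hsm : ContDiff ℝ ∞ st := Real.smoothTransition.contDiff.comp (contDiff_id.add contDiff_const)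
  have hstc : Continuous st := hsm.continuous
  have hst0 : ∀ y, y ≤ -1 → st y = 0 := fun y hy =>
    Real.smoothTransition.zero_of_nonpos (by linarith)
  have hst1 : ∀ y, 1 ≤ y → st y = 1 := fun y hy =>
    Real.smoothTransition.one_of_one_le (by linarith)
  have hn : ∀ y, 0 ≤ st y := fun y => Real.smoothTransition.nonneg _
  have hl : ∀ y, st y ≤ 1 := fun y => Real.smoothTransition.le_one _
  set sp : ℝ → ℝ := fun y => ∫ t in (-1 : ℝ)..y, st t with hsp
  have hder : ∀ y, HasDerivAt sp (st y) y := fun y =>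
    intervalIntegral.integral_hasDerivAt_right (hstc.intervalIntegrable _ _)
      (hstc.stronglyMeasurableAtFilter _ _) hstc.continuousAt
  have hleft : ∀ y, y ≤ -1 → sp y = 0 := by
    intro y hy
    have : sp y = ∫ t in (-1 : ℝ)..y, (0 : ℝ) := by
      apply intervalIntegral.integral_congr
      intro t ht
      rw [uIcc_of_ge hy] at ht
      exact hst0 t ht.2
    simpa using this
  have hsp1 : sp 1 = 1 := by
    have e1 : sp 1 = ∫ t in (-1 + z)..(1 + z), S t := by
      simp only [hsp, hst]
      rw [intervalIntegral.integral_comp_add_right (fun t => S t)]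
    have e2 : ∫ t in (-1 + z)..0, S t = 0 := by
      have : ∫ t in (-1 + z)..0, S t = ∫ t in (-1 + z)..0, (0 : ℝ) := by
        apply intervalIntegral.integral_congr
        intro t ht
        rw [uIcc_of_le (by linarith)] at ht
        exact Real.smoothTransition.zero_of_nonpos ht.2
      rw [this]; simp
    have e3 : ∫ t in (1 : ℝ)..(1 + z), S t = z := by
      have : ∫ t in (1 : ℝ)..(1 + z), S t = ∫ t in (1 : ℝ)..(1 + z), (1 : ℝ) := by
        apply intervalIntegral.integral_congr
        intro t ht
        rw [uIcc_of_le (by linarith)] at ht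
        exact Real.smoothTransition.one_of_one_le ht.1
      rw [this]; simp
    have e4 : ∫ t in (0 : ℝ)..1, S t = 1 - z := by
      rw [hz, intervalIntegral.integral_sub intervalIntegrable_const (hSi _ _)]
      simp
    rw [e1, ← intervalIntegral.integral_add_adjacent_intervals (hSi _ 0) (hSi 0 _),
      ← intervalIntegral.integral_add_adjacent_intervals (hSi 0 1) (hSi 1 _), e2, e3, e4]
    ring
  have hright : ∀ y, 1 ≤ y → sp y = y := by
    intro y hy
    have e : ∫ t in (1 : ℝ)..y, st t = ∫ t in (1 : ℝ)..y, (1 : ℝ) := by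
      apply intervalIntegral.integral_congr
      intro t ht
      rw [uIcc_of_le hy] at ht
      exact hst1 t ht.1
    have : sp y = sp 1 + ∫ t in (1 : ℝ)..y, st t :=
      (intervalIntegral.integral_add_adjacent_intervals (hstc.intervalIntegrable _ _)
        (hstc.intervalIntegrable _ _)).symm
    rw [this, hsp1, e]; simp
  have hmono : Monotone sp := monotone_of_hasDerivAt_nonneg hder (fun y => hn y)
  have hmono2 : Monotone fun y => y - sp y := monotone_of_hasDerivAt_nonneg
    (fun y => (hasDerivAt_id y).sub (hder y)) (fun y => by simpa using hl y)
  refine ⟨st, sp, hsm, ?_, hn, hl, hder, hleft, hright, ?_, ?_,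
    bounded_iteratedDeriv_of_step hsm (C := 1) (fun y => by rw [abs_of_nonneg (hn y)]; exact hl y)
      hst0 hst1⟩
  · intro x y hxy
    exact Real.smoothTransition.monotone (by linarith)
  · intro y
    rcases le_total y (-1) with h | h
    · rw [hleft y h]
    · have := hmono h
      rwa [hleft _ le_rfl] at this
  · intro y
    rcases le_total y 1 with h | h
    · have := hmono2 h
      simp only [hsp1] at this
      linarith
    · rw [hright y h]

/-! ### Grid data generated by a potential -/

/-- The grid function associated with the potential `Φ` of the data on the left half line. -/
def potentialGrid (Φ : ℝ → ℝ) (j : ℤ) : ℝ := if j ≤ 0 then Real.exp (-Φ j) - 1 else 0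

section Potential

variable {Φ u : ℝ → ℝ} {a b uL : ℝ} {φ : ℝ → ℝ}

theorem potential_sub_bounds (hΦ : ∀ x, HasDerivAt Φ (u x) x) (ha : ∀ x, a ≤ u x)
    (hb : ∀ x, u x ≤ b) {x y : ℝ} (hxy : x ≤ y) :
    a * (y - x) ≤ Φ y - Φ x ∧ Φ y - Φ x ≤ b * (y - x) := by
  have m1 : Monotone fun t => Φ t - a * t := monotone_of_hasDerivAt_nonneg
    (fun t => (hΦ t).sub ((hasDerivAt_id t).const_mul a)) (fun t => by simpa using ha t)
  have m2 : Monotone fun t => b * t - Φ t := monotone_of_hasDerivAt_nonneg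
    (fun t => ((hasDerivAt_id t).const_mul b).sub (hΦ t)) (fun t => by simpa using hb t)
  have h1 := m1 hxy
  have h2 := m2 hxy
  simp only at h1 h2
  constructor <;> linarith

theorem isShockProfile_potentialGrid (hΦ : ∀ x, HasDerivAt Φ (u x) x) (hΦ0 : Φ 0 = 0)
    (ha0 : 0 ≤ a) (ha : ∀ x, a ≤ u x) (hb : ∀ x, u x ≤ b) :
    IsShockProfile a b (potentialGrid Φ) := by
  have hab : a ≤ b := (ha 0).trans (hb 0)
  have hnn : ∀ j, 0 ≤ potentialGrid Φ j := by
    intro j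
    rw [potentialGrid]
    split_ifs with hj
    · have hj' : (j : ℝ) ≤ 0 := by exact_mod_cast hj
      have := (potential_sub_bounds hΦ ha hb hj').1
      rw [hΦ0] at this
      have h2 : 0 ≤ -Φ j := by nlinarith
      linarith [Real.one_le_exp h2]
    · exact le_rfl
  have hval : ∀ j : ℤ, j ≤ 0 → 1 + potentialGrid Φ j = Real.exp (-Φ j) := by
    intro j hj; rw [potentialGrid, if_pos hj]; ring
  have hzero : ∀ j : ℤ, 0 ≤ j → potentialGrid Φ j = 0 := by
    intro j hj
    rcases hj.lt_or_eq with h | h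
    · rw [potentialGrid, if_neg (by omega)]
    · rw [← h, potentialGrid, if_pos le_rfl]; simp [hΦ0]
  refine ⟨hnn, fun j => ?_, fun j => ?_⟩
  · by_cases hj : j ≤ 0
    · have e1 := hval j hj
      have e2 := hval (j - 1) (by omega)
      have h1 := (potential_sub_bounds hΦ ha hb (by push_cast; linarith :
        ((j - 1 : ℤ) : ℝ) ≤ j)).1
      have h2 : Real.exp a * Real.exp (-Φ j) ≤ Real.exp (-Φ (j - 1 : ℤ)) := by
        rw [← Real.exp_add]
        apply Real.exp_le_exp.2
        push_cast at h1 ⊢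
        nlinarith
      have h3 := Real.one_le_exp ha0
      nlinarith
    · rw [hzero j (by omega), mul_zero]; exact hnn _
  · by_cases hj : j ≤ 0
    · rw [hval j hj, hval (j - 1) (by omega), ← Real.exp_add]
      have h1 := (potential_sub_bounds hΦ ha hb (by push_cast; linarith :
        ((j - 1 : ℤ) : ℝ) ≤ j)).2
      apply Real.exp_le_exp.2
      push_cast at h1 ⊢
      nlinarith
    · rw [hzero j (by omega), hzero (j - 1) (by omega)]
      simpa using ha0.trans hab

/-- For j ≤ 0 one has log(1 + y_j) = -Φ(j), so the logarithmic ratio is an increment of Φ, which is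
the cell average. The normalization Φ(0) = 0 makes y vanish at 0 and fits with the right state. -/
theorem integral_shockData (hΦ : ∀ x, HasDerivAt Φ (u x) x) (hΦ0 : Φ 0 = 0) (hu : Continuous u)
    (hφ : ∀ x, uL + φ x = u x) (j : ℤ) :
    ∫ x in (j : ℝ)..(j + 1 : ℝ), shockData uL 0 φ x = logRatio (potentialGrid Φ) j := by
  rcases lt_or_ge j 0 with hj | hj
  · have hj1 : (j : ℝ) + 1 ≤ 0 := by exact_mod_cast hj
    have e1 : ∫ x in (j : ℝ)..(j + 1 : ℝ), shockData uL 0 φ x = ∫ x in (j : ℝ)..(j + 1 : ℝ), u x := by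
      apply intervalIntegral.integral_congr_ae
      have : ∀ᵐ x : ℝ, x ≠ 0 := Measure.ae_ne volume 0
      filter_upwards [this] with x hx hmem
      rw [uIoc_of_le (by linarith)] at hmem
      have : x < 0 := lt_of_le_of_ne (hmem.2.trans hj1) hx
      rw [shockData, if_pos this, hφ]
    rw [e1, intervalIntegral.integral_eq_sub_of_hasDerivAt (fun x _ => hΦ x)
      (hu.intervalIntegrable _ _), logRatio, potentialGrid, potentialGrid, if_pos hj.le,
      if_pos (by omega), add_sub_cancel, add_sub_cancel, Real.log_exp, Real.log_exp]
    push_cast; ring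
  · have hj' : (0 : ℝ) ≤ j := by exact_mod_cast hj
    have e1 : ∫ x in (j : ℝ)..(j + 1 : ℝ), shockData uL 0 φ x = ∫ x in (j : ℝ)..(j + 1 : ℝ), (0 : ℝ) := by
      apply intervalIntegral.integral_congr
      intro x hx
      rw [uIcc_of_le (by linarith)] at hx
      exact if_neg (by linarith [hx.1])
    have hz : ∀ i : ℤ, 0 ≤ i → potentialGrid Φ i = 0 := by
      intro i hi
      rcases hi.lt_or_eq with h | h
      · rw [potentialGrid, if_neg (by omega)]
      · rw [← h, potentialGrid, if_pos le_rfl]; simp [hΦ0]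
    rw [e1, logRatio, hz j hj, hz (j + 1) (by omega)]; simp

theorem linScheme_potentialGrid_eq_zero {μ : ℝ} (hΦ0 : Φ 0 = 0) (n : ℕ) (j : ℤ) (hj : n ≤ j) :
    linScheme μ (potentialGrid Φ) n j = 0 := by
  induction n generalizing j with
  | zero =>
    rcases hj.lt_or_eq with h | h
    · rw [linScheme, potentialGrid, if_neg (by simp at h; omega)]
    · rw [← h, linScheme, potentialGrid, if_pos (by simp)]; simp [hΦ0]
  | succ n ih =>
    push_cast at hj
    rw [linScheme, ih j (by omega), ih (j - 1) (by omega)]; simp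

theorem linScheme_pos {μ : ℝ} {y0 : ℤ → ℝ} (h0 : 0 < μ) (h1 : μ < 1) (hy : ∀ j, 0 ≤ y0 j) {j : ℤ}
    (hj : 0 < y0 j) (n : ℕ) : 0 < linScheme μ y0 n j := by
  induction n with
  | zero => exact hj
  | succ n ih =>
    exact add_pos_of_pos_of_nonneg (mul_pos (by linarith) ih)
      (mul_nonneg h0.le (linScheme_nonneg h0 h1 hy n _))

theorem exists_crossings {μ : ℝ} (h0 : 0 < μ) (h1 : μ < 1) (hΦ : ∀ x, HasDerivAt Φ (u x) x)
    (hΦ0 : Φ 0 = 0) (ha0 : 0 < a) (ha : ∀ x, a ≤ u x) (hb : ∀ x, u x ≤ b) :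
    ∃ J : ℕ → ℤ, (∀ n, 1 ≤ linScheme μ (potentialGrid Φ) n (J n)) ∧
      ∀ n, linScheme μ (potentialGrid Φ) n (J n + 1) < 1 := by
  have hprof := isShockProfile_potentialGrid hΦ hΦ0 ha0.le ha hb
  have hpos : 0 < potentialGrid Φ (-1) := by
    rw [potentialGrid, if_pos (by norm_num)]
    have := (potential_sub_bounds hΦ ha hb (by norm_num : (-1 : ℝ) ≤ 0)).1
    rw [hΦ0] at this
    have h2 : 0 < -Φ ((-1 : ℤ) : ℝ) := by push_cast; linarith
    linarith [Real.add_one_le_exp (-Φ ((-1 : ℤ) : ℝ))]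
  have : ∀ n, ∃ J : ℤ, 1 ≤ linScheme μ (potentialGrid Φ) n J ∧
      linScheme μ (potentialGrid Φ) n (J + 1) < 1 := fun n =>
    (hprof.linScheme h0 h1 n).exists_crossing ha0
      (linScheme_pos h0 h1 hprof.nonneg hpos n)
      (by rw [linScheme_potentialGrid_eq_zero hΦ0 n n le_rfl]; norm_num)
  choose J hJ using this
  exact ⟨J, fun n => (hJ n).1, fun n => (hJ n).2⟩

end Potential


/-! ### Smoothed piecewise affine potentials -/

/-- The smoothed convex potential with slopes `θ 0, …, θ K` and nodes `x 0, …, x (K - 1)`. -/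
def blockPotential (sp : ℝ → ℝ) (θ x : ℕ → ℝ) (K : ℕ) (X : ℝ) : ℝ :=
  θ K * X + ∑ k ∈ Finset.range K, (θ (k + 1) - θ k) * sp (x k - X)

/-- The derivative of `blockPotential`. -/
def blockSlope (st : ℝ → ℝ) (θ x : ℕ → ℝ) (K : ℕ) (X : ℝ) : ℝ :=
  θ K - ∑ k ∈ Finset.range K, (θ (k + 1) - θ k) * st (x k - X)

section Block

variable {st sp : ℝ → ℝ} {θ x β : ℕ → ℝ} {K : ℕ}

theorem hasDerivAt_blockPotential (hs : IsSmoothPos st sp) (X : ℝ) :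
    HasDerivAt (blockPotential sp θ x K) (blockSlope st θ x K X) X := by
  have h1 : HasDerivAt (fun X => ∑ k ∈ Finset.range K, (θ (k + 1) - θ k) * sp (x k - X))
      (∑ k ∈ Finset.range K, (θ (k + 1) - θ k) * (st (x k - X) * (-1))) X := by
    apply HasDerivAt.fun_sum
    intro k _
    exact ((hs.hasDeriv (x k - X)).comp X ((hasDerivAt_id X).const_sub (x k))).const_mul _
  have h2 := ((hasDerivAt_id X).const_mul (θ K)).add h1
  refine h2.congr_deriv ?_
  simp only [mul_neg, mul_one, Finset.sum_neg_distrib, blockSlope]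
  ring

theorem contDiff_blockSlope (hs : IsSmoothPos st sp) : ContDiff ℝ ∞ (blockSlope st θ x K) := by
  apply contDiff_const.sub
  apply ContDiff.sum
  intro k _
  exact contDiff_const.mul (hs.smooth.comp (contDiff_const.sub contDiff_id))

theorem monotone_blockSlope (hs : IsSmoothPos st sp) (hθ : Monotone θ) :
    Monotone (blockSlope st θ x K) := by
  intro X Y hXY
  apply sub_le_sub_left
  apply Finset.sum_le_sum
  intro k _
  exact mul_le_mul_of_nonneg_left (hs.mono (by linarith)) (sub_nonneg.2 (hθ k.le_succ))

theorem blockSlope_mem (hs : IsSmoothPos st sp) (hθ : Monotone θ) (X : ℝ) :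
    θ 0 ≤ blockSlope st θ x K X ∧ blockSlope st θ x K X ≤ θ K := by
  have h1 : ∑ k ∈ Finset.range K, (θ (k + 1) - θ k) * st (x k - X)
      ≤ ∑ k ∈ Finset.range K, (θ (k + 1) - θ k) :=
    Finset.sum_le_sum fun k _ => mul_le_of_le_one_right (sub_nonneg.2 (hθ k.le_succ)) (hs.le_one _)
  have h2 : 0 ≤ ∑ k ∈ Finset.range K, (θ (k + 1) - θ k) * st (x k - X) :=
    Finset.sum_nonneg fun k _ => mul_nonneg (sub_nonneg.2 (hθ k.le_succ)) (hs.nonneg _)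
  rw [Finset.sum_range_sub] at h1
  simp only [blockSlope]
  constructor <;> linarith

theorem IsSmoothPos.eq_one (hs : IsSmoothPos st sp) {y : ℝ} (hy : 1 < y) : st y = 1 := by
  refine (hs.hasDeriv y).unique ((hasDerivAt_id y).congr_of_eventuallyEq ?_)
  filter_upwards [Ioi_mem_nhds hy] with z hz using hs.right z (le_of_lt hz)

theorem exists_blockSlope_eq (hs : IsSmoothPos st sp) :
    ∃ X0, ∀ X ≤ X0, blockSlope st θ x K X = θ 0 := by
  refine ⟨-(∑ k ∈ Finset.range K, |x k|) - 2, fun X hX => ?_⟩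
  have h1 : ∑ k ∈ Finset.range K, (θ (k + 1) - θ k) * st (x k - X)
      = ∑ k ∈ Finset.range K, (θ (k + 1) - θ k) := by
    apply Finset.sum_congr rfl
    intro k hk
    have h2 : |x k| ≤ ∑ k ∈ Finset.range K, |x k| :=
      Finset.single_le_sum (f := fun k => |x k|) (fun i _ => abs_nonneg _) hk
    rw [hs.eq_one (by linarith [neg_abs_le (x k)]), mul_one]
  rw [blockSlope, h1, Finset.sum_range_sub]
  ring

/-- The increments of the slopes are nonnegative and sum to θ K - θ 0, so all derivatives are small
with this difference, whatever the number and position of the nodes. -/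
theorem abs_iteratedDeriv_blockSlope_le (hs : IsSmoothPos st sp) (hθ : Monotone θ) (c : ℝ)
    {i : ℕ} (hi : i ≠ 0) {C : ℝ} (hC : ∀ y, |iteratedDeriv i st y| ≤ C) (X : ℝ) :
    |iteratedDeriv i (fun X => blockSlope st θ x K X - c) X| ≤ (θ K - θ 0) * C := by
  have hsm : ∀ k, ContDiff ℝ i fun X => (θ (k + 1) - θ k) * st (x k - X) := fun k =>
    contDiff_const.mul ((hs.smooth.of_le (by exact_mod_cast le_top)).comp
      (contDiff_const.sub contDiff_id))
  have e0 : (fun X => blockSlope st θ x K X - c)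
      = (fun _ : ℝ => θ K - c) - fun X => ∑ k ∈ Finset.range K, (θ (k + 1) - θ k) * st (x k - X) := by
    funext X; simp only [blockSlope, Pi.sub_apply]; ring
  rw [e0, iteratedDeriv_sub contDiffAt_const (ContDiff.sum fun k _ => hsm k).contDiffAt,
    iteratedDeriv_const, if_neg hi, zero_sub, abs_neg,
    iteratedDeriv_fun_sum fun k _ => (hsm k).contDiffAt]
  calc |∑ k ∈ Finset.range K, iteratedDeriv i (fun X => (θ (k + 1) - θ k) * st (x k - X)) X|
      ≤ ∑ k ∈ Finset.range K, |iteratedDeriv i (fun X => (θ (k + 1) - θ k) * st (x k - X)) X| :=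
        Finset.abs_sum_le_sum_abs _ _
    _ ≤ ∑ k ∈ Finset.range K, (θ (k + 1) - θ k) * C := by
        apply Finset.sum_le_sum
        intro k _
        rw [iteratedDeriv_const_mul_field, iteratedDeriv_comp_const_sub, abs_mul,
          abs_of_nonneg (sub_nonneg.2 (hθ k.le_succ))]
        simp only [smul_eq_mul, abs_mul, abs_pow, abs_neg, abs_one, one_pow, one_mul]
        exact mul_le_mul_of_nonneg_left (hC _) (sub_nonneg.2 (hθ k.le_succ))
    _ = (θ K - θ 0) * C := by rw [← Finset.sum_mul, Finset.sum_range_sub]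

/-- The node x_k is where the lines θ_k X - β_k and θ_{k+1} X - β_{k+1} cross, so the summands are
increments of β_i - θ_i X. -/
theorem sum_Ico_slopes (hβ : ∀ j < K, (θ (j + 1) - θ j) * x j = β (j + 1) - β j) (hβK : β K = 0)
    {b : ℕ} (hb : b ≤ K) (X : ℝ) :
    ∑ k ∈ Finset.Ico b K, (θ (k + 1) - θ k) * (x k - X) = (θ b - θ K) * X - β b := by
  have e1 : ∀ k ∈ Finset.Ico b K, (θ (k + 1) - θ k) * (x k - X)
      = (fun i => β i - θ i * X) (k + 1) - (fun i => β i - θ i * X) k := by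
    intro k hk
    have := hβ k (Finset.mem_Ico.1 hk).2
    simp only
    linarith
  rw [Finset.sum_congr rfl e1, Finset.sum_Ico_sub (fun i => β i - θ i * X) hb, hβK]
  ring

/-- As sp(y) ≥ max(y, 0), the smoothed potential dominates the maximum of the affine pieces. No
smoothing error enters the resulting upper bound for y. -/
theorem blockPotential_ge (hs : IsSmoothPos st sp) (hθ : Monotone θ)
    (hβ : ∀ j < K, (θ (j + 1) - θ j) * x j = β (j + 1) - β j) (hβK : β K = 0)
    {b : ℕ} (hb : b ≤ K) (X : ℝ) : θ b * X - β b ≤ blockPotential sp θ x K X := by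
  have h1 := sum_Ico_slopes hβ hβK hb X
  have hd : ∀ k, 0 ≤ θ (k + 1) - θ k := fun k => sub_nonneg.2 (hθ k.le_succ)
  have h2 : ∑ k ∈ Finset.Ico b K, (θ (k + 1) - θ k) * (x k - X)
      ≤ ∑ k ∈ Finset.Ico b K, (θ (k + 1) - θ k) * sp (x k - X) :=
    Finset.sum_le_sum fun k _ => mul_le_mul_of_nonneg_left (hs.ge _) (hd k)
  have h3 : ∑ k ∈ Finset.Ico b K, (θ (k + 1) - θ k) * sp (x k - X)
      ≤ ∑ k ∈ Finset.range K, (θ (k + 1) - θ k) * sp (x k - X) := by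
    rw [Finset.range_eq_Ico]
    exact Finset.sum_le_sum_of_subset_of_nonneg (Finset.Ico_subset_Ico (Nat.zero_le _) le_rfl)
      fun k _ _ => mul_nonneg (hd k) (hs.pos _)
  rw [blockPotential]
  linarith

theorem blockPotential_eq (hs : IsSmoothPos st sp)
    (hβ : ∀ j < K, (θ (j + 1) - θ j) * x j = β (j + 1) - β j) (hβK : β K = 0)
    {b : ℕ} (hb : b ≤ K) {X : ℝ} (hl : ∀ k < b, x k + 1 ≤ X)
    (hr : ∀ k, b ≤ k → k < K → X ≤ x k - 1) : blockPotential sp θ x K X = θ b * X - β b := by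
  have h1 := sum_Ico_slopes hβ hβK hb X
  have h2 : ∑ k ∈ Finset.Ico b K, (θ (k + 1) - θ k) * sp (x k - X)
      = ∑ k ∈ Finset.Ico b K, (θ (k + 1) - θ k) * (x k - X) := by
    apply Finset.sum_congr rfl
    intro k hk
    rw [Finset.mem_Ico] at hk
    rw [hs.right _ (by linarith [hr k hk.1 hk.2])]
  have h3 : ∑ k ∈ Finset.Ico 0 b, (θ (k + 1) - θ k) * sp (x k - X) = 0 := by
    apply Finset.sum_eq_zero
    intro k hk
    rw [hs.left _ (by linarith [hl k (Finset.mem_Ico.1 hk).2]), mul_zero]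
  rw [blockPotential, Finset.range_eq_Ico, ← Finset.sum_Ico_consecutive _ (Nat.zero_le b) hb, h3, h2,
    h1]
  ring

end Block

/-! ### Exponential barriers for affine pieces of the potential -/

section Barrier

variable {μ : ℝ} {Φ : ℝ → ℝ} {t β xl xr : ℝ}

theorem potentialGrid_le_exp (hlow : ∀ X, t * X - β ≤ Φ X) (j : ℤ) :
    potentialGrid Φ j ≤ Real.exp (β - t * j) := by
  rw [potentialGrid]
  split_ifs
  · have : Real.exp (-Φ j) ≤ Real.exp (β - t * j) := Real.exp_le_exp.2 (by linarith [hlow j])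
    linarith
  · positivity

/-- To the left of the affine piece the steeper exponential dominates, to the right the flatter one,
so the combination is negative there. Over the piece itself the last exponential pays for the -1 in
e^{-Φ} - 1. -/
theorem potentialGrid_barrier (hnn : ∀ j, 0 ≤ potentialGrid Φ j)
    (heq : ∀ X, xl ≤ X → X ≤ xr → Φ X = t * X - β) (hxr : xr ≤ 0) {τ τ' : ℝ} (hτ : 0 ≤ τ)
    (hτ' : 0 ≤ τ') (j : ℤ) :
    Real.exp (β - t * j) - Real.exp (β + τ * xl - (t + τ) * j)
      - Real.exp (β - τ * xr - (t - τ) * j) - Real.exp (0 - τ' * j) ≤ potentialGrid Φ j := by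
  have p1 := Real.exp_pos (β + τ * xl - (t + τ) * j)
  have p2 := Real.exp_pos (β - τ * xr - (t - τ) * j)
  have p3 := Real.exp_pos (0 - τ' * j)
  rcases lt_or_ge (j : ℝ) xl with h | h
  · have : Real.exp (β - t * j) ≤ Real.exp (β + τ * xl - (t + τ) * j) :=
      Real.exp_le_exp.2 (by nlinarith)
    linarith [hnn j]
  rcases lt_or_ge xr (j : ℝ) with h' | h'
  · have : Real.exp (β - t * j) ≤ Real.exp (β - τ * xr - (t - τ) * j) :=
      Real.exp_le_exp.2 (by nlinarith)
    linarith [hnn j]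
  have hj0 : (j : ℝ) ≤ 0 := h'.trans hxr
  rw [potentialGrid, if_pos (by exact_mod_cast hj0), heq j h h']
  have : 1 ≤ Real.exp (0 - τ' * j) := Real.one_le_exp (by nlinarith)
  rw [neg_sub]
  linarith

/-- In a region reached only by characteristics from an affine piece of the potential, the
solution of the linear scheme is close to a pure exponential. -/
theorem linScheme_block_lower (h0 : 0 < μ) (h1 : μ < 1) (hnn : ∀ j, 0 ≤ potentialGrid Φ j)
    (heq : ∀ X, xl + 1 ≤ X → X ≤ xr - 1 → Φ X = t * X - β) (hxr : xr ≤ 1) {τ τ' D R γ : ℝ}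
    (ht : 0 ≤ t) (hτ : 0 ≤ τ) (hτ' : 0 ≤ τ') (m : ℕ) (hγ : t * γ = β + m * laxFlux μ t)
    (hD1 : D ≤ γ - xl - m * laxSpeed μ t) (hD2 : D ≤ xr - γ + m * laxSpeed μ t) (j : ℤ)
    (hj : |(j : ℝ) - γ| ≤ R) :
    Real.exp (-(t * (j - γ))) * (1 - (2 * Real.exp (-(τ * (D - 1 - R)) + m * τ ^ 2)
      + Real.exp (m * (μ * τ' + τ' ^ 2) - τ' * (γ - R) + t * R))) ≤
      linScheme μ (potentialGrid Φ) m j := by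
  have key := linScheme_exp_lower h0 h1
    (potentialGrid_barrier hnn heq (by linarith) hτ hτ') m j
  obtain ⟨hj1, hj2⟩ := abs_le.1 hj
  have hm : (0 : ℝ) ≤ m := Nat.cast_nonneg m
  -- The tilted exponentials grow with f(t ± τ) ≤ f(t) ± τ f'(t) + τ². Relative to the main one they
  -- gain m τ² and lose τ times the distance to the characteristics issued from the ends of the
  -- piece, which is at least D near γ.
  have f1 := laxFlux_le_tangent_add_sq h0 h1 t (t + τ)
  have f2 := laxFlux_le_tangent_add_sq h0 h1 t (t - τ)
  have f3 := laxFlux_le_tangent_add_sq h0 h1 0 τ'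
  rw [laxFlux_zero, laxSpeed_zero] at f3
  have g1 := mul_le_mul_of_nonneg_left f1 hm
  have g2 := mul_le_mul_of_nonneg_left f2 hm
  have g3 := mul_le_mul_of_nonneg_left f3 hm
  have e0 : β - t * j + m * laxFlux μ t = -(t * (j - γ)) := by linarith
  have k1 : Real.exp (β + τ * (xl + 1) - (t + τ) * j + m * laxFlux μ (t + τ))
      ≤ Real.exp (-(t * (j - γ))) * Real.exp (-(τ * (D - 1 - R)) + m * τ ^ 2) := by
    rw [← Real.exp_add]
    apply Real.exp_le_exp.2
    have := mul_le_mul_of_nonneg_left (by linarith : D - 1 - R ≤ j - xl - 1 - m * laxSpeed μ t) hτ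
    linarith
  have k2 : Real.exp (β - τ * (xr - 1) - (t - τ) * j + m * laxFlux μ (t - τ))
      ≤ Real.exp (-(t * (j - γ))) * Real.exp (-(τ * (D - 1 - R)) + m * τ ^ 2) := by
    rw [← Real.exp_add]
    apply Real.exp_le_exp.2
    have := mul_le_mul_of_nonneg_left (by linarith : D - 1 - R ≤ xr - 1 - j + m * laxSpeed μ t) hτ
    linarith
  have k3 : Real.exp (0 - τ' * j + m * laxFlux μ τ')
      ≤ Real.exp (-(t * (j - γ))) * Real.exp (m * (μ * τ' + τ' ^ 2) - τ' * (γ - R) + t * R) := by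
    rw [← Real.exp_add]
    apply Real.exp_le_exp.2
    have i1 := mul_le_mul_of_nonneg_left (by linarith : γ - R ≤ j) hτ'
    have i2 := mul_le_mul_of_nonneg_left (by linarith : (j : ℝ) - γ ≤ R) ht
    linarith
  rw [e0] at key
  linarith

end Barrier


/-! ### A sequence of shocks with slowly varying left states -/

/-- Parameters of initial data with left states `θ 0 < θ 1 < … < θ K`. The shock with left state
`θ k` has speed `lam k`, and it is meant to be alone on the time interval where the remaining
time `r (K + 1) - m` lies between `r k` and `r (k + 1)`; `P k` is the position of the shock
when the remaining time is `r k`, and `σ k` is the speed of the jump from `θ k` to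
`θ (k + 1)`. -/
structure IsBlockData (μ : ℝ) (K : ℕ) (r θ lam σ P : ℕ → ℝ) : Prop where
  r_pos : ∀ k, 0 < r k
  r_succ : ∀ k, r (k + 1) = 10 * r k
  strictMono : StrictMono θ
  pos : ∀ k, 0 < θ k
  speed : ∀ k, θ k * lam k = laxFlux μ (θ k)
  jump : ∀ k, (θ (k + 1) - θ k) * σ k = laxFlux μ (θ (k + 1)) - laxFlux μ (θ k)
  pos_top : P (K + 1) = 0
  pos_succ : ∀ k ≤ K, P k = P (k + 1) + lam k * (r (k + 1) - r k)

/-- The node between the `k`-th and the `(k + 1)`-st state. -/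
def blockNode (K : ℕ) (r σ P : ℕ → ℝ) (k : ℕ) : ℝ := P (k + 1) - (r (K + 1) - r (k + 1)) * σ k

/-- Minus the constant term of the affine piece of the potential with slope `θ k`. -/
def blockShift (μ : ℝ) (K : ℕ) (r θ P : ℕ → ℝ) (k : ℕ) : ℝ :=
  θ k * P (k + 1) - laxFlux μ (θ k) * (r (K + 1) - r (k + 1))

namespace IsBlockData

variable {μ : ℝ} {K : ℕ} {r θ lam σ P : ℕ → ℝ}

theorem r_mono (h : IsBlockData μ K r θ lam σ P) : Monotone r :=
  monotone_nat_of_le_succ fun k => by rw [h.r_succ]; linarith [h.r_pos k]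

theorem shift_top (h : IsBlockData μ K r θ lam σ P) : blockShift μ K r θ P K = 0 := by
  simp [blockShift, h.pos_top]

theorem node_top (h : IsBlockData μ K r θ lam σ P) : blockNode K r σ P K = 0 := by
  simp [blockNode, h.pos_top]

/-- The node is the starting point of a jump of speed σ j which reaches P (j + 1) together with the
shock. There the exponentials of both states equal one, and tracing them back to time 0 gives the
crossing of the two affine pieces. -/
theorem shift_sub (h : IsBlockData μ K r θ lam σ P) {j : ℕ} (hj : j < K) :
    (θ (j + 1) - θ j) * blockNode K r σ P j
      = blockShift μ K r θ P (j + 1) - blockShift μ K r θ P j := by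
  have e1 := h.pos_succ (j + 1) hj
  have e2 := h.jump j
  have e3 := h.speed (j + 1)
  simp only [blockNode, blockShift]
  rw [← e3, e1]
  have : laxFlux μ (θ j) = θ (j + 1) * lam (j + 1) - (θ (j + 1) - θ j) * σ j := by
    rw [e2, e3]; ring
  rw [this]
  ring

theorem le_pos (h : IsBlockData μ K r θ lam σ P) {Λ : ℝ} (hΛ : ∀ l, Λ ≤ lam l) {k : ℕ}
    (hk : k ≤ K + 1) : Λ * (r (K + 1) - r k) ≤ P k := by
  induction hk using Nat.decreasingInduction with
  | self => simp [h.pos_top]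
  | of_succ k hk ih =>
    rw [h.pos_succ k (by omega)]
    have := mul_le_mul_of_nonneg_right (hΛ k) (sub_nonneg.2 (h.r_mono k.le_succ))
    rw [Nat.succ_eq_add_one] at this
    linarith

/-- The left side is the point where the evolved exponential of state θ b equals one, that is the
position of the b-th shock at time m. -/
theorem shift_div (h : IsBlockData μ K r θ lam σ P) (b : ℕ) (m : ℝ) :
    lam b * m + blockShift μ K r θ P b / θ b
      = P (b + 1) + lam b * (m - (r (K + 1) - r (b + 1))) := by
  have := (h.pos b).ne'
  rw [blockShift, ← h.speed]
  field_simp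
  ring

theorem speed_bounds (h0 : 0 < μ) (h1 : μ < 1) (h : IsBlockData μ K r θ lam σ P) {t : ℝ}
    (ht : ∀ k, θ k ≤ t) (k : ℕ) :
    laxSpeed μ t - (t - θ 0) ≤ laxSpeed μ (θ k) ∧ laxSpeed μ (θ k) ≤ laxSpeed μ t := by
  have := laxSpeed_sub_le h0 h1 (ht k)
  have h2 := h.strictMono.monotone (Nat.zero_le k)
  exact ⟨by linarith, (strictMono_laxSpeed h0 h1).monotone (ht k)⟩

theorem jump_bounds (h0 : 0 < μ) (h1 : μ < 1) (h : IsBlockData μ K r θ lam σ P) {t : ℝ}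
    (ht : ∀ k, θ k ≤ t) (k : ℕ) :
    laxSpeed μ t - (t - θ 0) ≤ σ k ∧ σ k ≤ laxSpeed μ t := by
  have hlt := h.strictMono (Nat.lt_succ_self k)
  obtain ⟨c, hc, e⟩ := laxFlux_mean_value h0 h1 hlt
  have e2 := h.jump k
  have hσ : σ k = laxSpeed μ c := by
    have : θ (k + 1) - θ k ≠ 0 := sub_ne_zero.2 hlt.ne'
    apply mul_left_cancel₀ this
    rw [e2]
    rw [mul_comm]
    exact e
  have b1 := h.speed_bounds h0 h1 ht k
  have b2 := h.speed_bounds h0 h1 ht (k + 1)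
  have m := (strictMono_laxSpeed h0 h1).monotone
  rw [hσ]
  exact ⟨b1.1.trans (m hc.1.le), (m hc.2.le).trans b2.2⟩

/-- The window of the `(k + 1)`-st shock is far from the characteristics of the two nodes. -/
theorem margins (h0 : 0 < μ) (h1 : μ < 1) (h : IsBlockData μ K r θ lam σ P) {t c : ℝ}
    (ht : ∀ k, θ k ≤ t) (hc : ∀ k, lam k + 2 * c ≤ laxSpeed μ t)
    (hη : t - θ 0 ≤ c) (hη' : r (K + 1) * (t - θ 0) ≤ c / 2 * r 0) {k : ℕ} (hk : k < K) {m : ℝ}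
    (hm0 : 0 ≤ m) (hm1 : m + 2 * r (k + 1) ≤ r (K + 1)) (hm2 : r (K + 1) ≤ m + 6 * r (k + 1)) :
    c / 2 * r (k + 1) ≤ (lam (k + 1) * m + blockShift μ K r θ P (k + 1) / θ (k + 1))
        - blockNode K r σ P k - m * laxSpeed μ (θ (k + 1)) ∧
      c / 2 * r (k + 1) ≤ blockNode K r σ P (k + 1)
        - (lam (k + 1) * m + blockShift μ K r θ P (k + 1) / θ (k + 1))
        + m * laxSpeed μ (θ (k + 1)) := by
  have hη0 : 0 ≤ t - θ 0 := sub_nonneg.2 (ht 0)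
  have hc0 : 0 ≤ c := hη0.trans hη
  have hr1 := h.r_pos (k + 1)
  have hr0 : r 0 ≤ r (k + 1) := h.r_mono (Nat.zero_le _)
  have hN : c / 2 * r 0 ≤ c / 2 * r (k + 1) := mul_le_mul_of_nonneg_left hr0 (by linarith)
  have hmN : m ≤ r (K + 1) := by linarith
  have hr2 := h.r_succ (k + 1)
  have hTle : r (k + 1 + 1) ≤ r (K + 1) := h.r_mono (by omega)
  have b1 := h.jump_bounds h0 h1 ht k
  have b2 := h.jump_bounds h0 h1 ht (k + 1)
  have b3 := h.speed_bounds h0 h1 ht (k + 1)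
  have b4 := hc (k + 1)
  rw [h.shift_div (k + 1) m]
  have e1 := h.pos_succ (k + 1) hk
  have u1 : m * (t - θ 0) ≤ r (K + 1) * (t - θ 0) := mul_le_mul_of_nonneg_right hmN hη0
  -- Each gap is a relative speed of at least c times a duration: at least r (k + 1) until the next
  -- jump arrives, at least 4 r (k + 1) since the previous one. The spread of the characteristic
  -- speeds over the whole time costs at most c/2 r 0.
  constructor
  · have e : P (k + 1 + 1) + lam (k + 1) * (m - (r (K + 1) - r (k + 1 + 1))) - blockNode K r σ P k
        - m * laxSpeed μ (θ (k + 1)) = (σ k - lam (k + 1)) * (r (K + 1) - r (k + 1) - m)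
          + m * (σ k - laxSpeed μ (θ (k + 1))) := by
      rw [blockNode, e1]; ring
    rw [e]
    have i1 : c * r (k + 1) ≤ (σ k - lam (k + 1)) * (r (K + 1) - r (k + 1) - m) :=
      mul_le_mul (by linarith) (by linarith) hr1.le (by linarith)
    have i2 : m * (-(t - θ 0)) ≤ m * (σ k - laxSpeed μ (θ (k + 1))) :=
      mul_le_mul_of_nonneg_left (by linarith) hm0
    linarith
  · have e : blockNode K r σ P (k + 1)
        - (P (k + 1 + 1) + lam (k + 1) * (m - (r (K + 1) - r (k + 1 + 1))))
        + m * laxSpeed μ (θ (k + 1))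
        = (laxSpeed μ (θ (k + 1)) - lam (k + 1)) * (m - (r (K + 1) - r (k + 1 + 1)))
          + (r (K + 1) - r (k + 1 + 1)) * (laxSpeed μ (θ (k + 1)) - σ (k + 1)) := by
      rw [blockNode]; ring
    rw [e]
    have i1 : c * (4 * r (k + 1))
        ≤ (laxSpeed μ (θ (k + 1)) - lam (k + 1)) * (m - (r (K + 1) - r (k + 1 + 1))) :=
      mul_le_mul (by linarith) (by linarith) (by linarith) (by linarith)
    have i2 : (r (K + 1) - r (k + 1 + 1)) * (-(t - θ 0))
        ≤ (r (K + 1) - r (k + 1 + 1)) * (laxSpeed μ (θ (k + 1)) - σ (k + 1)) :=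
      mul_le_mul_of_nonneg_left (by linarith) (by linarith)
    have i3 : (r (K + 1) - r (k + 1 + 1)) * (t - θ 0) ≤ r (K + 1) * (t - θ 0) :=
      mul_le_mul_of_nonneg_right (by linarith [h.r_pos (k + 1 + 1)]) hη0
    have i4 : 0 ≤ c * r (k + 1) := mul_nonneg hc0 hr1.le
    linarith

theorem node_add_le (h0 : 0 < μ) (h1 : μ < 1) (h : IsBlockData μ K r θ lam σ P) {t c : ℝ}
    (ht : ∀ k, θ k ≤ t) (hc : ∀ k, lam k + 2 * c ≤ laxSpeed μ t)
    (hη : t - θ 0 ≤ c) (hη' : r (K + 1) * (t - θ 0) ≤ c / 2 * r 0) {k : ℕ} (hk : k < K) :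
    blockNode K r σ P k + c * r 0 ≤ blockNode K r σ P (k + 1) := by
  have hTle : r (k + 1 + 1) ≤ r (K + 1) := h.r_mono (by omega)
  have hr2 := h.r_succ (k + 1)
  have hr1 := h.r_pos (k + 1)
  obtain ⟨m1, m2⟩ := h.margins h0 h1 ht hc hη hη' hk (m := r (K + 1) - 2 * r (k + 1))
    (by linarith) (by linarith) (by linarith)
  have hr0 : r 0 ≤ r (k + 1) := h.r_mono (Nat.zero_le _)
  have hη0 : 0 ≤ t - θ 0 := sub_nonneg.2 (ht 0)
  have := mul_le_mul_of_nonneg_left hr0 (hη0.trans hη)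
  linarith

end IsBlockData

/-- The defect r_k^{-1/2} of the k-th state is dictated by the numerical viscosity: the resonant
wave number is then of the order of the largest one that survives for a time r_k. -/
theorem exists_isBlockData {μ : ℝ} (K : ℕ) {M : ℕ} (hM : 0 < M) {t : ℝ}
    (ht : 1 / √(M : ℝ) < t) :
    ∃ θ lam σ P : ℕ → ℝ, IsBlockData μ K (fun k => ((10 ^ k * M : ℕ) : ℝ)) θ lam σ P ∧
      (∀ k, θ k = t - 1 / √((10 ^ k * M : ℕ) : ℝ)) ∧ ∀ k, lam k = laxFlux μ (θ k) / θ k := by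
  have hM' : (0 : ℝ) < M := by exact_mod_cast hM
  set r : ℕ → ℝ := fun k => ((10 ^ k * M : ℕ) : ℝ) with hr
  have hrs : ∀ k, r (k + 1) = 10 * r k := fun k => by simp only [hr]; push_cast; ring
  have hrp : ∀ k, 0 < r k := fun k => by simp only [hr]; positivity
  have hr0 : r 0 = M := by simp [hr]
  set θ : ℕ → ℝ := fun k => t - 1 / √(r k) with hθ
  have hmono : StrictMono θ := strictMono_nat_of_lt_succ fun k => by
    simp only [hθ]
    apply sub_lt_sub_left
    apply one_div_lt_one_div_of_lt (Real.sqrt_pos.2 (hrp k))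
    apply Real.sqrt_lt_sqrt (hrp k).le
    rw [hrs]; linarith [hrp k]
  have hpos : ∀ k, 0 < θ k := fun k =>
    lt_of_lt_of_le (by simp only [hθ, hr0]; linarith) (hmono.monotone (Nat.zero_le k))
  refine ⟨θ, fun k => laxFlux μ (θ k) / θ k,
    fun k => (laxFlux μ (θ (k + 1)) - laxFlux μ (θ k)) / (θ (k + 1) - θ k),
    fun k => ∑ l ∈ Finset.Ico k (K + 1), laxFlux μ (θ l) / θ l * (r (l + 1) - r l),
    ⟨hrp, hrs, hmono, hpos, fun k => ?_, fun k => ?_, by simp, fun k hk => ?_⟩, fun k => rfl,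
    fun k => rfl⟩
  · exact mul_div_cancel₀ _ (hpos k).ne'
  · exact mul_div_cancel₀ _ (sub_ne_zero.2 (hmono (Nat.lt_succ_self k)).ne')
  · rw [Finset.sum_eq_sum_Ico_succ_bot (by omega : k < K + 1)]
    ring


namespace IsBlockData

variable {μ : ℝ} {K : ℕ} {r θ lam σ P : ℕ → ℝ} {st sp : ℝ → ℝ} {t c : ℝ}

theorem node_mono (h0 : 0 < μ) (h1 : μ < 1) (h : IsBlockData μ K r θ lam σ P)
    (ht : ∀ k, θ k ≤ t) (hc : ∀ k, lam k + 2 * c ≤ laxSpeed μ t) (hη : t - θ 0 ≤ c)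
    (hη' : r (K + 1) * (t - θ 0) ≤ c / 2 * r 0) {i j : ℕ} (hij : i ≤ j) (hj : j ≤ K) :
    blockNode K r σ P i ≤ blockNode K r σ P j := by
  induction j, hij using Nat.le_induction with
  | base => exact le_rfl
  | succ j hij ih =>
    have := h.node_add_le h0 h1 ht hc hη hη' (by omega : j < K)
    have h3 : 0 ≤ c * r 0 := mul_nonneg ((sub_nonneg.2 (ht 0)).trans hη) (h.r_pos 0).le
    exact (ih (by omega)).trans (by linarith)

theorem potential_zero (h0 : 0 < μ) (h1 : μ < 1) (h : IsBlockData μ K r θ lam σ P)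
    (hs : IsSmoothPos st sp) (ht : ∀ k, θ k ≤ t) (hc : ∀ k, lam k + 2 * c ≤ laxSpeed μ t)
    (hη : t - θ 0 ≤ c) (hη' : r (K + 1) * (t - θ 0) ≤ c / 2 * r 0) (hcr : 1 ≤ c * r 0) :
    blockPotential sp θ (blockNode K r σ P) K 0 = 0 := by
  rw [blockPotential_eq hs (fun j hj => h.shift_sub hj) h.shift_top le_rfl
    (fun k hk => ?_) (fun k hk hk' => by omega), h.shift_top]
  · ring
  · have h2 := h.node_add_le h0 h1 ht hc hη hη' hk
    have h3 := h.node_mono h0 h1 ht hc hη hη' (i := k + 1) (j := K) hk le_rfl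
    rw [h.node_top] at h3
    linarith

/-- The upper bound holds because the potential dominates its affine pieces. The lower one comes
from the barriers: the margins beat the quadratic growth since CK τ ≤ c/4, and the correction of
small rate τ' travels with speed close to μ, so it is left behind by the faster shock. Both errors
are exponentially small in r 0. -/
theorem profile_close (h0 : 0 < μ) (h1 : μ < 1) (h : IsBlockData μ K r θ lam σ P)
    (hs : IsSmoothPos st sp) (ht : ∀ k, θ k ≤ t) (hc : ∀ k, lam k + 2 * c ≤ laxSpeed μ t)
    (hη : t - θ 0 ≤ c) (hη' : r (K + 1) * (t - θ 0) ≤ c / 2 * r 0)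
    {Λ R e CK τ τ' : ℝ} (hΛ : ∀ l, Λ ≤ lam l) (hR : 0 ≤ R) (hτ : 0 < τ) (hτc : CK * τ ≤ c / 4)
    (hCK : r (K + 1) ≤ CK * r 0) (hτ' : 0 < τ') (hτΛ : μ + 2 * τ' ≤ Λ)
    (he1 : Real.exp (-(τ * (c / 4) * r 0) + τ * (1 + R)) ≤ e / 3)
    (he2 : Real.exp (-(τ' ^ 2 * r 0) + (τ' + t) * R) ≤ e / 3)
    (hnn : ∀ j, 0 ≤ potentialGrid (blockPotential sp θ (blockNode K r σ P) K) j)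
    {k : ℕ} (hk : k < K) {m : ℕ} (hm1 : m + 2 * r (k + 1) ≤ r (K + 1))
    (hm2 : r (K + 1) ≤ m + 6 * r (k + 1)) {γ : ℝ}
    (hγ : γ = lam (k + 1) * m + blockShift μ K r θ P (k + 1) / θ (k + 1)) (j : ℤ) :
    linScheme μ (potentialGrid (blockPotential sp θ (blockNode K r σ P) K)) m j
        ≤ Real.exp (-(θ (k + 1) * (j - γ))) ∧
      (|(j : ℝ) - γ| ≤ R → Real.exp (-(θ (k + 1) * (j - γ))) * (1 - e)
        ≤ linScheme μ (potentialGrid (blockPotential sp θ (blockNode K r σ P) K)) m j) := by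
  set Φ := blockPotential sp θ (blockNode K r σ P) K with hΦ
  have hp := h.pos (k + 1)
  have hm0 : (0 : ℝ) ≤ m := Nat.cast_nonneg m
  have hc0 : 0 ≤ c := (sub_nonneg.2 (ht 0)).trans hη
  have hlow : ∀ X, θ (k + 1) * X - blockShift μ K r θ P (k + 1) ≤ Φ X := fun X =>
    blockPotential_ge hs h.strictMono.monotone (fun j hj => h.shift_sub hj) h.shift_top hk X
  have hγ1 : θ (k + 1) * γ = blockShift μ K r θ P (k + 1) + m * laxFlux μ (θ (k + 1)) := by
    rw [hγ, ← h.speed]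
    field_simp
    ring
  refine ⟨?_, fun hj => ?_⟩
  · have := linScheme_exp_upper h0 h1 (potentialGrid_le_exp hlow) m j
    refine this.trans (Real.exp_le_exp.2 ?_)
    linarith
  have heq : ∀ X, blockNode K r σ P k + 1 ≤ X → X ≤ blockNode K r σ P (k + 1) - 1 →
      Φ X = θ (k + 1) * X - blockShift μ K r θ P (k + 1) := by
    intro X hX1 hX2
    apply blockPotential_eq hs (fun j hj => h.shift_sub hj) h.shift_top hk
    · intro i hi
      linarith [h.node_mono h0 h1 ht hc hη hη' (i := i) (j := k) (by omega) (by omega)]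
    · intro i hi hi'
      linarith [h.node_mono h0 h1 ht hc hη hη' (i := k + 1) (j := i) (by omega) (by omega)]
  have hx0 : blockNode K r σ P (k + 1) ≤ 1 := by
    have := h.node_mono h0 h1 ht hc hη hη' (i := k + 1) (j := K) hk le_rfl
    rw [h.node_top] at this
    linarith
  obtain ⟨D1, D2⟩ := h.margins h0 h1 ht hc hη hη' hk hm0 hm1 hm2
  rw [← hγ] at D1 D2
  have key := linScheme_block_lower h0 h1 hnn heq hx0 hp.le hτ.le hτ'.le m hγ1 D1 D2 j hj
  refine le_trans ?_ key
  apply mul_le_mul_of_nonneg_left _ (Real.exp_pos _).le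
  have hr0 : r 0 ≤ r (k + 1) := h.r_mono (Nat.zero_le _)
  have hr2 := h.r_succ (k + 1)
  have hr1 := h.r_pos (k + 1)
  have hTle : r (k + 1 + 1) ≤ r (K + 1) := h.r_mono (by omega)
  have i1 : Real.exp (-(τ * (c / 2 * r (k + 1) - 1 - R)) + m * τ ^ 2) ≤ e / 3 := by
    refine le_trans (Real.exp_le_exp.2 ?_) he1
    have a1 : (m : ℝ) * τ ^ 2 ≤ CK * r 0 * τ ^ 2 :=
      mul_le_mul_of_nonneg_right (by linarith) (sq_nonneg τ)
    have a2 : (CK * τ) * (r 0 * τ) ≤ c / 4 * (r 0 * τ) :=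
      mul_le_mul_of_nonneg_right hτc (mul_nonneg (h.r_pos 0).le hτ.le)
    have a3 : τ * c * r 0 ≤ τ * c * r (k + 1) :=
      mul_le_mul_of_nonneg_left hr0 (mul_nonneg hτ.le hc0)
    linarith
  have hγΛ : Λ * m ≤ γ := by
    rw [hγ, h.shift_div (k + 1) m]
    have b1 := h.le_pos hΛ (k := k + 1 + 1) (by omega)
    have b2 : Λ * (m - (r (K + 1) - r (k + 1 + 1)))
        ≤ lam (k + 1) * (m - (r (K + 1) - r (k + 1 + 1))) :=
      mul_le_mul_of_nonneg_right (hΛ _) (by linarith)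
    linarith
  have i2 : Real.exp (m * (μ * τ' + τ' ^ 2) - τ' * (γ - R) + θ (k + 1) * R) ≤ e / 3 := by
    refine le_trans (Real.exp_le_exp.2 ?_) he2
    have a1 : τ' * (Λ * m) ≤ τ' * γ := mul_le_mul_of_nonneg_left hγΛ hτ'.le
    have a2 : (μ + 2 * τ') * (m * τ') ≤ Λ * (m * τ') :=
      mul_le_mul_of_nonneg_right hτΛ (mul_nonneg hm0 hτ'.le)
    have a3 : τ' ^ 2 * r 0 ≤ τ' ^ 2 * m := mul_le_mul_of_nonneg_left (by linarith) (sq_nonneg _)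
    have a4 := mul_le_mul_of_nonneg_right (ht (k + 1)) hR
    linarith
  linarith

end IsBlockData


/-! ### Resonant fluxes and oscillating data -/

/-- The properties of the flux `g` which make the shock with left state `t` resonant. -/
structure IsResonantFlux (t : ℝ) (q : ℕ) (g : ℝ → ℝ) (g1 g2 Lg Cg : ℝ) : Prop where
  pos : 0 < g1
  lt : g1 < g2
  lt_state : g2 < t
  support : ∀ u, g u ≠ 0 → g1 < u ∧ u < g2
  lipschitz : ∀ u w, |g u - g w| ≤ Lg * |u - w|
  bounded : ∀ u, |g u| ≤ Cg
  profile : ∀ x, 1 / 2 ≤ |x| → g (shockProfile t x) = 0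
  coeff : ∫ b in (0 : ℝ)..1, resonantSource (fun y => g (shockProfile t y)) q b ≠ 0

theorem abs_shockProfile_sub_le' (t x z : ℝ) :
    |shockProfile t x - shockProfile t z| ≤ 2 * |t| * |x - z| := by
  have h1 := abs_softplus_sub_le (-(t * x)) (-(t * z))
  have h2 := abs_softplus_sub_le (-(t * (x + 1))) (-(t * (z + 1)))
  rw [show -(t * x) - -(t * z) = -(t * (x - z)) by ring, abs_neg, abs_mul] at h1
  rw [show -(t * (x + 1)) - -(t * (z + 1)) = -(t * (x - z)) by ring, abs_neg, abs_mul] at h2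
  rw [abs_le] at *
  simp only [shockProfile]
  constructor <;> linarith

/-- The k-th window lies at distance between 3 l r and 5 l r behind J, with r = r (k + 1). As r
grows by the factor 10, the windows are disjoint and their contributions add. -/
theorem sum_windows {K : ℕ} {r : ℕ → ℝ} (hr : ∀ k, 0 < r k) (hrs : ∀ k, r (k + 1) = 10 * r k)
    {l : ℝ} (hl : 0 < l) (J : ℤ) {F : ℤ → ℝ} {c0 : ℝ}
    (h : ∀ k < K, ∀ S : Finset ℤ, (∀ j : ℤ, 3 * l * r (k + 1) ≤ (J : ℝ) - j →
      (J : ℝ) - j ≤ 5 * l * r (k + 1) → j ∈ S) → c0 ≤ ∑ j ∈ S, F j) :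
    ∃ S : Finset ℤ, K * c0 ≤ ∑ j ∈ S, F j := by
  have hmono : Monotone r := monotone_nat_of_le_succ fun k => by rw [hrs]; linarith [hr k]
  set W : ℕ → Finset ℤ := fun k =>
    Finset.Icc (J - ⌊5 * l * r (k + 1)⌋) (J - ⌈3 * l * r (k + 1)⌉) with hW
  have hmem : ∀ k (j : ℤ), j ∈ W k ↔ 3 * l * r (k + 1) ≤ (J : ℝ) - j ∧
      (J : ℝ) - j ≤ 5 * l * r (k + 1) := by
    intro k j
    simp only [hW, Finset.mem_Icc]
    rw [sub_le_comm, Int.le_floor, le_sub_comm, Int.ceil_le]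
    push_cast
    tauto
  have hlt : ∀ i k, i < k → Disjoint (W i) (W k) := by
    intro i k hik
    rw [Finset.disjoint_left]
    intro j hi hk
    rw [hmem] at hi hk
    have h1 : r (i + 1 + 1) ≤ r (k + 1) := hmono (by omega)
    rw [hrs] at h1
    have h2 := mul_le_mul_of_nonneg_left h1 hl.le
    have h3 := mul_pos hl (hr (i + 1))
    linarith
  refine ⟨(Finset.range K).biUnion W, ?_⟩
  rw [Finset.sum_biUnion]
  · have := Finset.card_nsmul_le_sum (Finset.range K) (fun k => ∑ j ∈ W k, F j) c0
      fun k hk => h k (Finset.mem_range.1 hk) _ fun j h1 h2 => (hmem k j).2 ⟨h1, h2⟩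
    simpa using this
  · intro i _ k _ hik
    rcases lt_or_gt_of_ne hik with h' | h'
    · exact hlt i k h'
    · exact (hlt k i h').symm

theorem exists_large_radius {a0 g1 d : ℝ} (ha0 : 0 < a0) (hg1 : 0 < g1) (hd : 0 < d) :
    ∃ R : ℕ, 1 / a0 + 2 ≤ R ∧ Real.exp (-(a0 * R)) ≤ g1 ∧ Real.exp (-(a0 * R)) ≤ d := by
  have h1 : Tendsto (fun R : ℕ => Real.exp (-(a0 * R))) atTop (𝓝 0) :=
    Real.tendsto_exp_neg_atTop_nhds_zero.comp
      (tendsto_natCast_atTop_atTop.const_mul_atTop ha0)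
  have h2 : ∀ᶠ R : ℕ in atTop, 1 / a0 + 2 ≤ (R : ℝ) :=
    tendsto_natCast_atTop_atTop.eventually_ge_atTop _
  obtain ⟨R, h⟩ := (h2.and ((h1.eventually_le_const hg1).and (h1.eventually_le_const hd))).exists
  exact ⟨R, h.1, h.2.1, h.2.2⟩

theorem eventually_exp_neg_mul_le {κ : ℝ} (hκ : 0 < κ) (B : ℝ) {e : ℝ} (he : 0 < e) :
    ∀ᶠ M : ℕ in atTop, Real.exp (-(κ * M) + B) ≤ e := by
  have h1 : Tendsto (fun M : ℕ => -(κ * (M : ℝ)) + B) atTop atBot :=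
    tendsto_atBot_add_const_right _ _
      (tendsto_neg_atTop_atBot.comp (tendsto_natCast_atTop_atTop.const_mul_atTop hκ))
  exact (Real.tendsto_exp_atBot.comp h1).eventually_le_const he

theorem eventually_one_div_sqrt_le {d : ℝ} (hd : 0 < d) :
    ∀ᶠ M : ℕ in atTop, 1 / √(M : ℝ) ≤ d := by
  have h1 : Tendsto (fun M : ℕ => (√(M : ℝ))⁻¹) atTop (𝓝 0) :=
    tendsto_inv_atTop_zero.comp (Real.tendsto_sqrt_atTop.comp tendsto_natCast_atTop_atTop)
  filter_upwards [h1.eventually_le_const hd] with M hM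
  rwa [one_div]

/-- The crossing moves with a speed between f(a)/t and f(t)/a, up to bounded errors, and both
quotients are within l/12 of lam0 when t - a is small. -/
theorem crossing_speed_close {μ lam0 t a a0 l : ℝ} {y0 : ℤ → ℝ} (h0 : 0 < μ) (h1 : μ < 1)
    (h : IsShockProfile a t y0) (ha0 : 0 < a0) (ha : a0 ≤ a) (hat : a ≤ t)
    (hf : laxFlux μ t = lam0 * t) (hlam1 : lam0 < 1) (hη : t - a ≤ l / 12 * a0)
    {J : ℕ → ℤ} (hJ1 : ∀ n, 1 ≤ linScheme μ y0 n (J n))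
    (hJ2 : ∀ n, linScheme μ y0 n (J n + 1) < 1) {m N : ℕ} (hmN : m ≤ N) :
    |(J m : ℝ) - J N + lam0 * ((N : ℝ) - m)| ≤ l / 12 * ((N : ℝ) - m) + (1 / a0 + 1) := by
  have hap : 0 < a := by linarith
  have htp : 0 < t := by linarith
  obtain ⟨k, rfl⟩ := Nat.exists_eq_add_of_le hmN
  obtain ⟨s1, s2⟩ := crossing_speed h0 h1 h hap htp hJ1 hJ2 m k
  have hk : (0 : ℝ) ≤ k := Nat.cast_nonneg k
  have hl : 0 ≤ l / 12 := by
    by_contra hn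
    have := mul_neg_of_neg_of_pos (not_le.1 hn) ha0
    linarith
  have hfa : laxFlux μ t - (t - a) ≤ laxFlux μ a := by
    have := abs_laxFlux_sub_le h0 h1 t a
    rw [abs_of_nonneg (by linarith : 0 ≤ t - a)] at this
    linarith [le_abs_self (laxFlux μ t - laxFlux μ a)]
  have b1 : lam0 - l / 12 ≤ laxFlux μ a / t := by
    rw [le_div_iff₀ htp]
    have := mul_le_mul_of_nonneg_left (ha.trans hat) hl
    linarith
  have b2 : laxFlux μ t / a ≤ lam0 + l / 12 := by
    rw [div_le_iff₀ hap, hf]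
    have i1 := mul_le_mul_of_nonneg_left ha hl
    have i2 := mul_nonneg (by linarith : 0 ≤ 1 - lam0) (by linarith : 0 ≤ t - a)
    linarith
  have c1 := mul_le_mul_of_nonneg_right b1 hk
  have c2 := mul_le_mul_of_nonneg_right b2 hk
  have d1 : 1 / a ≤ 1 / a0 := one_div_le_one_div_of_le ha0 ha
  have d2 : 1 / t ≤ 1 / a0 := one_div_le_one_div_of_le ha0 (ha.trans hat)
  push_cast
  rw [abs_le]
  constructor <;> linarith


/-- Arbitrarily small perturbations of the left state of a resonant shock for which the
Godunov approximation of `v` has large variation. -/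
theorem exists_oscillating_data {μ lam0 t g1 g2 Lg Cg : ℝ} {q : ℕ} {p : ℤ} {g : ℝ → ℝ}
    (hμ : 1 / 2 < μ) (h1 : μ < 1) (hg : IsResonantFlux t q g g1 g2 Lg Cg)
    (hf : laxFlux μ t = lam0 * t) (hlt : lam0 < laxSpeed μ t) (hq : 0 < q)
    (hlam0 : lam0 = (p : ℝ) / q) (hμl : μ < lam0) (hlam1 : lam0 < 1) :
    ∃ c0 > 0, ∃ C : ℕ → ℝ, ∀ (K : ℕ) (δ : ℝ), 0 < δ →
      ∃ (φ Φ : ℝ → ℝ) (N : ℕ) (S : Finset ℤ), ContDiff ℝ ∞ φ ∧ Monotone φ ∧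
        (∀ x, -δ ≤ φ x ∧ φ x ≤ 0) ∧ (∀ i x, |iteratedDeriv i φ x| ≤ δ * C i) ∧ 1 / δ ≤ N ∧
        (∃ X0, ∀ x ≤ X0, φ x = φ X0) ∧ Φ 0 = 0 ∧ (∀ x, HasDerivAt Φ (t + φ x) x) ∧
        K * c0 ≤ ∑ j ∈ S,
          |godunovGridV (laxFlux μ) (1 / 2) g (shockData t 0 φ) (fun _ => 0) N j
            - godunovGridV (laxFlux μ) (1 / 2) g (shockData t 0 φ) (fun _ => 0) N (j - 1)| := by
  have h0 : 0 < μ := by linarith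
  obtain ⟨hg1, hg12, hg2t, hgs, hgL, hgC, hgp, hcoef⟩ := hg
  have ht : 0 < t := by linarith
  have hLg : 0 ≤ Lg := by
    have := (abs_nonneg _).trans (hgL 0 1)
    simpa using this
  -- A level strictly between the support of g and the shock state, which all perturbed left states
  -- will exceed.
  obtain ⟨a0, ha0⟩ : ∃ a0, a0 = (g2 + t) / 2 := ⟨_, rfl⟩
  have ha0p : 0 < a0 := by linarith
  obtain ⟨l, hl⟩ : ∃ l, l = lam0 - 1 / 2 := ⟨_, rfl⟩
  have hlp : 0 < l := by linarith
  -- Half of the gap between the characteristic speed behind the shock and the shock speed: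
  -- characteristics overtake the shock at a definite rate.
  obtain ⟨c5, hc5⟩ : ∃ c5, c5 = (laxSpeed μ t - lam0) / 2 := ⟨_, rfl⟩
  have hc5p : 0 < c5 := by linarith
  obtain ⟨R, hR, hR1, hR2⟩ := exists_large_radius ha0p hg1 (by linarith : 0 < a0 - g2)
  obtain ⟨c0, hc0, hwin⟩ := window_lower_bound (h := fun y => g (shockProfile t y))
    (Lh := Lg * (2 * |t|)) (Ch := Cg) (Cg := Cg) (C1 := 1 / a0 + 1)
    (c1 := (laxSpeed μ t - lam0) / (2 * t)) (c2 := 2 * (laxSpeed μ t - lam0) / t)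
    hgp (fun x y => (hgL _ _).trans (by
      rw [mul_assoc]; exact mul_le_mul_of_nonneg_left (abs_shockProfile_sub_le' t x y) hLg))
    (fun y => hgC _) hq hlam0 (by linarith) hlam1 hcoef R (by positivity)
    (div_pos (by linarith) (by linarith)) (div_pos (by linarith) (by linarith))
  obtain ⟨st, sp, hs⟩ := exists_smoothPos
  choose Cst hCst using hs.bounded
  refine ⟨c0, hc0, fun i => |Cst i| + 1, fun K δ hδ => ?_⟩
  obtain ⟨e0, he0, ρ0, hρ0, hw⟩ := hwin (10 ^ (K + 1))
  clear hwin
  -- A relative error e of the exponential changes the source by at most 4 e Lg, half of the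
  -- tolerance e0; the other half is left for replacing θ (k + 1) by t.
  obtain ⟨e, he⟩ : ∃ e, e = min (1 / 2) (e0 / (8 * (Lg + 1))) := ⟨_, rfl⟩
  have hep : 0 < e := by rw [he]; exact lt_min (by norm_num) (by positivity)
  have he12 : e ≤ 1 / 2 := by rw [he]; exact min_le_left _ _
  have hee0 : e * (8 * (Lg + 1)) ≤ e0 := by
    rw [← le_div_iff₀ (by positivity), he]; exact min_le_right _ _
  have hc2p : 0 < 2 * (laxSpeed μ t - lam0) / t := div_pos (by linarith) (by linarith)
  have hlm : 0 < lam0 - μ := by linarith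
  -- With K fixed, every remaining requirement is a largeness condition on the single parameter M =
  -- r 0.
  have hev := (eventually_one_div_sqrt_le hδ).and <| (eventually_one_div_sqrt_le
      (by linarith : 0 < t - a0)).and <| (eventually_one_div_sqrt_le
      (by linarith : 0 < t / 2)).and <| (eventually_one_div_sqrt_le hc5p).and <|
      (eventually_one_div_sqrt_le hρ0).and <| (eventually_one_div_sqrt_le
      (by positivity : 0 < e0 / (2 * (Lg + 1) * (4 * R + 1)))).and <|
      (eventually_one_div_sqrt_le (by positivity : 0 < l / 12 * a0)).and <|
      (eventually_one_div_sqrt_le (by positivity : 0 < c5 / 2 / 10 ^ (K + 1))).and <|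
      (eventually_one_div_sqrt_le
        (by positivity : 0 < (lam0 - μ) / 2 / (2 * (laxSpeed μ t - lam0) / t))).and <|
      (eventually_exp_neg_mul_le (by positivity : 0 < c5 / (4 * 10 ^ (K + 1)) * (c5 / 4))
        (c5 / (4 * 10 ^ (K + 1)) * (1 + (2 * R + 1))) (by positivity : 0 < e / 3)).and <|
      (eventually_exp_neg_mul_le (by positivity : 0 < ((lam0 - μ) / 4) ^ 2)
        (((lam0 - μ) / 4 + t) * (2 * R + 1)) (by positivity : 0 < e / 3)).and <|
      (tendsto_natCast_atTop_atTop.eventually_ge_atTop (1 / c5 : ℝ)).and <|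
      (tendsto_natCast_atTop_atTop.eventually_ge_atTop (1 / δ : ℝ)).and (eventually_gt_atTop 0)
  obtain ⟨M, m1, m2, m3, m4, m5, m6, m7, m8, m9, m10, m11, m12, m13, hM⟩ := hev.exists
  clear hev
  have hM' : (0 : ℝ) < M := by exact_mod_cast hM
  obtain ⟨θ, lam, σ, P, hB, hθ, hlam⟩ := exists_isBlockData (μ := μ) K hM
    (lt_of_le_of_lt m3 (by linarith : t / 2 < t))
  obtain ⟨r, hr⟩ : ∃ r : ℕ → ℝ, r = fun k => ((10 ^ k * M : ℕ) : ℝ) := ⟨_, rfl⟩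
  rw [← hr] at hB
  have hr0 : r 0 = M := by simp [hr]
  have hrk : ∀ k, ((10 ^ k * M : ℕ) : ℝ) = r k := fun k => by rw [hr]
  have hrK : r (K + 1) = 10 ^ (K + 1) * r 0 := by rw [hr0, hr]; push_cast; ring
  simp only [hrk] at hθ
  have hη : ∀ k, 1 / √(r k) ≤ 1 / √(M : ℝ) := fun k =>
    one_div_le_one_div_of_le (Real.sqrt_pos.2 hM')
      (Real.sqrt_le_sqrt (by rw [← hr0]; exact hB.r_mono (Nat.zero_le k)))
  have hηp : ∀ k, 0 < 1 / √(r k) := fun k => one_div_pos.2 (Real.sqrt_pos.2 (hB.r_pos k))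
  have hθt : ∀ k, θ k ≤ t := fun k => by rw [hθ]; linarith [hηp k]
  have hθ0 : t - θ 0 = 1 / √(M : ℝ) := by rw [hθ, hr0]; ring
  have hlb : ∀ k, (laxSpeed μ t - lam0) / (2 * t) * (1 / √(r k)) ≤ lam0 - lam k ∧
      lam0 - lam k ≤ 2 * (laxSpeed μ t - lam0) / t * (1 / √(r k)) := fun k => by
    rw [hlam, hθ]
    exact shock_speed_bounds h0 h1 ht hf (hηp k) ((hη k).trans m3)
      ((hη k).trans (by rw [← hc5]; exact m4))
  have hc : ∀ k, lam k + 2 * c5 ≤ laxSpeed μ t := fun k => by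
    have i1 := (hlb k).1
    have i2 : 0 < (laxSpeed μ t - lam0) / (2 * t) * (1 / √(r k)) :=
      mul_pos (div_pos (by linarith) (by linarith)) (hηp k)
    rw [hc5]; linarith
  have hΛ : ∀ k, (lam0 + μ) / 2 ≤ lam k := fun k => by
    have i1 := (hlb k).2
    have i2 := (hη k).trans m9
    rw [le_div_iff₀ hc2p, mul_comm] at i2
    linarith
  have hη1 : t - θ 0 ≤ c5 := by rw [hθ0]; exact m4
  have hη2 : r (K + 1) * (t - θ 0) ≤ c5 / 2 * r 0 := by
    rw [hθ0, hrK]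
    rw [le_div_iff₀ (by positivity)] at m8
    have := mul_le_mul_of_nonneg_right m8 (hB.r_pos 0).le
    linarith
  have hcr : 1 ≤ c5 * r 0 := by
    rw [hr0]
    rw [div_le_iff₀ hc5p] at m12
    linarith
  obtain ⟨x, hx⟩ : ∃ x, x = blockNode K r σ P := ⟨_, rfl⟩
  obtain ⟨Φ, hΦ⟩ : ∃ Φ, Φ = blockPotential sp θ x K := ⟨_, rfl⟩
  obtain ⟨u, hu⟩ : ∃ u, u = blockSlope st θ x K := ⟨_, rfl⟩
  have hΦ0 : Φ 0 = 0 := by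
    rw [hΦ, hx]; exact hB.potential_zero h0 h1 hs hθt hc hη1 hη2 hcr
  have hΦu : ∀ X, HasDerivAt Φ (u X) X := fun X => by
    rw [hΦ, hu]; exact hasDerivAt_blockPotential hs X
  have hθm := hB.strictMono.monotone
  have hub : ∀ X, θ 0 ≤ u X ∧ u X ≤ t := fun X => by
    have := blockSlope_mem (x := x) (K := K) hs hθm X
    rw [hu]
    exact ⟨this.1, this.2.trans (hθt K)⟩
  have huc : ContDiff ℝ ∞ u := by rw [hu]; exact contDiff_blockSlope hs
  have ha : a0 ≤ θ 0 := by linarith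
  have hθ0p : 0 < θ 0 := by linarith
  have hprof := isShockProfile_potentialGrid hΦu hΦ0 hθ0p.le (fun X => (hub X).1)
    (fun X => (hub X).2)
  obtain ⟨J, hJ1, hJ2⟩ := exists_crossings h0 h1 hΦu hΦ0 hθ0p (fun X => (hub X).1)
    (fun X => (hub X).2)
  obtain ⟨φ, hφ⟩ : ∃ φ : ℝ → ℝ, φ = fun X => u X - t := ⟨_, rfl⟩
  have hφu : ∀ X, t + φ X = u X := fun X => by rw [hφ]; ring
  have hU : ∀ n j, godunovGridU (laxFlux μ) (shockData t 0 φ) n j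
      = logRatio (linScheme μ (potentialGrid Φ) n) j :=
    godunovGridU_eq h0 h1 hprof.nonneg
      (integral_shockData hΦu hΦ0 huc.continuous hφu)
  have hδφ : ∀ X, -δ ≤ φ X ∧ φ X ≤ 0 := fun X => by
    have := hub X
    rw [hφ]
    constructor <;> simp only <;> linarith
  -- The final time is r (K + 1), so that N - m is the remaining time at time m.
  obtain ⟨N, hN⟩ : ∃ N : ℕ, N = 10 ^ (K + 1) * M := ⟨_, rfl⟩
  have hNr : (N : ℝ) = r (K + 1) := by rw [hN, hrk]
  have hloc : ∀ m j, g (logRatio (linScheme μ (potentialGrid Φ) m) j) ≠ 0 → |j - J m| ≤ R :=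
    fun m => (hprof.linScheme h0 h1 m).source_localized ha0p ha hgs hR1 hR2 (hJ1 m) (hJ2 m)
  obtain ⟨v, hv⟩ : ∃ v, v
    = godunovGridV (laxFlux μ) (1 / 2) g (shockData t 0 φ) (fun _ => 0) := ⟨_, rfl⟩
  have hv0 : ∀ j, v 0 j = 0 := fun j => by rw [hv]; simp [godunovGridV]
  have hvs : ∀ n j, v (n + 1) j = 1 / 2 * v n (j - 1) + (1 - 1 / 2) * v n j
      - (g (logRatio (linScheme μ (potentialGrid Φ) n) j)
        - g (logRatio (linScheme μ (potentialGrid Φ) n) (j - 1))) := fun n j => by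
    rw [hv, godunovGridV, hU, hU]
  obtain ⟨S, hS⟩ := sum_windows (K := K) hB.r_pos hB.r_succ hlp (J N)
    (F := fun j => |v N j - v N (j - 1)|) (c0 := c0) (by
    intro k hk S hS
    have hrN : ((10 ^ (k + 1) * M : ℕ) : ℝ) = r (k + 1) := hrk _
    have hle : r (k + 1 + 1) ≤ r (K + 1) := hB.r_mono (by omega)
    rw [hB.r_succ] at hle
    have hr1 := hB.r_pos (k + 1)
    have hr01 : r 0 ≤ r (k + 1) := hB.r_mono (Nat.zero_le _)
    refine hw (10 ^ (k + 1) * M) N (1 / √(r (k + 1))) (lam0 - lam (k + 1))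
      (blockShift μ K r θ P (k + 1) / θ (k + 1)) J
      (fun m j => g (logRatio (linScheme μ (potentialGrid Φ) m) j)) v (by positivity) ?_ ?_
      (hηp _) ((hη _).trans m5) ?_ (hlb _).1 (hlb _).2 (fun m j => hgC _) hloc ?_ ?_ hv0 hvs S ?_
    · have : (6 : ℝ) * ((10 ^ (k + 1) * M : ℕ) : ℝ) ≤ (N : ℝ) := by rw [hrN, hNr]; linarith
      exact_mod_cast this
    · rw [hrN, hNr, hrK]
      exact mul_le_mul_of_nonneg_left hr01 (by positivity)
    · rw [hrN, one_div, inv_pow, Real.sq_sqrt hr1.le, inv_mul_cancel₀ hr1.ne']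
    · intro m hm
      rw [← hl]
      exact crossing_speed_close h0 h1 hprof ha0p ha (hθt 0) hf hlam1
        (by rw [hθ0]; exact m7) hJ1 hJ2 hm
    · intro m hm1 hm2
      have hm1' : (m : ℝ) + 2 * r (k + 1) ≤ r (K + 1) := by
        rw [← hrN, ← hNr]; exact_mod_cast hm1
      have hm2' : r (K + 1) ≤ (m : ℝ) + 6 * r (k + 1) := by
        rw [← hrN, ← hNr]; exact_mod_cast hm2
      obtain ⟨γ, hγ⟩ : ∃ γ, γ = lam (k + 1) * m + blockShift μ K r θ P (k + 1) / θ (k + 1) :=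
        ⟨_, rfl⟩
      rw [show (lam0 - (lam0 - lam (k + 1))) * (m : ℝ) + blockShift μ K r θ P (k + 1) / θ (k + 1)
        = γ by rw [hγ]; ring]
      have hclose := hB.profile_close h0 h1 hs hθt hc hη1 hη2 hΛ
        (R := 2 * R + 1) (e := e) (CK := 10 ^ (K + 1)) (τ := c5 / (4 * 10 ^ (K + 1)))
        (τ' := (lam0 - μ) / 4) (by positivity) (by positivity)
        (le_of_eq (by field_simp)) hrK.le (by positivity) (by linarith)
        (by rw [hr0]; exact m10) (by rw [hr0]; exact m11)
        (by rw [← hx, ← hΦ]; exact hprof.nonneg) hk hm1' hm2' hγ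
      rw [← hx, ← hΦ] at hclose
      obtain ⟨k1, k2⟩ := (hprof.linScheme h0 h1 m).source_close (t := θ (k + 1)) (t0 := t) (γ := γ)
        (e := e) ha0p ha (ha.trans (hθm (Nat.zero_le _))) hgL hR (hJ1 m) (hJ2 m) (hloc m) hgp
        (fun j => (hclose j).1) hep.le he12 (fun j => (hclose j).2)
      refine ⟨k1, fun j => (k2 j).trans ?_⟩
      have hd : |θ (k + 1) - t| ≤ 1 / √(M : ℝ) := by
        rw [hθ, sub_sub_cancel_left, abs_neg, abs_of_pos (hηp _)]; exact hη _
      have i2 := hd.trans m6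
      rw [le_div_iff₀ (by positivity)] at i2
      have i3 : 0 ≤ |θ (k + 1) - t| * (4 * R + 1) := by positivity
      linarith
    · intro j hj1 hj2
      rw [hrN, ← hl] at hj1 hj2
      exact hS j hj1 hj2)
  refine ⟨φ, Φ, N, S, ?_, ?_, hδφ, ?_, ?_, ?_, hΦ0, fun X => by rw [hφu]; exact hΦu X,
    by rw [← hv]; exact hS⟩
  · rw [hφ]; exact huc.sub contDiff_const
  · rw [hφ, hu]
    intro X Y hXY
    exact sub_le_sub_right (monotone_blockSlope hs hθm hXY) t
  · intro i X
    rcases eq_or_ne i 0 with rfl | hi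
    · rw [iteratedDeriv_zero]
      have := hδφ X
      calc |φ X| ≤ δ * 1 := by rw [abs_le]; constructor <;> linarith
        _ ≤ _ := mul_le_mul_of_nonneg_left (by linarith [abs_nonneg (Cst 0)]) hδ.le
    · rw [hφ, hu]
      refine (abs_iteratedDeriv_blockSlope_le hs hθm t hi (hCst i) X).trans ?_
      have j1 : θ K - θ 0 ≤ δ := by linarith [hθt K]
      have j2 : 0 ≤ θ K - θ 0 := sub_nonneg.2 (hθm (Nat.zero_le K))
      have j3 : 0 ≤ Cst i := (abs_nonneg _).trans (hCst i 0)
      exact mul_le_mul j1 (by linarith [le_abs_self (Cst i)]) j3 hδ.le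
  · refine m13.trans ?_
    rw [hNr, ← hr0]
    exact hB.r_mono (Nat.zero_le _)
  · obtain ⟨X0, hX0⟩ := exists_blockSlope_eq (θ := θ) (x := x) (K := K) hs
    refine ⟨X0, fun X hX => ?_⟩
    rw [hφ, hu]
    simp only
    rw [hX0 X hX, hX0 X0 le_rfl]


/-! ### Construction of a resonant flux -/

theorem shockProfile_eq_log (t x : ℝ) : shockProfile t x
    = Real.log ((1 + Real.exp (-(t * x))) / (1 + Real.exp (-(t * x)) * Real.exp (-t))) := by
  rw [Real.log_div (by positivity) (by positivity), ← Real.exp_add, shockProfile]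
  ring_nf

theorem strictAnti_shockProfile {t : ℝ} (ht : 0 < t) : StrictAnti (shockProfile t) := by
  intro x y hxy
  have h1 : Real.exp (-(t * y)) < Real.exp (-(t * x)) := Real.exp_lt_exp.2 (by nlinarith)
  have h2 : Real.exp (-t) < 1 := Real.exp_zero ▸ Real.exp_lt_exp.2 (by linarith)
  have p1 := Real.exp_pos (-(t * y))
  have p2 := Real.exp_pos (-t)
  rw [shockProfile_eq_log, shockProfile_eq_log]
  apply Real.log_lt_log (by positivity)
  rw [div_lt_div_iff₀ (by positivity) (by positivity)]
  nlinarith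

theorem shockProfile_mem {t : ℝ} (ht : 0 < t) (x : ℝ) :
    0 < shockProfile t x ∧ shockProfile t x < t := by
  have h2 : Real.exp (-t) < 1 := Real.exp_zero ▸ Real.exp_lt_exp.2 (by linarith)
  have p1 := Real.exp_pos (-(t * x))
  have p2 := Real.exp_pos (-t)
  have e : Real.exp t * Real.exp (-t) = 1 := by rw [← Real.exp_add]; simp
  have p3 : 1 < Real.exp t := Real.one_lt_exp_iff.2 ht
  rw [shockProfile_eq_log]
  constructor
  · apply Real.log_pos
    rw [one_lt_div (by positivity)]
    nlinarith
  · rw [Real.log_lt_iff_lt_exp (by positivity), div_lt_iff₀ (by positivity)]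
    have : Real.exp t * (1 + Real.exp (-(t * x)) * Real.exp (-t))
        = Real.exp t + Real.exp (-(t * x)) := by linear_combination Real.exp (-(t * x)) * e
    rw [this]
    linarith

theorem continuous_shockProfile (t : ℝ) : Continuous (shockProfile t) := by
  have h : ∀ s : ℝ, Continuous fun x : ℝ => Real.log (1 + Real.exp (-(t * (x + s)))) := fun s =>
    Continuous.log (by fun_prop) fun x => by positivity
  have e : shockProfile t = fun x => Real.log (1 + Real.exp (-(t * (x + 0))))
      - Real.log (1 + Real.exp (-(t * (x + 1)))) := by
    funext x; simp [shockProfile]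
  rw [e]
  exact (h 0).sub (h 1)

/-- The bump is taken so narrow that g, evaluated along the profile, is supported in |x| ≤ 1/(8q).
There cos(2πqx) is nonnegative, so the real part of the q-th Fourier coefficient is the integral of
a nonnegative function that is positive at 0. -/
theorem exists_resonantFlux {t : ℝ} (ht : 0 < t) {q : ℕ} (hq : 0 < q) :
    ∃ (g : ℝ → ℝ) (g1 g2 Lg Cg : ℝ), ContDiff ℝ ∞ g ∧ HasCompactSupport g ∧
      IsResonantFlux t q g g1 g2 Lg Cg := by
  have hq' : (1 : ℝ) ≤ q := by exact_mod_cast hq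
  obtain ⟨d, hd⟩ : ∃ d : ℝ, d = 1 / (8 * q) := ⟨_, rfl⟩
  have hdp : 0 < d := by rw [hd]; positivity
  have hdq : d * q = 1 / 8 := by rw [hd]; field_simp
  have hd2 : d ≤ 1 / 2 := by nlinarith
  have hanti := strictAnti_shockProfile ht
  have h1 : shockProfile t d < shockProfile t 0 := hanti hdp
  have h2 : shockProfile t 0 < shockProfile t (-d) := hanti (by linarith)
  set ρ := min (shockProfile t 0 - shockProfile t d) (shockProfile t (-d) - shockProfile t 0) with hρ
  have hρp : 0 < ρ := lt_min (by linarith) (by linarith)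
  let G : ContDiffBump (shockProfile t 0) := ⟨ρ / 2, ρ, by linarith, by linarith⟩
  obtain ⟨g, hg⟩ : ∃ g : ℝ → ℝ, g = G := ⟨_, rfl⟩
  have hgd : ContDiff ℝ ∞ g := by rw [hg]; exact G.contDiff
  have hgc : HasCompactSupport g := by rw [hg]; exact G.hasCompactSupport
  have hg0 : ∀ u, 0 ≤ g u := fun u => by rw [hg]; exact G.nonneg
  have hgs : ∀ u, g u ≠ 0 → shockProfile t d < u ∧ u < shockProfile t (-d) := by
    intro u hu
    have : u ∈ Function.support G := by rw [hg] at hu; exact hu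
    rw [G.support_eq, Metric.mem_ball, Real.dist_eq, abs_lt] at this
    have l1 : ρ ≤ _ := min_le_left _ _
    have l2 : ρ ≤ _ := min_le_right _ _
    change _ < _ ∧ _ < ρ at this
    have t1 : -ρ < u - shockProfile t 0 := this.1
    constructor <;> linarith [this.2]
  have hzero : ∀ x, d ≤ |x| → g (shockProfile t x) = 0 := by
    intro x hx
    by_contra hn
    obtain ⟨k1, k2⟩ := hgs _ hn
    rw [hanti.lt_iff_gt] at k1 k2
    exact absurd hx (not_le.2 (abs_lt.2 ⟨k2, k1⟩))
  have hcenter : g (shockProfile t 0) = 1 := by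
    rw [hg]; exact G.one_of_mem_closedBall (Metric.mem_closedBall_self (by positivity))
  obtain ⟨L, hL⟩ := ContDiff.lipschitzWith_of_hasCompactSupport hgc hgd (by simp)
  have hprof : ∀ x, 1 / 2 ≤ |x| → g (shockProfile t x) = 0 := fun x hx => hzero x (hd2.trans hx)
  refine ⟨g, shockProfile t d, shockProfile t (-d), L, 1, hgd, hgc,
    (shockProfile_mem ht d).1, h1.trans h2, (shockProfile_mem ht _).2, hgs, fun u w => ?_,
    fun u => ?_, hprof, ?_⟩
  · have := hL.dist_le_mul u w
    rwa [Real.dist_eq, Real.dist_eq] at this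
  · rw [abs_of_nonneg (hg0 u), hg]; exact G.le_one
  rw [integral_resonantSource hprof q]
  set F : ℝ → ℂ := fun b => ((g (shockProfile t (-b)) : ℝ) : ℂ) * ew (-(2 * Real.pi * q * b)) with hF
  have hre : ∀ b, (F b).re = g (shockProfile t (-b)) * Real.cos (2 * Real.pi * q * b) := by
    intro b
    simp only [hF, Complex.re_ofReal_mul]
    congr 1
    rw [ew, Complex.exp_ofReal_mul_I_re, Real.cos_neg]
  have hFc : Continuous F := by
    apply Continuous.mul
    · exact Complex.continuous_ofReal.comp
        (hgd.continuous.comp ((continuous_shockProfile t).comp continuous_neg))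
    · unfold ew; fun_prop
  intro hzero0
  have e1 : (∫ b in -(1 / 2 : ℝ)..(1 / 2), F b).re = ∫ b in -(1 / 2 : ℝ)..(1 / 2), (F b).re := by
    have := (Complex.reCLM.intervalIntegral_comp_comm (hFc.intervalIntegrable (μ := volume) (-(1 / 2)) (1 / 2)))
    exact this.symm
  have e2 : 0 < ∫ b in -(1 / 2 : ℝ)..(1 / 2), (F b).re := by
    apply intervalIntegral.integral_pos (by norm_num)
      (Complex.continuous_re.comp hFc).continuousOn
    · intro b _
      rw [Function.comp_apply, hre]
      rcases le_or_gt d |b| with hb | hb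
      · rw [hzero (-b) (by rwa [abs_neg]), zero_mul]
      · apply mul_nonneg (hg0 _)
        have hb' : |2 * Real.pi * q * b| ≤ Real.pi / 2 := by
          rw [abs_mul, abs_of_pos (by positivity)]
          have : 2 * Real.pi * q * |b| ≤ 2 * Real.pi * q * d :=
            mul_le_mul_of_nonneg_left hb.le (by positivity)
          have h3 : 2 * Real.pi * q * d = 2 * Real.pi * (d * q) := by ring
          rw [h3, hdq] at this
          linarith [Real.pi_pos]
        rw [abs_le] at hb'
        exact Real.cos_nonneg_of_neg_pi_div_two_le_of_le (by linarith [hb'.1]) hb'.2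
    · refine ⟨0, by constructor <;> norm_num, ?_⟩
      rw [Function.comp_apply, hre]
      simp [hcenter]
  rw [← e1, hzero0] at e2
  simp at e2


/-! ### Rarefaction solutions by characteristics -/

/-- The foot of the characteristic through `(t, x)`, for increasing data `m`; negative times are
replaced by `0`. -/
def charFoot (μ : ℝ) (m : ℝ → ℝ) (t x : ℝ) : ℝ :=
  Classical.epsilon fun ξ => ξ + max t 0 * laxSpeed μ (m ξ) = x

/-- The solution with increasing data `m`. -/
def charSol (μ : ℝ) (m : ℝ → ℝ) (t x : ℝ) : ℝ := m (charFoot μ m t x)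

/-- The potential of `charSol`, where `Φ` is the potential of the data. -/
def charPot (μ : ℝ) (m Φ : ℝ → ℝ) (t x : ℝ) : ℝ :=
  Φ (charFoot μ m t x) + charSol μ m t x * (x - charFoot μ m t x)
    - max t 0 * laxFlux μ (charSol μ m t x)

section Char

variable {μ : ℝ} {m Φ : ℝ → ℝ} (h0 : 0 < μ) (h1 : μ < 1) (hm : Continuous m) (hmono : Monotone m)
include h0 h1 hm hmono

omit hmono in
theorem charFoot_spec (t x : ℝ) :
    charFoot μ m t x + max t 0 * laxSpeed μ (charSol μ m t x) = x := by
  have ht : 0 ≤ max t 0 := le_max_right _ _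
  have hc : Continuous fun ξ => ξ + max t 0 * laxSpeed μ (m ξ) :=
    continuous_id.add (continuous_const.mul ((continuous_laxSpeed h0 h1).comp hm))
  have : ∃ ξ, ξ + max t 0 * laxSpeed μ (m ξ) = x := by
    have hmem : x ∈ Icc ((fun ξ => ξ + max t 0 * laxSpeed μ (m ξ)) (x - max t 0))
        ((fun ξ => ξ + max t 0 * laxSpeed μ (m ξ)) x) := by
      constructor
      · have := mul_le_of_le_one_right ht (laxSpeed_lt_one h0 h1 (m (x - max t 0))).le
        simp only
        linarith
      · have := mul_nonneg ht (laxSpeed_pos h0 h1 (m x)).le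
        simp only
        linarith
    obtain ⟨ξ, _, hξ⟩ := intermediate_value_Icc (by linarith) hc.continuousOn hmem
    exact ⟨ξ, hξ⟩
  exact Classical.epsilon_spec this

omit hm in
theorem char_strictMono {s : ℝ} (hs : 0 ≤ s) {ξ ζ : ℝ} (h : ξ < ζ) :
    ζ - ξ ≤ (ζ + s * laxSpeed μ (m ζ)) - (ξ + s * laxSpeed μ (m ξ)) := by
  have := mul_le_mul_of_nonneg_left ((strictMono_laxSpeed h0 h1).monotone (hmono h.le)) hs
  linarith

theorem charFoot_eq {t x ξ : ℝ} (h : ξ + max t 0 * laxSpeed μ (m ξ) = x) :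
    charFoot μ m t x = ξ := by
  have e := charFoot_spec h0 h1 hm t x
  have ht : 0 ≤ max t 0 := le_max_right _ _
  rw [charSol] at e
  rcases lt_trichotomy (charFoot μ m t x) ξ with hlt | heq | hlt
  · linarith [char_strictMono h0 h1 hmono ht hlt]
  · exact heq
  · linarith [char_strictMono h0 h1 hmono ht hlt]

theorem charFoot_zero (x : ℝ) : charFoot μ m 0 x = x :=
  charFoot_eq h0 h1 hm hmono (by simp)

theorem charFoot_mono (t : ℝ) : Monotone (charFoot μ m t) := by
  intro x y hxy
  by_contra hn
  have e1 := charFoot_spec h0 h1 hm t x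
  have e2 := charFoot_spec h0 h1 hm t y
  rw [charSol] at e1 e2
  linarith [char_strictMono h0 h1 hmono (le_max_right t 0) (not_le.1 hn)]

/-- Characteristics of increasing data spread, and their speeds lie between 0 and 1. -/
theorem abs_charFoot_sub_le (t s x y : ℝ) :
    |charFoot μ m t x - charFoot μ m s y| ≤ |t - s| + |x - y| := by
  have key : ∀ t s x y : ℝ, charFoot μ m t x ≤ charFoot μ m s y + (|t - s| + |x - y|) := by
    intro t s x y
    have e1 := charFoot_spec h0 h1 hm t x
    have e2 := charFoot_spec h0 h1 hm s y
    rw [charSol] at e1 e2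
    rcases le_or_gt (charFoot μ m t x) (charFoot μ m s y) with h | h
    · linarith [abs_nonneg (t - s), abs_nonneg (x - y)]
    · have i1 := mul_le_mul_of_nonneg_left ((strictMono_laxSpeed h0 h1).monotone (hmono h.le))
        (le_max_right s 0)
      have p1 := laxSpeed_pos h0 h1 (m (charFoot μ m t x))
      have p2 := laxSpeed_lt_one h0 h1 (m (charFoot μ m t x))
      have i2 : |max s 0 - max t 0| ≤ |s - t| := abs_max_sub_max_le_abs s t 0
      have i3 : (max s 0 - max t 0) * laxSpeed μ (m (charFoot μ m t x)) ≤ |s - t| * 1 :=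
        (mul_le_mul_of_nonneg_right ((le_abs_self _).trans i2) p1.le).trans
          (mul_le_mul_of_nonneg_left p2.le (abs_nonneg _))
      have i4 := le_abs_self (x - y)
      rw [abs_sub_comm s t] at i3
      linarith
  have k1 := key t s x y
  have k2 := key s t y x
  rw [abs_sub_comm s t, abs_sub_comm y x] at k2
  rw [abs_le]
  constructor <;> linarith

theorem continuous_charFoot : Continuous fun p : ℝ × ℝ => charFoot μ m p.1 p.2 := by
  rw [continuous_iff_continuousAt]
  intro p
  rw [ContinuousAt, tendsto_iff_dist_tendsto_zero]
  have : Tendsto (fun z : ℝ × ℝ => |z.1 - p.1| + |z.2 - p.2|) (𝓝 p) (𝓝 0) := by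
    have hc : Continuous fun z : ℝ × ℝ => |z.1 - p.1| + |z.2 - p.2| := by fun_prop
    simpa using hc.tendsto p
  refine squeeze_zero (fun _ => dist_nonneg) (fun z => ?_) this
  rw [Real.dist_eq]
  exact abs_charFoot_sub_le h0 h1 hm hmono _ _ _ _

theorem continuous_charSol : Continuous fun p : ℝ × ℝ => charSol μ m p.1 p.2 :=
  hm.comp (continuous_charFoot h0 h1 hm hmono)

theorem charSol_mono (t : ℝ) : Monotone (charSol μ m t) :=
  hmono.comp (charFoot_mono h0 h1 hm hmono t)

theorem charSol_zero (x : ℝ) : charSol μ m 0 x = m x := by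
  rw [charSol, charFoot_zero h0 h1 hm hmono]

theorem charPot_zero (x : ℝ) : charPot μ m Φ 0 x = Φ x := by
  rw [charPot, charSol, charFoot_zero h0 h1 hm hmono]; simp

omit h0 h1 hm in
theorem potential_tangent_le (hΦ : ∀ x, HasDerivAt Φ (m x) x) (x y : ℝ) :
    Φ x + m x * (y - x) ≤ Φ y := by
  rcases lt_trichotomy x y with h | h | h
  · obtain ⟨c, hc, e⟩ := exists_hasDerivAt_eq_slope Φ m h
      (fun z _ => (hΦ z).continuousAt.continuousWithinAt) (fun z _ => hΦ z)
    rw [eq_div_iff (by linarith)] at e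
    have := mul_le_mul_of_nonneg_right (hmono hc.1.le) (by linarith : 0 ≤ y - x)
    linarith
  · rw [h]; simp
  · obtain ⟨c, hc, e⟩ := exists_hasDerivAt_eq_slope Φ m h
      (fun z _ => (hΦ z).continuousAt.continuousWithinAt) (fun z _ => hΦ z)
    rw [eq_div_iff (by linarith)] at e
    have := mul_le_mul_of_nonneg_right (hmono hc.2.le) (by linarith : 0 ≤ x - y)
    linarith

/-- The potential is the supremum of a family of affine functions. -/
theorem charPot_tangent_le (hΦ : ∀ x, HasDerivAt Φ (m x) x) (t x s y : ℝ) :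
    charPot μ m Φ t x + charSol μ m t x * (y - x)
      - (max s 0 - max t 0) * laxFlux μ (charSol μ m t x) ≤ charPot μ m Φ s y := by
  have e2 := charFoot_spec h0 h1 hm s y
  set ξ := charFoot μ m t x with hξ
  set ζ := charFoot μ m s y with hζ
  have c1 := potential_tangent_le hmono hΦ ξ ζ
  have c2 := mul_le_mul_of_nonneg_left (laxFlux_tangent_le h0 h1 (charSol μ m s y) (charSol μ m t x))
    (le_max_right s 0)
  simp only [charPot, ← hξ, ← hζ]
  have hu : charSol μ m t x = m ξ := rfl
  rw [← hu] at c1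
  have c3 : max s 0 * laxSpeed μ (charSol μ m s y) = y - ζ := by linarith
  have c4 : max s 0 * (laxSpeed μ (charSol μ m s y) * (charSol μ m t x - charSol μ m s y))
      = (y - ζ) * (charSol μ m t x - charSol μ m s y) := by rw [← c3]; ring
  rw [mul_add, c4] at c2
  linarith

/-- The foot need not be differentiable. Instead the tangent inequalities at the two points trap the
increment between the slopes at both ends, and these are continuous. -/
theorem hasDerivAt_charPot_x (hΦ : ∀ x, HasDerivAt Φ (m x) x) (t x : ℝ) :
    HasDerivAt (charPot μ m Φ t) (charSol μ m t x) x := by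
  rw [hasDerivAt_iff_isLittleO, Asymptotics.isLittleO_iff]
  intro c hc
  have hcont : Continuous fun y => charSol μ m t y :=
    (continuous_charSol h0 h1 hm hmono).comp (by fun_prop : Continuous fun y : ℝ => (t, y))
  obtain ⟨d, hd, H⟩ := Metric.continuousAt_iff.1 (hcont.continuousAt (x := x)) c hc
  filter_upwards [Metric.ball_mem_nhds x hd] with y hy
  have k1 := charPot_tangent_le h0 h1 hm hmono hΦ t x t y
  have k2 := charPot_tangent_le h0 h1 hm hmono hΦ t y t x
  have k3 := (H hy).le
  rw [Real.dist_eq] at k3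
  rw [smul_eq_mul, Real.norm_eq_abs, Real.norm_eq_abs]
  have k4 : |charPot μ m Φ t y - charPot μ m Φ t x - (y - x) * charSol μ m t x|
      ≤ |(charSol μ m t y - charSol μ m t x) * (y - x)| := by
    rw [abs_of_nonneg (by linarith)]
    refine le_trans ?_ (le_abs_self _)
    linarith
  refine k4.trans ?_
  rw [abs_mul]
  exact mul_le_mul_of_nonneg_right k3 (abs_nonneg _)

theorem hasDerivAt_charPot_t (hΦ : ∀ x, HasDerivAt Φ (m x) x) {t : ℝ} (ht : 0 < t) (x : ℝ) :
    HasDerivAt (fun t => charPot μ m Φ t x) (-laxFlux μ (charSol μ m t x)) t := by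
  rw [hasDerivAt_iff_isLittleO, Asymptotics.isLittleO_iff]
  intro c hc
  have hcont : Continuous fun s => laxFlux μ (charSol μ m s x) :=
    (continuous_laxFlux h0 h1).comp
      ((continuous_charSol h0 h1 hm hmono).comp (by fun_prop : Continuous fun s : ℝ => (s, x)))
  obtain ⟨d, hd, H⟩ := Metric.continuousAt_iff.1 (hcont.continuousAt (x := t)) c hc
  filter_upwards [Metric.ball_mem_nhds t hd, Ioi_mem_nhds ht] with s hs hs0
  have k1 := charPot_tangent_le h0 h1 hm hmono hΦ t x s x
  have k2 := charPot_tangent_le h0 h1 hm hmono hΦ s x t x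
  rw [max_eq_left (le_of_lt (mem_Ioi.1 hs0)), max_eq_left ht.le] at k1 k2
  have k3 := (H hs).le
  rw [Real.dist_eq] at k3
  rw [smul_eq_mul, Real.norm_eq_abs, Real.norm_eq_abs]
  have k4 : |charPot μ m Φ s x - charPot μ m Φ t x - (s - t) * -laxFlux μ (charSol μ m t x)|
      ≤ |(laxFlux μ (charSol μ m s x) - laxFlux μ (charSol μ m t x)) * (s - t)| := by
    rw [abs_of_nonneg (by linarith)]
    refine le_trans ?_ (neg_le_abs _)
    linarith
  refine k4.trans ?_
  rw [abs_mul]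
  exact mul_le_mul_of_nonneg_right k3 (abs_nonneg _)

theorem continuous_charPot (hΦ : ∀ x, HasDerivAt Φ (m x) x) :
    Continuous fun p : ℝ × ℝ => charPot μ m Φ p.1 p.2 := by
  have hc : Continuous Φ := continuous_iff_continuousAt.2 fun x => (hΦ x).continuousAt
  have c1 := continuous_charFoot h0 h1 hm hmono
  have c2 := continuous_charSol h0 h1 hm hmono
  have c3 := (continuous_laxFlux h0 h1).comp c2
  exact ((hc.comp c1).add (c2.mul (continuous_snd.sub c1))).sub
    ((continuous_fst.max continuous_const).mul c3)

/-- Truncating the data from below leaves the characteristics with values above k unchanged, and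
uniqueness of the foot settles the remaining points. Thus max(u, k) has a potential too, which the
entropy inequality will use. -/
theorem charSol_max (k t x : ℝ) :
    charSol μ (fun x => max (m x) k) t x = max (charSol μ m t x) k := by
  have hk : Continuous fun x => max (m x) k := hm.max continuous_const
  have hkm : Monotone fun x => max (m x) k := fun x y hxy => max_le_max_right k (hmono hxy)
  have e1 := charFoot_spec h0 h1 hm t x
  have e2 := charFoot_spec h0 h1 hk t x
  rcases le_or_gt k (charSol μ m t x) with h | h
  · have : charFoot μ (fun x => max (m x) k) t x = charFoot μ m t x := by
      apply charFoot_eq h0 h1 hk hkm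
      change _ + max t 0 * laxSpeed μ (max (charSol μ m t x) k) = x
      rw [max_eq_left h]
      exact e1
    rw [charSol, this]; rfl
  · rw [max_eq_right h.le, charSol]
    by_contra hn
    have hlt : k < m (charFoot μ (fun x => max (m x) k) t x) := by
      by_contra h'
      exact hn (max_eq_right (not_lt.1 h'))
    have : charFoot μ m t x = charFoot μ (fun x => max (m x) k) t x := by
      apply charFoot_eq h0 h1 hm hmono
      rw [charSol, max_eq_left hlt.le] at e2
      exact e2
    rw [charSol, this] at h
    exact absurd h (not_lt.2 hlt.le)

end Char


/-! ### Green's formula on the half plane for functions of class `C¹` -/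

theorem integrable_of_box {F : ℝ × ℝ → ℝ} (hF : Continuous F) {L : ℝ}
    (hz : ∀ p : ℝ × ℝ, L ≤ |p.1| ∨ L ≤ |p.2| → F p = 0) : Integrable F := by
  apply hF.integrable_of_hasCompactSupport
  apply HasCompactSupport.of_support_subset_isCompact
    ((isCompact_Icc (a := -L) (b := L)).prod (isCompact_Icc (a := -L) (b := L)))
  intro p hp
  by_contra hn
  apply hp
  apply hz
  by_contra h'
  rw [not_or, not_le, not_le, abs_lt, abs_lt] at h'
  exact hn ⟨⟨h'.1.1.le, h'.1.2.le⟩, ⟨h'.2.1.le, h'.2.2.le⟩⟩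

theorem integrable_of_interval {F : ℝ → ℝ} (hF : Continuous F) {L : ℝ}
    (hz : ∀ x, L ≤ |x| → F x = 0) : Integrable F := by
  apply hF.integrable_of_hasCompactSupport
  apply HasCompactSupport.of_support_subset_isCompact (isCompact_Icc (a := -L) (b := L))
  intro x hx
  by_contra hn
  apply hx
  apply hz
  by_contra h'
  rw [not_le, abs_lt] at h'
  exact hn ⟨h'.1.le, h'.2.le⟩

theorem setIntegral_upperHalf {F : ℝ × ℝ → ℝ} (hF : Integrable F) :
    ∫ p in upperHalf, F p = ∫ t in Ioi (0 : ℝ), ∫ x, F (t, x) := by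
  rw [upperHalf, Measure.volume_eq_prod, setIntegral_prod _ (by
    rw [← Measure.volume_eq_prod]; exact hF.integrableOn)]
  simp

theorem setIntegral_upperHalf_symm {F : ℝ × ℝ → ℝ} (hF : Integrable F) :
    ∫ p in upperHalf, F p = ∫ x, ∫ t in Ioi (0 : ℝ), F (t, x) := by
  rw [setIntegral_upperHalf hF]
  refine integral_integral_swap (f := fun t x => F (t, x)) ?_
  have : (volume.restrict (Ioi (0 : ℝ))).prod (volume : Measure ℝ)
      = (volume : Measure (ℝ × ℝ)).restrict (Ioi 0 ×ˢ univ) := by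
    rw [Measure.volume_eq_prod, ← Measure.prod_restrict, Measure.restrict_univ]
  rw [this]
  exact hF.integrableOn

theorem abs_sub_le_of_hasDerivAt {F F' : ℝ → ℝ} (hF : ∀ x, HasDerivAt F (F' x) x) {A : ℝ}
    (hA : ∀ x, |F' x| ≤ A) (x y : ℝ) : |F y - F x| ≤ A * |y - x| := by
  have := Convex.norm_image_sub_le_of_norm_hasDerivWithin_le (f := F) (f' := F') (s := univ)
    (fun z _ => (hF z).hasDerivWithinAt) (fun z _ => hA z) convex_univ (mem_univ x) (mem_univ y)
  simpa using this

theorem tendsto_quotient_right {F : ℝ → ℝ} {F' x : ℝ} (hF : HasDerivAt F F' x) {s : ℕ → ℝ}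
    (hs : ∀ n, 0 < s n) (hs0 : Tendsto s atTop (𝓝 0)) :
    Tendsto (fun n => (F (x + s n) - F x) / s n) atTop (𝓝 F') := by
  have h1 : Tendsto (fun n => s n) atTop (𝓝[≠] 0) :=
    tendsto_nhdsWithin_iff.2 ⟨hs0, Eventually.of_forall fun n => (hs n).ne'⟩
  have h2 := (hasDerivAt_iff_tendsto_slope_zero.1 hF).comp h1
  refine h2.congr fun n => ?_
  simp only [Function.comp_apply, smul_eq_mul]
  field_simp

theorem tendsto_quotient_left {F : ℝ → ℝ} {F' x : ℝ} (hF : HasDerivAt F F' x) {s : ℕ → ℝ}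
    (hs : ∀ n, 0 < s n) (hs0 : Tendsto s atTop (𝓝 0)) :
    Tendsto (fun n => (F x - F (x - s n)) / s n) atTop (𝓝 F') := by
  have h1 : Tendsto (fun n => -s n) atTop (𝓝[≠] 0) :=
    tendsto_nhdsWithin_iff.2 ⟨by simpa using hs0.neg,
      Eventually.of_forall fun n => by simpa using (hs n).ne'⟩
  have h2 := (hasDerivAt_iff_tendsto_slope_zero.1 hF).comp h1
  refine h2.congr fun n => ?_
  have := (hs n).ne'
  simp only [Function.comp_apply, smul_eq_mul, ← sub_eq_add_neg]
  field_simp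
  ring

/-- R is only of class C¹, so no mixed derivative is available. The x-derivative is replaced by a
difference quotient, for which one integrates by parts in t and translates in x; dominated
convergence then gives the limit. -/
theorem green_half_plane {R Rx Rt ψ ψx ψt : ℝ → ℝ → ℝ} {A L : ℝ}
    (cR : Continuous fun p : ℝ × ℝ => R p.1 p.2) (cRx : Continuous fun p : ℝ × ℝ => Rx p.1 p.2)
    (cRt : Continuous fun p : ℝ × ℝ => Rt p.1 p.2) (cψ : Continuous fun p : ℝ × ℝ => ψ p.1 p.2)
    (cψx : Continuous fun p : ℝ × ℝ => ψx p.1 p.2) (cψt : Continuous fun p : ℝ × ℝ => ψt p.1 p.2)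
    (hRx : ∀ t x, HasDerivAt (R t) (Rx t x) x)
    (hRt : ∀ t > 0, ∀ x, HasDerivAt (fun t => R t x) (Rt t x) t)
    (hψx : ∀ t x, HasDerivAt (ψ t) (ψx t x) x)
    (hψt : ∀ t > 0, ∀ x, HasDerivAt (fun t => ψ t x) (ψt t x) t)
    (hA : ∀ t x, |Rx t x| ≤ A)
    (z : ∀ t x, L ≤ |t| ∨ L ≤ |x| → ψ t x = 0) (zx : ∀ t x, L ≤ |t| ∨ L ≤ |x| → ψx t x = 0)
    (zt : ∀ t x, L ≤ |t| ∨ L ≤ |x| → ψt t x = 0) :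
    ∫ p in upperHalf, (Rx p.1 p.2 * ψt p.1 p.2 - Rt p.1 p.2 * ψx p.1 p.2)
      = -∫ x, Rx 0 x * ψ 0 x := by
  obtain ⟨s, hs⟩ : ∃ s : ℕ → ℝ, s = fun n : ℕ => 1 / ((n : ℝ) + 1) := ⟨_, rfl⟩
  have hsp : ∀ n, 0 < s n := fun n => by rw [hs]; positivity
  have hs1 : ∀ n, s n ≤ 1 := fun n => by
    rw [hs]; simp only; rw [div_le_one (by positivity)]; linarith [(Nat.cast_nonneg n : (0 : ℝ) ≤ n)]
  have hs0 : Tendsto s atTop (𝓝 0) := by rw [hs]; exact tendsto_one_div_add_atTop_nhds_zero_nat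
  set D : ℕ → ℝ → ℝ → ℝ := fun n t x => (R t (x + s n) - R t x) / s n with hD
  set Dt : ℕ → ℝ → ℝ → ℝ := fun n t x => (Rt t (x + s n) - Rt t x) / s n with hDt
  set E : ℕ → ℝ → ℝ → ℝ := fun n t x => (ψ t x - ψ t (x - s n)) / s n with hE
  have csh : ∀ c : ℝ, Continuous fun p : ℝ × ℝ => (p.1, p.2 + c) := fun c => by fun_prop
  have cD : ∀ n, Continuous fun p : ℝ × ℝ => D n p.1 p.2 := fun n =>
    ((cR.comp (csh (s n))).sub cR).div_const _
  have cDt : ∀ n, Continuous fun p : ℝ × ℝ => Dt n p.1 p.2 := fun n =>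
    ((cRt.comp (csh (s n))).sub cRt).div_const _
  have cE : ∀ n, Continuous fun p : ℝ × ℝ => E n p.1 p.2 := fun n => by
    have := (cψ.sub (cψ.comp (csh (-s n)))).div_const (s n)
    simp only [hE, sub_eq_add_neg] at this ⊢
    exact this
  have zE : ∀ n t x, L + 1 ≤ |t| ∨ L + 1 ≤ |x| → E n t x = 0 := by
    intro n t x h
    have e1 : ψ t x = 0 := z t x (h.imp (fun h => by linarith) (fun h => by linarith))
    have e2 : ψ t (x - s n) = 0 := by
      apply z
      refine h.imp (fun h => by linarith) (fun h => ?_)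
      have := abs_sub_abs_le_abs_sub x (s n)
      rw [abs_of_pos (hsp n)] at this
      linarith [hs1 n]
    simp [hE, e1, e2]
  -- the formula for difference quotients
  have key : ∀ n, (∫ p in upperHalf, D n p.1 p.2 * ψt p.1 p.2)
      - (∫ p in upperHalf, Rt p.1 p.2 * E n p.1 p.2) = -∫ x, D n 0 x * ψ 0 x := by
    intro n
    have i1 : Integrable fun p : ℝ × ℝ => D n p.1 p.2 * ψt p.1 p.2 :=
      integrable_of_box ((cD n).mul cψt) (L := L) fun p hp => by simp [zt _ _ hp]
    have i2 : Integrable fun p : ℝ × ℝ => Dt n p.1 p.2 * ψ p.1 p.2 :=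
      integrable_of_box ((cDt n).mul cψ) (L := L) fun p hp => by simp [z _ _ hp]
    have i3 : Integrable fun p : ℝ × ℝ => Rt p.1 p.2 * E n p.1 p.2 :=
      integrable_of_box (cRt.mul (cE n)) (L := L + 1) fun p hp => by simp [zE _ _ _ hp]
    have e1 : ∫ p in upperHalf, Dt n p.1 p.2 * ψ p.1 p.2
        = -∫ p in upperHalf, Rt p.1 p.2 * E n p.1 p.2 := by
      rw [setIntegral_upperHalf i2, setIntegral_upperHalf i3, ← integral_neg]
      congr 1
      funext t
      simp only
      have cRt' : Continuous (Rt t) := cRt.comp (by fun_prop : Continuous fun x : ℝ => (t, x))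
      have cψ' : Continuous (ψ t) := cψ.comp (by fun_prop : Continuous fun x : ℝ => (t, x))
      have j1 : Integrable fun x => Rt t (x + s n) * ψ t x :=
        integrable_of_interval ((cRt'.comp (by fun_prop)).mul cψ') (L := L) fun x hx => by
          simp [z t x (Or.inr hx)]
      have j2 : Integrable fun x => Rt t x * ψ t x :=
        integrable_of_interval (cRt'.mul cψ') (L := L) fun x hx => by simp [z t x (Or.inr hx)]
      have j3 : Integrable fun x => Rt t x * ψ t (x - s n) := by
        have := j1.comp_sub_right (s n)
        simpa using this
      have e2 : ∫ x, Rt t (x + s n) * ψ t x = ∫ x, Rt t x * ψ t (x - s n) := by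
        rw [← integral_sub_right_eq_self (fun x => Rt t (x + s n) * ψ t x) (s n)]
        simp
      calc ∫ x, Dt n t x * ψ t x
          = ∫ x, (Rt t (x + s n) * ψ t x - Rt t x * ψ t x) / s n := by
            congr 1; funext x; simp only [hDt]; ring
        _ = (∫ x, Rt t x * ψ t (x - s n) - Rt t x * ψ t x) / s n := by
            rw [integral_div, integral_sub j1 j2, e2, ← integral_sub j3 j2]
        _ = -∫ x, Rt t x * E n t x := by
            rw [← integral_div, ← integral_neg]
            congr 1; funext x; simp only [hE]; ring
    have e3 : ∫ p in upperHalf, (D n p.1 p.2 * ψt p.1 p.2 + Dt n p.1 p.2 * ψ p.1 p.2)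
        = -∫ x, D n 0 x * ψ 0 x := by
      rw [setIntegral_upperHalf_symm (F := fun p => D n p.1 p.2 * ψt p.1 p.2
        + Dt n p.1 p.2 * ψ p.1 p.2) (i1.add i2), ← integral_neg]
      congr 1
      funext x
      simp only
      have cx : Continuous fun t : ℝ => (t, x) := by fun_prop
      have c1 : Continuous fun t => D n t x * ψ t x := ((cD n).mul cψ).comp cx
      have c2 : Continuous fun t => D n t x * ψt t x + Dt n t x * ψ t x :=
        (((cD n).mul cψt).add ((cDt n).mul cψ)).comp cx
      have := integral_Ioi_of_hasDerivAt_of_tendsto (a := 0) (m := 0)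
        (f := fun t => D n t x * ψ t x) (f' := fun t => D n t x * ψt t x + Dt n t x * ψ t x)
        c1.continuousWithinAt (fun t ht => by
          have d1 : HasDerivAt (fun t => D n t x) (Dt n t x) t :=
            ((hRt t ht (x + s n)).sub (hRt t ht x)).div_const _
          exact (d1.mul (hψt t ht x)).congr_deriv (by ring))
        (integrable_of_interval c2 (L := L) fun t ht => by
          simp [z t x (Or.inl ht), zt t x (Or.inl ht)]).integrableOn
        (tendsto_const_nhds.congr' (by
          filter_upwards [eventually_ge_atTop L] with t ht
          rw [z t x (Or.inl (ht.trans (le_abs_self t))), mul_zero]))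
      rw [this, zero_sub]
    rw [integral_add i1.integrableOn i2.integrableOn, e1] at e3
    linarith
  -- passage to the limit
  obtain ⟨B, hB⟩ : ∃ B, ∀ t x, |ψx t x| ≤ B := by
    have hcs : HasCompactSupport fun p : ℝ × ℝ => ψx p.1 p.2 := by
      apply HasCompactSupport.of_support_subset_isCompact
        ((isCompact_Icc (a := -L) (b := L)).prod (isCompact_Icc (a := -L) (b := L)))
      intro p hp
      by_contra hn
      apply hp
      apply zx
      by_contra h'
      rw [not_or, not_le, not_le, abs_lt, abs_lt] at h'
      exact hn ⟨⟨h'.1.1.le, h'.1.2.le⟩, ⟨h'.2.1.le, h'.2.2.le⟩⟩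
    obtain ⟨B, hB⟩ := cψx.bounded_above_of_compact_support hcs
    exact ⟨B, fun t x => hB (t, x)⟩
  have hDA : ∀ n t x, |D n t x| ≤ A := fun n t x => by
    have := abs_sub_le_of_hasDerivAt (hRx t) (hA t) x (x + s n)
    rw [add_sub_cancel_left, abs_of_pos (hsp n)] at this
    simp only [hD]
    rwa [abs_div, abs_of_pos (hsp n), div_le_iff₀ (hsp n)]
  have hEB : ∀ n t x, |E n t x| ≤ B := fun n t x => by
    have := abs_sub_le_of_hasDerivAt (hψx t) (hB t) (x - s n) x
    rw [sub_sub_cancel, abs_of_pos (hsp n)] at this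
    simp only [hE]
    rwa [abs_div, abs_of_pos (hsp n), div_le_iff₀ (hsp n)]
  have l1 : Tendsto (fun n => ∫ p in upperHalf, D n p.1 p.2 * ψt p.1 p.2) atTop
      (𝓝 (∫ p in upperHalf, Rx p.1 p.2 * ψt p.1 p.2)) := by
    apply tendsto_integral_of_dominated_convergence
      (F := fun n (p : ℝ × ℝ) => D n p.1 p.2 * ψt p.1 p.2) (fun p : ℝ × ℝ => A * |ψt p.1 p.2|)
      (fun n => ((cD n).mul cψt).aestronglyMeasurable)
    · exact (integrable_of_box (continuous_const.mul cψt.abs) (L := L) fun p hp => by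
        simp [zt _ _ hp]).integrableOn
    · intro n
      refine Eventually.of_forall fun p => ?_
      rw [Real.norm_eq_abs, abs_mul]
      exact mul_le_mul_of_nonneg_right (hDA _ _ _) (abs_nonneg _)
    · exact Eventually.of_forall fun p => (tendsto_quotient_right (hRx _ _) hsp hs0).mul_const _
  have l2 : Tendsto (fun n => ∫ p in upperHalf, Rt p.1 p.2 * E n p.1 p.2) atTop
      (𝓝 (∫ p in upperHalf, Rt p.1 p.2 * ψx p.1 p.2)) := by
    set Q : Set (ℝ × ℝ) := Icc (-(L + 1)) (L + 1) ×ˢ Icc (-(L + 1)) (L + 1) with hQ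
    have hQc : IsCompact Q := isCompact_Icc.prod isCompact_Icc
    apply tendsto_integral_of_dominated_convergence
      (F := fun n (p : ℝ × ℝ) => Rt p.1 p.2 * E n p.1 p.2) (Q.indicator fun p => |Rt p.1 p.2| * B)
      (fun n => (cRt.mul (cE n)).aestronglyMeasurable)
    · exact (((cRt.abs.mul continuous_const).continuousOn.integrableOn_compact
        hQc).integrable_indicator hQc.measurableSet).integrableOn
    · intro n
      refine Eventually.of_forall fun p => ?_
      by_cases hp : p ∈ Q
      · rw [indicator_of_mem hp, Real.norm_eq_abs, abs_mul]
        exact mul_le_mul_of_nonneg_left (hEB _ _ _) (abs_nonneg _)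
      · rw [indicator_of_notMem hp, zE n p.1 p.2, mul_zero, norm_zero]
        by_contra h'
        rw [not_or, not_le, not_le, abs_lt, abs_lt] at h'
        exact hp ⟨⟨h'.1.1.le, h'.1.2.le⟩, ⟨h'.2.1.le, h'.2.2.le⟩⟩
    · exact Eventually.of_forall fun p => (tendsto_quotient_left (hψx _ _) hsp hs0).const_mul _
  have c0 : Continuous fun x : ℝ => ((0 : ℝ), x) := by fun_prop
  have l3 : Tendsto (fun n => -∫ x, D n 0 x * ψ 0 x) atTop (𝓝 (-∫ x, Rx 0 x * ψ 0 x)) := by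
    apply Tendsto.neg
    apply tendsto_integral_of_dominated_convergence
      (F := fun n x => D n 0 x * ψ 0 x) (fun x => A * |ψ 0 x|)
      (fun n => (((cD n).mul cψ).comp c0).aestronglyMeasurable)
    · exact integrable_of_interval ((continuous_const.mul cψ.abs).comp c0) (L := L) fun x hx => by
        simp [z 0 x (Or.inr hx)]
    · intro n
      refine Eventually.of_forall fun x => ?_
      rw [Real.norm_eq_abs, abs_mul]
      exact mul_le_mul_of_nonneg_right (hDA _ _ _) (abs_nonneg _)
    · exact Eventually.of_forall fun x => (tendsto_quotient_right (hRx _ _) hsp hs0).mul_const _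
  have hfin := tendsto_nhds_unique ((l1.sub l2).congr key) l3
  rw [← hfin, integral_sub]
  · exact (integrable_of_box (cRx.mul cψt) (L := L) fun p hp => by simp [zt _ _ hp]).integrableOn
  · exact (integrable_of_box (cRt.mul cψx) (L := L) fun p hp => by simp [zx _ _ hp]).integrableOn


/-! ### Test functions -/

namespace IsTestFunction

variable {η : ℝ × ℝ → ℝ}

theorem exists_box (hη : IsTestFunction η) : ∃ L : ℝ, ∀ p : ℝ × ℝ, L ≤ |p.1| ∨ L ≤ |p.2| →
    η p = 0 ∧ dt η p = 0 ∧ dx η p = 0 := by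
  obtain ⟨L, hL⟩ := hη.compact.isCompact.isBounded.subset_ball 0
  refine ⟨L, fun p hp => ?_⟩
  have hp' : p ∉ tsupport η := by
    intro h
    have := hL h
    rw [mem_ball_zero_iff, Prod.norm_def, max_lt_iff, Real.norm_eq_abs, Real.norm_eq_abs] at this
    rcases hp with hp | hp <;> linarith [this.1, this.2]
  have hf : fderiv ℝ η p = 0 := by
    by_contra hn
    exact hp' (support_fderiv_subset ℝ hn)
  exact ⟨image_eq_zero_of_notMem_tsupport hp', by simp [dt, hf], by simp [dx, hf]⟩

theorem continuous (hη : IsTestFunction η) : Continuous η := hη.smooth.continuous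

theorem continuous_dt (hη : IsTestFunction η) : Continuous (dt η) :=
  (hη.smooth.continuous_fderiv (by simp)).clm_apply continuous_const

theorem continuous_dx (hη : IsTestFunction η) : Continuous (dx η) :=
  (hη.smooth.continuous_fderiv (by simp)).clm_apply continuous_const

theorem hasDerivAt_dt (hη : IsTestFunction η) (t x : ℝ) :
    HasDerivAt (fun t => η (t, x)) (dt η (t, x)) t :=
  (hη.smooth.differentiable (by simp) (t, x)).hasFDerivAt.comp_hasDerivAt t
    ((hasDerivAt_id t).prodMk (hasDerivAt_const t x))

theorem hasDerivAt_dx (hη : IsTestFunction η) (t x : ℝ) :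
    HasDerivAt (fun x => η (t, x)) (dx η (t, x)) x :=
  (hη.smooth.differentiable (by simp) (t, x)).hasFDerivAt.comp_hasDerivAt x
    ((hasDerivAt_const x t).prodMk (hasDerivAt_id x))

end IsTestFunction

/-! ### Potentials of class `C¹` on the half plane -/

/-- `R` is a function of class `C¹` on `t ≥ 0`, with derivatives `Rx` and `Rt`. -/
structure IsPotential (R Rx Rt : ℝ → ℝ → ℝ) (A : ℝ) : Prop where
  cont : Continuous fun p : ℝ × ℝ => R p.1 p.2
  cont_x : Continuous fun p : ℝ × ℝ => Rx p.1 p.2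
  cont_t : Continuous fun p : ℝ × ℝ => Rt p.1 p.2
  deriv_x : ∀ t x, HasDerivAt (R t) (Rx t x) x
  deriv_t : ∀ t > 0, ∀ x, HasDerivAt (fun t => R t x) (Rt t x) t
  bound : ∀ t x, |Rx t x| ≤ A

theorem isPotential_affine (k d : ℝ) :
    IsPotential (fun t x => k * x + d * t) (fun _ _ => k) (fun _ _ => d) |k| where
  cont := by fun_prop
  cont_x := continuous_const
  cont_t := continuous_const
  deriv_x t x := by simpa using ((hasDerivAt_id x).const_mul k).add_const (d * t)
  deriv_t t _ x := by simpa using ((hasDerivAt_id t).const_mul d).const_add (k * x)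
  bound _ _ := le_rfl

theorem IsPotential.sub {R Rx Rt R' Rx' Rt' : ℝ → ℝ → ℝ} {A A' : ℝ} (h : IsPotential R Rx Rt A)
    (h' : IsPotential R' Rx' Rt' A') :
    IsPotential (fun t x => R t x - R' t x) (fun t x => Rx t x - Rx' t x)
      (fun t x => Rt t x - Rt' t x) (A + A') where
  cont := h.cont.sub h'.cont
  cont_x := h.cont_x.sub h'.cont_x
  cont_t := h.cont_t.sub h'.cont_t
  deriv_x t x := (h.deriv_x t x).sub (h'.deriv_x t x)
  deriv_t t ht x := (h.deriv_t t ht x).sub (h'.deriv_t t ht x)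
  bound t x := (abs_sub _ _).trans (add_le_add (h.bound t x) (h'.bound t x))

theorem isPotential_charPot {μ : ℝ} {m Φ : ℝ → ℝ} (h0 : 0 < μ) (h1 : μ < 1) (hm : Continuous m)
    (hmono : Monotone m) (hΦ : ∀ x, HasDerivAt Φ (m x) x) {A : ℝ} (hA : ∀ x, |m x| ≤ A) :
    IsPotential (charPot μ m Φ) (charSol μ m) (fun t x => -laxFlux μ (charSol μ m t x)) A where
  cont := continuous_charPot h0 h1 hm hmono hΦ
  cont_x := continuous_charSol h0 h1 hm hmono
  cont_t := ((continuous_laxFlux h0 h1).comp (continuous_charSol h0 h1 hm hmono)).neg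
  deriv_x t x := hasDerivAt_charPot_x h0 h1 hm hmono hΦ t x
  deriv_t _ ht x := hasDerivAt_charPot_t h0 h1 hm hmono hΦ ht x
  bound _ _ := hA _

namespace IsPotential

variable {R Rx Rt W Wx Wt : ℝ → ℝ → ℝ} {A B : ℝ} {η : ℝ × ℝ → ℝ}

/-- The weak form of `(Rx)_t - (Rt)_x` restricted to the region `W < 0`. -/
def cutForm (R : ℝ → ℝ → ℝ) (Rt : ℝ → ℝ → ℝ) (W : ℝ → ℝ → ℝ) (η : ℝ × ℝ → ℝ) : ℝ :=
  (∫ p in upperHalf, if W p.1 p.2 < 0 then R p.1 p.2 * dt η p - Rt p.1 p.2 * dx η p else 0)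
    + ∫ x, if W 0 x < 0 then R 0 x * η (0, x) else 0

theorem weak_eq (hR : IsPotential R Rx Rt A) (hη : IsTestFunction η) :
    (∫ p in upperHalf, (Rx p.1 p.2 * dt η p - Rt p.1 p.2 * dx η p)) + ∫ x, Rx 0 x * η (0, x) = 0 := by
  obtain ⟨L, hL⟩ := hη.exists_box
  have := green_half_plane hR.cont hR.cont_x hR.cont_t (ψ := fun t x => η (t, x))
    (ψx := fun t x => dx η (t, x)) (ψt := fun t x => dt η (t, x)) hη.continuous hη.continuous_dx
    hη.continuous_dt hR.deriv_x hR.deriv_t hη.hasDerivAt_dx (fun t _ x => hη.hasDerivAt_dt t x)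
    hR.bound (fun t x h => (hL (t, x) h).1) (fun t x h => (hL (t, x) h).2.2)
    (fun t x h => (hL (t, x) h).2.1)
  simp only [Prod.mk.eta] at this
  rw [this, neg_add_cancel]

theorem integrable_form (hR : IsPotential R Rx Rt A) (hη : IsTestFunction η) :
    Integrable fun p : ℝ × ℝ => Rx p.1 p.2 * dt η p - Rt p.1 p.2 * dx η p := by
  obtain ⟨L, hL⟩ := hη.exists_box
  exact integrable_of_box ((hR.cont_x.mul hη.continuous_dt).sub (hR.cont_t.mul hη.continuous_dx))
    (L := L) fun p hp => by simp [(hL p hp).2.1, (hL p hp).2.2]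

theorem integrable_initial (hR : IsPotential R Rx Rt A) (hη : IsTestFunction η) :
    Integrable fun x => Rx 0 x * η (0, x) := by
  obtain ⟨L, hL⟩ := hη.exists_box
  have c0 : Continuous fun x : ℝ => ((0 : ℝ), x) := by fun_prop
  exact integrable_of_interval ((hR.cont_x.mul hη.continuous).comp c0) (L := L)
    fun x hx => by simp [(hL (0, x) (Or.inr hx)).1]

/-- Green's formula is used with the test function h(nW) η, where h(nW) tends to the indicator of W
< 0. Differentiating h(nW) contributes only through the Jacobian of R and W. -/
theorem tendsto_cutForm (hR : IsPotential R Rx Rt A) (hW : IsPotential W Wx Wt B)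
    (hη : IsTestFunction η) : ∃ h' : ℝ → ℝ, (∀ y, h' y ≤ 0) ∧
    Tendsto (fun n : ℕ => -∫ p in upperHalf, n * h' (n * W p.1 p.2) * η p
      * (Rx p.1 p.2 * Wt p.1 p.2 - Rt p.1 p.2 * Wx p.1 p.2)) atTop (𝓝 (cutForm Rx Rt W η)) := by
  obtain ⟨L, hL⟩ := hη.exists_box
  obtain ⟨h, hh⟩ : ∃ h : ℝ → ℝ, h = fun y => Real.smoothTransition (-y) := ⟨_, rfl⟩
  have hsm : ContDiff ℝ 1 h := by
    rw [hh]; exact Real.smoothTransition.contDiff.comp contDiff_neg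
  have hd : ∀ y, HasDerivAt h (deriv h y) y := fun y =>
    (hsm.differentiable (by simp) y).hasDerivAt
  have hdc : Continuous (deriv h) := hsm.continuous_deriv le_rfl
  have hanti : Antitone h := by
    rw [hh]; exact fun x y hxy => Real.smoothTransition.monotone (by linarith)
  have hnn : ∀ y, 0 ≤ h y := fun y => by rw [hh]; exact Real.smoothTransition.nonneg _
  have hle : ∀ y, h y ≤ 1 := fun y => by rw [hh]; exact Real.smoothTransition.le_one _
  have hlim : ∀ w : ℝ, Tendsto (fun n : ℕ => h (n * w)) atTop (𝓝 (if w < 0 then 1 else 0)) := by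
    intro w
    split_ifs with hw
    · apply tendsto_const_nhds.congr'
      filter_upwards [tendsto_natCast_atTop_atTop.eventually_ge_atTop (1 / -w)] with n hn
      rw [div_le_iff₀ (by linarith)] at hn
      rw [hh]
      exact (Real.smoothTransition.one_of_one_le (by linarith)).symm
    · apply tendsto_const_nhds.congr
      intro n
      rw [hh]
      refine (Real.smoothTransition.zero_of_nonpos ?_).symm
      have := mul_nonneg (Nat.cast_nonneg n : (0 : ℝ) ≤ n) (not_lt.1 hw)
      linarith
  refine ⟨deriv h, fun y => hanti.deriv_nonpos, ?_⟩
  have hint := hR.integrable_form hη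
  have hint0 := hR.integrable_initial hη
  have c0 : Continuous fun x : ℝ => ((0 : ℝ), x) := by fun_prop
  have cW : ∀ n : ℕ, Continuous fun p : ℝ × ℝ => h (n * W p.1 p.2) := fun n =>
    hsm.continuous.comp (continuous_const.mul hW.cont)
  have cW' : ∀ n : ℕ, Continuous fun p : ℝ × ℝ => deriv h (n * W p.1 p.2) := fun n =>
    hdc.comp (continuous_const.mul hW.cont)
  have key : ∀ n : ℕ, (∫ p in upperHalf, h (n * W p.1 p.2)
        * (Rx p.1 p.2 * dt η p - Rt p.1 p.2 * dx η p)) + ∫ x, h (n * W 0 x) * (Rx 0 x * η (0, x))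
      = -∫ p in upperHalf, n * deriv h (n * W p.1 p.2) * η p
        * (Rx p.1 p.2 * Wt p.1 p.2 - Rt p.1 p.2 * Wx p.1 p.2) := by
    intro n
    have G := green_half_plane hR.cont hR.cont_x hR.cont_t
      (ψ := fun t x => h (n * W t x) * η (t, x))
      (ψx := fun t x => deriv h (n * W t x) * (n * Wx t x) * η (t, x)
        + h (n * W t x) * dx η (t, x))
      (ψt := fun t x => deriv h (n * W t x) * (n * Wt t x) * η (t, x)
        + h (n * W t x) * dt η (t, x)) (L := L)
      ((cW n).mul hη.continuous)
      ((((cW' n).mul (continuous_const.mul hW.cont_x)).mul hη.continuous).add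
        ((cW n).mul hη.continuous_dx))
      ((((cW' n).mul (continuous_const.mul hW.cont_t)).mul hη.continuous).add
        ((cW n).mul hη.continuous_dt))
      hR.deriv_x hR.deriv_t
      (fun t x => (((hd _).comp x ((hW.deriv_x t x).const_mul (n : ℝ))).mul
        (hη.hasDerivAt_dx t x)))
      (fun t ht x => ((HasDerivAt.comp (h₂ := h) t (hd _)
        ((hW.deriv_t t ht x).const_mul (n : ℝ))).mul (hη.hasDerivAt_dt t x)))
      hR.bound (fun t x hp => by simp [(hL (t, x) hp).1])
      (fun t x hp => by simp [(hL (t, x) hp).1, (hL (t, x) hp).2.2])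
      (fun t x hp => by simp [(hL (t, x) hp).1, (hL (t, x) hp).2.1])
    simp only [Prod.mk.eta] at G
    have i1 : Integrable fun p : ℝ × ℝ => h (n * W p.1 p.2)
        * (Rx p.1 p.2 * dt η p - Rt p.1 p.2 * dx η p) :=
      integrable_of_box ((cW n).mul ((hR.cont_x.mul hη.continuous_dt).sub
        (hR.cont_t.mul hη.continuous_dx))) (L := L) fun p hp => by
          simp [(hL p hp).2.1, (hL p hp).2.2]
    have i2 : Integrable fun p : ℝ × ℝ => n * deriv h (n * W p.1 p.2) * η p
        * (Rx p.1 p.2 * Wt p.1 p.2 - Rt p.1 p.2 * Wx p.1 p.2) :=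
      integrable_of_box (((continuous_const.mul (cW' n)).mul hη.continuous).mul
        ((hR.cont_x.mul hW.cont_t).sub (hR.cont_t.mul hW.cont_x))) (L := L) fun p hp => by
          simp [(hL p hp).1]
    have e1 : ∫ p in upperHalf, (Rx p.1 p.2 * (deriv h (n * W p.1 p.2) * (n * Wt p.1 p.2) * η p
          + h (n * W p.1 p.2) * dt η p) - Rt p.1 p.2 * (deriv h (n * W p.1 p.2)
          * (n * Wx p.1 p.2) * η p + h (n * W p.1 p.2) * dx η p))
        = (∫ p in upperHalf, h (n * W p.1 p.2) * (Rx p.1 p.2 * dt η p - Rt p.1 p.2 * dx η p))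
          + ∫ p in upperHalf, n * deriv h (n * W p.1 p.2) * η p
            * (Rx p.1 p.2 * Wt p.1 p.2 - Rt p.1 p.2 * Wx p.1 p.2) := by
      rw [← integral_add i1.integrableOn i2.integrableOn]
      congr 1
      funext p
      ring
    rw [e1] at G
    have e2 : ∫ x, Rx 0 x * (h (n * W 0 x) * η (0, x)) = ∫ x, h (n * W 0 x) * (Rx 0 x * η (0, x)) := by
      congr 1; funext x; ring
    rw [e2] at G
    linarith
  refine Tendsto.congr key (Tendsto.add ?_ ?_)
  · apply tendsto_integral_of_dominated_convergence
      (F := fun (n : ℕ) (p : ℝ × ℝ) => h (n * W p.1 p.2)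
        * (Rx p.1 p.2 * dt η p - Rt p.1 p.2 * dx η p))
      (fun p : ℝ × ℝ => |Rx p.1 p.2 * dt η p - Rt p.1 p.2 * dx η p|)
      (fun n => ((cW n).aestronglyMeasurable.mul hint.aestronglyMeasurable.restrict))
      hint.abs.integrableOn
    · intro n
      refine Eventually.of_forall fun p => ?_
      rw [Real.norm_eq_abs, abs_mul, abs_of_nonneg (hnn _)]
      exact mul_le_of_le_one_left (abs_nonneg _) (hle _)
    · refine Eventually.of_forall fun p => ?_
      have := (hlim (W p.1 p.2)).mul_const (Rx p.1 p.2 * dt η p - Rt p.1 p.2 * dx η p)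
      simpa only [ite_mul, one_mul, zero_mul] using this
  · apply tendsto_integral_of_dominated_convergence
      (F := fun (n : ℕ) x => h (n * W 0 x) * (Rx 0 x * η (0, x)))
      (fun x => |Rx 0 x * η (0, x)|)
      (fun n => (((cW n).comp c0).aestronglyMeasurable.mul hint0.aestronglyMeasurable))
      hint0.abs
    · intro n
      refine Eventually.of_forall fun x => ?_
      rw [Real.norm_eq_abs, abs_mul, abs_of_nonneg (hnn _)]
      exact mul_le_of_le_one_left (abs_nonneg _) (hle _)
    · refine Eventually.of_forall fun x => ?_
      have := (hlim (W 0 x)).mul_const (Rx 0 x * η (0, x))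
      simpa only [ite_mul, one_mul, zero_mul] using this

/-- The Jacobian of W with itself vanishes. In other words, cutting at the zero level of a
continuous potential satisfies the Rankine-Hugoniot condition automatically. -/
theorem cutForm_self (hW : IsPotential W Wx Wt B) (hη : IsTestFunction η) :
    cutForm Wx Wt W η = 0 := by
  obtain ⟨h', _, ht⟩ := hW.tendsto_cutForm hW hη
  refine tendsto_nhds_unique ht (tendsto_const_nhds.congr fun n => ?_)
  have : ∀ p : ℝ × ℝ, n * h' (n * W p.1 p.2) * η p
      * (Wx p.1 p.2 * Wt p.1 p.2 - Wt p.1 p.2 * Wx p.1 p.2) = 0 := fun p => by ring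
  simp [this]

theorem cutForm_nonneg (hR : IsPotential R Rx Rt A) (hW : IsPotential W Wx Wt B)
    (hη : IsTestFunction η) (hpos : ∀ p, 0 ≤ η p)
    (hS : ∀ t x, 0 ≤ Rx t x * Wt t x - Rt t x * Wx t x) : 0 ≤ cutForm Rx Rt W η := by
  obtain ⟨h', hh, ht⟩ := hR.tendsto_cutForm hW hη
  refine ge_of_tendsto ht (Eventually.of_forall fun n => ?_)
  rw [neg_nonneg]
  apply integral_nonpos
  intro p
  apply mul_nonpos_of_nonpos_of_nonneg _ (hS _ _)
  exact mul_nonpos_of_nonpos_of_nonneg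
    (mul_nonpos_of_nonneg_of_nonpos (Nat.cast_nonneg n) (hh _)) (hpos p)

end IsPotential


/-! ### Total variation of differences of monotone functions -/

theorem totVar_sub_le {A B : ℝ → ℝ} (hA : Monotone A) (hB : Monotone B) {a b : ℝ}
    (ha : ∀ x y, A y - A x ≤ a) (hb : ∀ x y, B y - B x ≤ b) :
    totVar (fun x => A x - B x) ≤ ENNReal.ofReal (a + b) := by
  refine iSup_le fun p => ?_
  obtain ⟨n, u, hu, -⟩ := p
  simp only
  have hstep : ∀ i, edist (A (u (i + 1)) - B (u (i + 1))) (A (u i) - B (u i))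
      ≤ ENNReal.ofReal ((A (u (i + 1)) + B (u (i + 1))) - (A (u i) + B (u i))) := by
    intro i
    rw [edist_dist, Real.dist_eq]
    apply ENNReal.ofReal_le_ofReal
    have h1 := hA (hu (Nat.le_succ i))
    have h2 := hB (hu (Nat.le_succ i))
    rw [Nat.succ_eq_add_one] at h1 h2
    rw [abs_le]
    constructor <;> linarith
  calc ∑ i ∈ Finset.range n, edist (A (u (i + 1)) - B (u (i + 1))) (A (u i) - B (u i))
      ≤ ∑ i ∈ Finset.range n,
          ENNReal.ofReal ((A (u (i + 1)) + B (u (i + 1))) - (A (u i) + B (u i))) :=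
        Finset.sum_le_sum fun i _ => hstep i
    _ = ENNReal.ofReal (∑ i ∈ Finset.range n,
          ((A (u (i + 1)) + B (u (i + 1))) - (A (u i) + B (u i)))) := by
        rw [ENNReal.ofReal_sum_of_nonneg]
        intro i _
        have h1 := hA (hu (Nat.le_succ i))
        have h2 := hB (hu (Nat.le_succ i))
        rw [Nat.succ_eq_add_one] at h1 h2
        linarith
    _ ≤ ENNReal.ofReal (a + b) := by
        apply ENNReal.ofReal_le_ofReal
        rw [Finset.sum_range_sub fun i => A (u i) + B (u i)]
        linarith [ha (u 0) (u n), hb (u 0) (u n)]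

/-! ### The exact solution -/

theorem integral_add_two_mul_sub {α : Type*} [MeasurableSpace α] {ν : Measure α} {A B C : α → ℝ}
    (hA : Integrable A ν) (hB : Integrable B ν) (hC : Integrable C ν) :
    ∫ x, (A x + (2 * B x - C x)) ∂ν = (∫ x, A x ∂ν) + (2 * (∫ x, B x ∂ν) - ∫ x, C x ∂ν) := by
  have h : Integrable (fun x => 2 * B x - C x) ν := (hB.const_mul 2).sub hC
  rw [integral_add hA h, integral_sub (hB.const_mul 2) hC,
    integral_const_mul]

section Exact

variable {μ : ℝ} {m Φ : ℝ → ℝ} {a uL : ℝ}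

/-- The exact solution with increasing data `m` on the left of a shock and `0` on the right. -/
def exactSol (μ : ℝ) (m Φ : ℝ → ℝ) (t x : ℝ) : ℝ :=
  if charPot μ m Φ t x < 0 then charSol μ m t x else 0

theorem totVar_exactSol_le (h0 : 0 < μ) (h1 : μ < 1) (hm : Continuous m) (hmono : Monotone m)
    (hΦ : ∀ x, HasDerivAt Φ (m x) x) (ha : 0 < a) (hma : ∀ x, a ≤ m x) (hmL : ∀ x, m x ≤ uL)
    (t : ℝ) : totVar (exactSol μ m Φ t) ≤ ENNReal.ofReal (uL + uL) := by
  have hW : Monotone (charPot μ m Φ t) := monotone_of_hasDerivAt_nonneg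
    (fun x => hasDerivAt_charPot_x h0 h1 hm hmono hΦ t x) (fun x => ha.le.trans (hma _))
  have hu := charSol_mono h0 h1 hm hmono t
  have hL : 0 ≤ uL := by linarith [hma 0, hmL 0]
  have hu0 : ∀ x, 0 ≤ charSol μ m t x := fun x => ha.le.trans (hma _)
  have huL : ∀ x, charSol μ m t x ≤ uL := fun x => hmL _
  -- Adding and subtracting uL beyond the shock writes the solution as a difference of two
  -- increasing functions.
  have e : exactSol μ m Φ t = fun x => (if charPot μ m Φ t x < 0 then charSol μ m t x else uL)
      - (if charPot μ m Φ t x < 0 then 0 else uL) := by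
    funext x
    rw [exactSol]
    split_ifs <;> simp
  rw [e]
  apply totVar_sub_le
  · intro x y hxy
    have := hW hxy
    simp only
    split_ifs with h h'
    · exact hu hxy
    · exact huL _
    · linarith
    · exact le_rfl
  · intro x y hxy
    have := hW hxy
    simp only
    split_ifs with h h'
    · exact le_rfl
    · exact hL
    · linarith
    · exact le_rfl
  · intro x y
    have h3 := hu0 x
    have h4 := huL y
    split_ifs <;> linarith
  · intro x y
    split_ifs <;> linarith

/-- The weak equation is `IsPotential.cutForm_self`, and V = 0 because g vanishes on all values of
U. For k < 0 the entropy inequality is linear. For k ≥ 0 one has |U - k| = k + 2 (max(u, k) - k) - U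
where W < 0 and |U - k| = k - U elsewhere; only the middle term fails to be conserved, and
`laxFlux_chord` gives its sign. -/
theorem isEntropySolution_exactSol (h0 : 0 < μ) (h1 : μ < 1) (hm : Continuous m)
    (hmono : Monotone m) (hΦ : ∀ x, HasDerivAt Φ (m x) x) (hΦ0 : Φ 0 = 0) (ha : 0 < a)
    (hma : ∀ x, a ≤ m x) (hmL : ∀ x, m x ≤ uL) {g : ℝ → ℝ} (hg0 : g 0 = 0)
    (hg : ∀ u, a ≤ u → u ≤ uL → g u = 0) {u₀ : ℝ → ℝ} (hu₀ : ∀ x, u₀ x = if x < 0 then m x else 0)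
    (lam : ℝ) :
    IsEntropySolution (laxFlux μ) lam g u₀ (fun _ => 0) (exactSol μ m Φ) (fun _ _ => 0) := by
  have hL : 0 ≤ uL := by linarith [hma 0, hmL 0]
  have hW : IsPotential (charPot μ m Φ) (charSol μ m) (fun t x => -laxFlux μ (charSol μ m t x)) uL :=
    isPotential_charPot h0 h1 hm hmono hΦ fun x => by
      rw [abs_of_nonneg (ha.le.trans (hma x))]; exact hmL x
  have hneg : ∀ x, charPot μ m Φ 0 x < 0 ↔ x < 0 := by
    intro x
    rw [charPot_zero h0 h1 hm hmono]
    have hmonoΦ : StrictMono Φ := strictMono_of_deriv_pos fun x => by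
      rw [(hΦ x).deriv]; linarith [hma x]
    have := hmonoΦ.lt_iff_lt (a := x) (b := 0)
    rwa [hΦ0] at this
  have hmeas : MeasurableSet {p : ℝ × ℝ | charPot μ m Φ p.1 p.2 < 0} :=
    (isOpen_lt hW.cont continuous_const).measurableSet
  have hinit : ∀ x, u₀ x = if charPot μ m Φ 0 x < 0 then charSol μ m 0 x else 0 := by
    intro x
    rw [hu₀, charSol_zero h0 h1 hm hmono]
    simp only [hneg]
  have hUnn : ∀ t x, 0 ≤ exactSol μ m Φ t x := fun t x => by
    rw [exactSol]; split_ifs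
    · exact ha.le.trans (hma _)
    · exact le_rfl
  have hweak : ∀ η, IsTestFunction η →
      (∫ p in upperHalf, (exactSol μ m Φ p.1 p.2 * dt η p
        + laxFlux μ (exactSol μ m Φ p.1 p.2) * dx η p)) + ∫ x : ℝ, u₀ x * η (0, x) = 0 := by
    intro η hη
    refine Eq.trans ?_ (hW.cutForm_self hη)
    rw [IsPotential.cutForm]
    congr 1
    · congr 1
      funext p
      rw [exactSol]
      split_ifs
      · ring
      · rw [laxFlux_zero]; ring
    · congr 1
      funext x
      rw [hinit]
      split_ifs <;> ring
  have hint : ∀ η, IsTestFunction η → Integrable fun p : ℝ × ℝ =>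
      exactSol μ m Φ p.1 p.2 * dt η p + laxFlux μ (exactSol μ m Φ p.1 p.2) * dx η p := by
    intro η hη
    have := (hW.integrable_form hη).indicator hmeas
    refine this.congr (Eventually.of_forall fun p => ?_)
    simp only [indicator, mem_ofPred_eq, exactSol]
    split_ifs
    · ring
    · rw [laxFlux_zero]; ring
  have hint0 : ∀ η, IsTestFunction η → Integrable fun x : ℝ => u₀ x * η (0, x) := by
    intro η hη
    have := (hW.integrable_initial hη).indicator (measurableSet_Iio (a := (0 : ℝ)))
    refine this.congr (Eventually.of_forall fun x => ?_)
    simp only [indicator, mem_Iio, hu₀, charSol_zero h0 h1 hm hmono]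
    split_ifs <;> ring
  refine ⟨?_, measurable_const, ⟨uL, fun t _ x => ⟨?_, by simpa using hL⟩⟩, hweak, ?_, ?_⟩
  · exact Measurable.ite hmeas hW.cont_x.measurable measurable_const
  · rw [abs_of_nonneg (hUnn t x), exactSol]
    split_ifs
    · exact hmL _
    · exact hL
  · intro η _
    have hgU : ∀ t x, g (exactSol μ m Φ t x) = 0 := fun t x => by
      rw [exactSol]; split_ifs
      · exact hg _ (hma _) (hmL _)
      · exact hg0
    simp [hgU]
  · intro k η hη hpos
    have hK := isPotential_affine k (-laxFlux μ k)
    have eK := hK.weak_eq hη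
    have iK := hK.integrable_form hη
    have iK0 := hK.integrable_initial hη
    rcases lt_or_ge k 0 with hk | hk
    · have e1 : ∀ p : ℝ × ℝ, |exactSol μ m Φ p.1 p.2 - k| * dt η p
          + Real.sign (exactSol μ m Φ p.1 p.2 - k)
            * (laxFlux μ (exactSol μ m Φ p.1 p.2) - laxFlux μ k) * dx η p
          = (exactSol μ m Φ p.1 p.2 * dt η p + laxFlux μ (exactSol μ m Φ p.1 p.2) * dx η p)
            - (k * dt η p - -laxFlux μ k * dx η p) := by
        intro p
        have : 0 < exactSol μ m Φ p.1 p.2 - k := by linarith [hUnn p.1 p.2]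
        rw [abs_of_pos this, Real.sign_of_pos this]
        ring
      have e2 : ∀ x, |u₀ x - k| * η (0, x) = u₀ x * η (0, x) - k * η (0, x) := by
        intro x
        have : 0 ≤ u₀ x := by
          rw [hu₀]; split_ifs
          · exact ha.le.trans (hma _)
          · exact le_rfl
        rw [abs_of_pos (by linarith)]
        ring
      simp only [e1, e2]
      rw [integral_sub (hint η hη).integrableOn iK.integrableOn, integral_sub (hint0 η hη) iK0]
      linarith [hweak η hη]
    · have hk' : Continuous fun x => max (m x) k := hm.max continuous_const
      have hkm : Monotone fun x => max (m x) k := fun x y hxy => max_le_max_right k (hmono hxy)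
      have hΦk : ∀ x, HasDerivAt (fun x => ∫ s in (0 : ℝ)..x, max (m s) k) (max (m x) k) x :=
        fun x => intervalIntegral.integral_hasDerivAt_right (hk'.intervalIntegrable _ _)
          (hk'.stronglyMeasurableAtFilter _ _) hk'.continuousAt
      have hPk := isPotential_charPot h0 h1 hk' hkm hΦk (A := max uL k) fun x => by
        rw [abs_of_nonneg (hk.trans (le_max_right _ _))]
        exact max_le_max_right k (hmL x)
      have hR := hPk.sub hK
      -- The Jacobian is k f(u) - u f(k) where u ≥ k, and zero where u < k.
      have hpos' := hR.cutForm_nonneg hW hη hpos (by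
        intro t x
        simp only [charSol_max h0 h1 hm hmono]
        rcases le_or_gt k (charSol μ m t x) with h | h
        · rw [max_eq_left h]
          have := laxFlux_chord h0 h1 hk h
          linarith
        · rw [max_eq_right h.le]
          simp)
      have iR := (hR.integrable_form hη).indicator hmeas
      have iR0 := (hR.integrable_initial hη).indicator (measurableSet_Iio (a := (0 : ℝ)))
      have e1 : ∀ p : ℝ × ℝ, |exactSol μ m Φ p.1 p.2 - k| * dt η p
          + Real.sign (exactSol μ m Φ p.1 p.2 - k)
            * (laxFlux μ (exactSol μ m Φ p.1 p.2) - laxFlux μ k) * dx η p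
          = (k * dt η p - -laxFlux μ k * dx η p)
            + (2 * (if charPot μ m Φ p.1 p.2 < 0 then
                (charSol μ (fun x => max (m x) k) p.1 p.2 - k) * dt η p
                - (-laxFlux μ (charSol μ (fun x => max (m x) k) p.1 p.2) - -laxFlux μ k) * dx η p
              else 0)
            - (exactSol μ m Φ p.1 p.2 * dt η p
              + laxFlux μ (exactSol μ m Φ p.1 p.2) * dx η p)) := by
        intro p
        rw [exactSol]
        simp only [charSol_max h0 h1 hm hmono]
        split_ifs
        · rcases lt_trichotomy k (charSol μ m p.1 p.2) with h | h | h
          · rw [max_eq_left h.le, abs_of_pos (by linarith), Real.sign_of_pos (by linarith)]; ring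
          · rw [← h]; simp
          · rw [max_eq_right h.le, abs_of_neg (by linarith), Real.sign_of_neg (by linarith)]; ring
        · rcases hk.lt_or_eq with h | h
          · rw [zero_sub, abs_neg, abs_of_pos h, Real.sign_of_neg (by linarith), laxFlux_zero]; ring
          · rw [← h, laxFlux_zero]; simp
      have e2 : ∀ x, |u₀ x - k| * η (0, x) = k * η (0, x)
          + (2 * (if charPot μ m Φ 0 x < 0 then
              (charSol μ (fun x => max (m x) k) 0 x - k) * η (0, x) else 0)
            - u₀ x * η (0, x)) := by
        intro x
        rw [hinit]
        simp only [charSol_max h0 h1 hm hmono]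
        split_ifs
        · rcases le_total k (charSol μ m 0 x) with h | h
          · rw [max_eq_left h, abs_of_nonneg (by linarith)]; ring
          · rw [max_eq_right h, abs_of_nonpos (by linarith)]; ring
        · rw [zero_sub, abs_neg, abs_of_nonneg hk]; ring
      have iR' : Integrable fun p : ℝ × ℝ => if charPot μ m Φ p.1 p.2 < 0 then
          (charSol μ (fun x => max (m x) k) p.1 p.2 - k) * dt η p
          - (-laxFlux μ (charSol μ (fun x => max (m x) k) p.1 p.2) - -laxFlux μ k) * dx η p
          else 0 := iR
      have iR0' : Integrable fun x => if charPot μ m Φ 0 x < 0 then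
          (charSol μ (fun x => max (m x) k) 0 x - k) * η (0, x) else 0 := by
        simp only [hneg]; exact iR0
      simp only [e1, e2]
      rw [integral_add_two_mul_sub iK.integrableOn iR'.integrableOn (hint η hη).integrableOn,
        integral_add_two_mul_sub iK0 iR0' (hint0 η hη)]
      rw [IsPotential.cutForm] at hpos'
      linarith [hweak η hη]

end Exact


/-! ### Step functions on the integer grid -/

theorem sum_le_totVar_step (w : ℤ → ℝ) (S : Finset ℤ) :
    ENNReal.ofReal (∑ j ∈ S, |w j - w (j - 1)|) ≤ totVar fun x : ℝ => w ⌊x⌋ := by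
  obtain ⟨L, hL⟩ : ∃ L : ℕ, ∀ j ∈ S, |j| ≤ L := by
    refine ⟨∑ j ∈ S, j.natAbs, fun j hj => ?_⟩
    rw [Int.abs_eq_natAbs]
    exact_mod_cast Finset.single_le_sum (f := fun j : ℤ => j.natAbs) (fun _ _ => Nat.zero_le _) hj
  have hmono : Monotone fun i : ℕ => -(L : ℝ) - 1 + i := fun i j hij => by
    simpa using hij
  have h1 := eVariationOn.sum_le (f := fun x : ℝ => w ⌊x⌋) (s := univ) (n := 2 * L + 1)
    (u := fun i : ℕ => -(L : ℝ) - 1 + i) hmono (fun _ => mem_univ _)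
  have hfl : ∀ i : ℕ, ⌊-(L : ℝ) - 1 + i⌋ = -(L : ℤ) - 1 + i := fun i => by
    rw [Int.floor_eq_iff]; push_cast; constructor <;> linarith
  have h2 : ∀ i : ℕ, edist (w ⌊-(L : ℝ) - 1 + (i + 1 : ℕ)⌋) (w ⌊-(L : ℝ) - 1 + i⌋)
      = ENNReal.ofReal |w (i - L) - w (i - L - 1)| := by
    intro i
    rw [hfl, hfl, edist_dist, Real.dist_eq]
    congr 3 <;> congr 1 <;> push_cast <;> ring
  refine le_trans ?_ h1
  simp only [h2]
  rw [← ENNReal.ofReal_sum_of_nonneg fun _ _ => abs_nonneg _]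
  apply ENNReal.ofReal_le_ofReal
  have h3 : ∑ i ∈ Finset.range (2 * L + 1), |w (i - L) - w (i - L - 1)|
      = ∑ j ∈ (Finset.range (2 * L + 1)).image (fun i : ℕ => (i : ℤ) - L), |w j - w (j - 1)| := by
    rw [Finset.sum_image]
    intro i _ j _ hij
    simpa using hij
  rw [h3]
  apply Finset.sum_le_sum_of_subset_of_nonneg
  · intro j hj
    have := abs_le.1 (hL j hj)
    rw [Finset.mem_image]
    exact ⟨(j + L).toNat, Finset.mem_range.2 (by omega), by omega⟩
  · intro _ _ _; exact abs_nonneg _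

theorem totVar_step_ne_top {w : ℤ → ℝ} {a b : ℤ} (hw : ∀ j, j < a ∨ b < j → w j = 0) :
    totVar (fun x : ℝ => w ⌊x⌋) ≠ ⊤ := by
  set F := Finset.Icc a (b + 1) with hF
  set D : ℤ → ℝ := fun i => |w i - w (i - 1)| with hD
  -- Jordan decomposition: T accumulates the jumps, and both T and T - w are nondecreasing.
  set T : ℤ → ℝ := fun j => ∑ i ∈ F, if i ≤ j then D i else 0 with hT
  have hstep : ∀ j, T (j + 1) = T j + D (j + 1) := by
    intro j
    have e1 : T (j + 1) = T j + ∑ i ∈ F, if i = j + 1 then D i else 0 := by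
      rw [hT, ← Finset.sum_add_distrib]
      apply Finset.sum_congr rfl
      intro i _
      split_ifs <;> first | omega | simp
    rw [e1, Finset.sum_ite_eq' F (j + 1) D]
    split_ifs with h
    · rfl
    · rw [hF, Finset.mem_Icc, not_and_or, not_le, not_le] at h
      have z1 : w (j + 1) = 0 := hw _ (by omega)
      have z2 : w j = 0 := hw _ (by omega)
      simp [hD, z1, z2]
  have hT0 : ∀ j, 0 ≤ T j := fun j => Finset.sum_nonneg fun i _ => by
    split_ifs
    · exact abs_nonneg _
    · exact le_rfl
  have hT1 : ∀ j, T j ≤ ∑ i ∈ F, D i := fun j => Finset.sum_le_sum fun i _ => by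
    split_ifs
    · exact le_rfl
    · exact abs_nonneg _
  have hwb : ∀ j, |w j| ≤ ∑ i ∈ F, |w i| := by
    intro j
    by_cases h : j ∈ F
    · exact Finset.single_le_sum (f := fun i => |w i|) (fun i _ => abs_nonneg _) h
    · rw [hF, Finset.mem_Icc, not_and_or, not_le, not_le] at h
      rw [hw j (by omega), abs_zero]
      exact Finset.sum_nonneg fun i _ => abs_nonneg _
  have hTm : Monotone T := monotone_int_of_le_succ fun j => by
    rw [hstep]; exact le_add_of_nonneg_right (abs_nonneg _)
  have hTw : Monotone fun j => T j - w j := monotone_int_of_le_succ fun j => by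
    have : w (j + 1) - w j ≤ D (j + 1) := by
      simp only [hD, add_sub_cancel_right]; exact le_abs_self _
    simp only [hstep]
    linarith
  have e : (fun x : ℝ => w ⌊x⌋) = fun x : ℝ => T ⌊x⌋ - (T ⌊x⌋ - w ⌊x⌋) := by funext x; ring
  rw [e]
  refine ne_top_of_le_ne_top ENNReal.ofReal_ne_top (totVar_sub_le (a := ∑ i ∈ F, D i)
    (b := (∑ i ∈ F, D i) + 2 * ∑ i ∈ F, |w i|) (hTm.comp Int.floor_mono)
    (hTw.comp Int.floor_mono) (fun x y => ?_) fun x y => ?_)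
  · simp only [Function.comp_apply]
    linarith [hT0 ⌊x⌋, hT1 ⌊y⌋]
  · simp only [Function.comp_apply]
    have b1 := abs_le.1 (hwb ⌊x⌋)
    have b2 := abs_le.1 (hwb ⌊y⌋)
    linarith [hT0 ⌊x⌋, hT1 ⌊y⌋, b1.1, b1.2, b2.1, b2.2]

theorem integral_step {c : ℤ → ℝ} {F : Finset ℤ} (hc : ∀ j ∉ F, c j = 0) :
    Integrable (fun x : ℝ => c ⌊x⌋) ∧ ∫ x : ℝ, c ⌊x⌋ = ∑ j ∈ F, c j := by
  have e : (fun x : ℝ => c ⌊x⌋)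
      = fun x => ∑ j ∈ F, (Ico (j : ℝ) (j + 1)).indicator (fun _ => c j) x := by
    funext x
    have e1 : ∀ j : ℤ, (Ico (j : ℝ) (j + 1)).indicator (fun _ => c j) x
        = if j = ⌊x⌋ then c j else 0 := by
      intro j
      rw [indicator]
      congr 1
      rw [mem_Ico, eq_comm (a := j), Int.floor_eq_iff]
    simp only [e1]
    rw [Finset.sum_ite_eq' F ⌊x⌋ c]
    split_ifs with h
    · rfl
    · exact hc _ h
  have hi : ∀ j ∈ F, Integrable ((Ico (j : ℝ) (j + 1)).indicator fun _ => c j) := fun j _ =>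
    (integrable_indicator_iff measurableSet_Ico).2
      (integrableOn_const (by simp [Real.volume_Ico]))
  rw [e]
  refine ⟨integrable_finsetSum F hi, ?_⟩
  rw [integral_finsetSum F hi]
  apply Finset.sum_congr rfl
  intro j _
  rw [integral_indicator measurableSet_Ico, setIntegral_const, measureReal_def, Real.volume_Ico]
  simp

/-! ### The Godunov scheme: translations and propagation -/

theorem godunovGridU_shift (f : ℝ → ℝ) {u₀ u₀' : ℝ → ℝ} (h : ∀ x, u₀' x = u₀ (x - 1)) (n : ℕ)
    (j : ℤ) : godunovGridU f u₀' n j = godunovGridU f u₀ n (j - 1) := by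
  induction n generalizing j with
  | zero =>
    simp only [godunovGridU, h]
    rw [intervalIntegral.integral_comp_sub_right]
    push_cast
    congr 1
    ring
  | succ n ih => simp only [godunovGridU, ih]

theorem godunovGridV_shift (f : ℝ → ℝ) (lam : ℝ) (g : ℝ → ℝ) {u₀ u₀' : ℝ → ℝ}
    (h : ∀ x, u₀' x = u₀ (x - 1)) (n : ℕ) (j : ℤ) :
    godunovGridV f lam g u₀' (fun _ => 0) n j = godunovGridV f lam g u₀ (fun _ => 0) n (j - 1) := by
  induction n generalizing j with
  | zero => simp [godunovGridV]
  | succ n ih => simp only [godunovGridV, ih, godunovGridU_shift f h]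

theorem godunovU_shift (f : ℝ → ℝ) {u₀ u₀' : ℝ → ℝ} (h : ∀ x, u₀' x = u₀ (x - 1)) (t x : ℝ) :
    godunovU f u₀' t x = godunovU f u₀ t (x - 1) := by
  rw [godunovU, godunovU, godunovGridU_shift f h, Int.floor_sub_one]

theorem godunovV_shift (f : ℝ → ℝ) (lam : ℝ) (g : ℝ → ℝ) {u₀ u₀' : ℝ → ℝ}
    (h : ∀ x, u₀' x = u₀ (x - 1)) (t x : ℝ) :
    godunovV f lam g u₀' (fun _ => 0) t x = godunovV f lam g u₀ (fun _ => 0) t (x - 1) := by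
  rw [godunovV, godunovV, godunovGridV_shift f lam g h, Int.floor_sub_one]

section Propagation

variable {μ a b : ℝ} {u₀ g : ℝ → ℝ}

/-- Both f and x - f(x) are nondecreasing, so the scheme is monotone. It looks only to the left,
hence the cells j < 0 never see the shock. -/
theorem godunovGridU_mem (h0 : 0 < μ) (h1 : μ < 1)
    (hu : ∀ j : ℤ, j < 0 → a ≤ godunovGridU (laxFlux μ) u₀ 0 j ∧ godunovGridU (laxFlux μ) u₀ 0 j ≤ b)
    (n : ℕ) (j : ℤ) (hj : j < 0) :
    a ≤ godunovGridU (laxFlux μ) u₀ n j ∧ godunovGridU (laxFlux μ) u₀ n j ≤ b := by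
  have hm : ∀ x y : ℝ, x ≤ y → x - laxFlux μ x ≤ y - laxFlux μ y := fun x y hxy => by
    have := (le_abs_self _).trans (abs_laxFlux_sub_le h0 h1 y x)
    rw [abs_of_nonneg (by linarith)] at this
    linarith
  have hf := (strictMono_laxFlux h0 h1).monotone
  induction n generalizing j with
  | zero => exact hu j hj
  | succ n ih =>
    obtain ⟨i1, i2⟩ := ih j hj
    obtain ⟨i3, i4⟩ := ih (j - 1) (by omega)
    rw [godunovGridU]
    have k1 := hm _ _ i1
    have k2 := hm _ _ i2
    have k3 := hf i3
    have k4 := hf i4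
    constructor <;> linarith

theorem godunovGridU_eq_zero (hu : ∀ j : ℤ, 0 ≤ j → godunovGridU (laxFlux μ) u₀ 0 j = 0)
    (n : ℕ) (j : ℤ) (hj : n ≤ j) : godunovGridU (laxFlux μ) u₀ n j = 0 := by
  induction n generalizing j with
  | zero => exact hu j (by simpa using hj)
  | succ n ih =>
    push_cast at hj
    rw [godunovGridU, ih j (by omega), ih (j - 1) (by omega)]; simp

/-- The source vanishes behind the initial shock position and ahead of the fastest numerical signal,
so v is supported in 0 ≤ j ≤ n. -/
theorem godunovGridV_eq_zero (h0 : 0 < μ) (h1 : μ < 1)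
    (hu : ∀ j : ℤ, j < 0 → a ≤ godunovGridU (laxFlux μ) u₀ 0 j ∧ godunovGridU (laxFlux μ) u₀ 0 j ≤ b)
    (hu0 : ∀ j : ℤ, 0 ≤ j → godunovGridU (laxFlux μ) u₀ 0 j = 0) (hg0 : g 0 = 0)
    (hg : ∀ u, a ≤ u → u ≤ b → g u = 0) (lam : ℝ) (n : ℕ) (j : ℤ) (hj : j < 0 ∨ (n : ℤ) < j) :
    godunovGridV (laxFlux μ) lam g u₀ (fun _ => 0) n j = 0 := by
  have hG : ∀ (n : ℕ) (j : ℤ), j < 0 ∨ (n : ℤ) ≤ j → g (godunovGridU (laxFlux μ) u₀ n j) = 0 := by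
    intro n j hj
    rcases hj with hj | hj
    · have := godunovGridU_mem h0 h1 hu n j hj
      exact hg _ this.1 this.2
    · rw [godunovGridU_eq_zero hu0 n j hj, hg0]
  induction n generalizing j with
  | zero => simp [godunovGridV]
  | succ n ih =>
    push_cast at hj
    rw [godunovGridV, ih j (by omega), ih (j - 1) (by omega), hG n j (by omega),
      hG n (j - 1) (by omega)]
    simp

end Propagation


/-! ### Estimates for perturbed shock data -/

section ShockData

variable {μ a uL X0 : ℝ} {φ Φ g : ℝ → ℝ} (hφ : Continuous φ) (hmono : Monotone φ)
  (hΦ : ∀ x, HasDerivAt Φ (uL + φ x) x) (hΦ0 : Φ 0 = 0) (ha : 0 < a) (hma : ∀ x, a ≤ uL + φ x)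
  (hmL : ∀ x, uL + φ x ≤ uL) (hX0 : ∀ x ≤ X0, φ x = φ X0)

include hφ hΦ hΦ0 in
theorem godunovGridU_shockData (f : ℝ → ℝ) (j : ℤ) :
    godunovGridU f (shockData uL 0 φ) 0 j = if j < 0 then Φ (j + 1) - Φ j else 0 := by
  have hz : ∀ i : ℤ, 0 ≤ i → potentialGrid Φ i = 0 := by
    intro i hi
    rcases hi.lt_or_eq with h | h
    · rw [potentialGrid, if_neg (by omega)]
    · rw [← h, potentialGrid, if_pos le_rfl]; simp [hΦ0]
  rw [godunovGridU, integral_shockData hΦ hΦ0 (continuous_const.add hφ) (fun _ => rfl), logRatio]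
  split_ifs with hj
  · rw [potentialGrid, potentialGrid, if_pos hj.le, if_pos (by omega), add_sub_cancel,
      add_sub_cancel, Real.log_exp, Real.log_exp]
    push_cast; ring
  · rw [hz j (by omega), hz (j + 1) (by omega)]; simp

include hφ hΦ hΦ0 hma hmL in
theorem godunovGridU_shockData_mem (f : ℝ → ℝ) (j : ℤ) (hj : j < 0) :
    a ≤ godunovGridU f (shockData uL 0 φ) 0 j ∧ godunovGridU f (shockData uL 0 φ) 0 j ≤ uL := by
  rw [godunovGridU_shockData hφ hΦ hΦ0, if_pos hj]
  have := potential_sub_bounds hΦ hma hmL (by linarith : (j : ℝ) ≤ j + 1)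
  rw [add_sub_cancel_left, mul_one, mul_one] at this
  exact this

include hφ hΦ hΦ0 in
theorem godunovGridU_shockData_nonneg (f : ℝ → ℝ) (j : ℤ) (hj : 0 ≤ j) :
    godunovGridU f (shockData uL 0 φ) 0 j = 0 := by
  rw [godunovGridU_shockData hφ hΦ hΦ0, if_neg (by omega)]

include hX0 in
theorem exists_godunovGridU_shockData_const (f : ℝ → ℝ) :
    ∃ L : ℤ, L < 0 ∧ ∀ j < L, godunovGridU f (shockData uL 0 φ) 0 j = uL + φ X0 := by
  refine ⟨min (⌊X0⌋ - 1) (-2), by omega, fun j hj => ?_⟩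
  rw [lt_min_iff] at hj
  have h1 : (j : ℝ) + 1 ≤ X0 := by
    have : j + 1 ≤ ⌊X0⌋ := by omega
    have := Int.le_floor.1 this
    exact_mod_cast this
  have h2 : (j : ℝ) + 1 < 0 := by
    have : j + 1 < 0 := by omega
    exact_mod_cast this
  have e : ∫ x in (j : ℝ)..(j + 1 : ℝ), shockData uL 0 φ x
      = ∫ _ in (j : ℝ)..(j + 1 : ℝ), (uL + φ X0) := by
    apply intervalIntegral.integral_congr
    intro x hx
    rw [uIcc_of_le (by linarith)] at hx
    simp only [shockData]
    rw [if_pos (by linarith [hx.2]), hX0 x (by linarith [hx.2])]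
  rw [godunovGridU, e]
  simp

include hφ hmono hΦ hΦ0 hma hmL ha in
theorem totVar_godunovU_shockData_le (f : ℝ → ℝ) :
    totVar (fun x : ℝ => godunovGridU f (shockData uL 0 φ) 0 ⌊x⌋) ≤ ENNReal.ofReal (uL + uL) := by
  set w := godunovGridU f (shockData uL 0 φ) 0 with hw
  have hmem : ∀ j : ℤ, j < 0 → a ≤ w j ∧ w j ≤ uL :=
    godunovGridU_shockData_mem hφ hΦ hΦ0 hma hmL f
  have hzero := godunovGridU_shockData_nonneg hφ hΦ hΦ0 f
  have hL : 0 ≤ uL := by linarith [hma 0, hmL 0]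
  have hstep : ∀ j : ℤ, j + 1 < 0 → w j ≤ w (j + 1) := by
    intro j hj
    rw [hw, godunovGridU_shockData hφ hΦ hΦ0, godunovGridU_shockData hφ hΦ hΦ0,
      if_pos (by omega), if_pos hj]
    have hm : Monotone fun x => uL + φ x := fun x y hxy => by simpa using hmono hxy
    have t1 := potential_tangent_le hm hΦ ((j : ℝ) + 1) j
    have t2 := potential_tangent_le hm hΦ ((j : ℝ) + 1) ((j : ℝ) + 1 + 1)
    push_cast
    linarith
  have e : (fun x : ℝ => w ⌊x⌋) = fun x : ℝ => (fun j : ℤ => if j < 0 then w j else uL) ⌊x⌋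
      - (fun j : ℤ => if j < 0 then 0 else uL) ⌊x⌋ := by
    funext x
    simp only
    split_ifs with h
    · simp
    · rw [hw, hzero ⌊x⌋ (by omega), sub_self]
  rw [e]
  apply totVar_sub_le
  · refine Monotone.comp (g := fun j : ℤ => if j < 0 then w j else uL)
      (monotone_int_of_le_succ fun j => ?_) Int.floor_mono
    split_ifs with h h'
    · exact hstep j h'
    · exact (hmem j h).2
    · omega
    · exact le_rfl
  · refine Monotone.comp (g := fun j : ℤ => if j < 0 then 0 else uL)
      (monotone_int_of_le_succ fun j => ?_) Int.floor_mono
    split_ifs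
    · exact le_rfl
    · exact hL
    · omega
    · exact le_rfl
  · intro x y
    simp only
    have p1 : ∀ j : ℤ, j < 0 → 0 ≤ w j := fun j hj => ha.le.trans (hmem j hj).1
    split_ifs with h h' h'
    · linarith [p1 _ h', (hmem _ h).2]
    · linarith [(hmem _ h).2]
    · linarith [p1 _ h']
    · linarith
  · intro x y
    simp only
    split_ifs <;> linarith

include hφ hmono hΦ hΦ0 hma hmL ha hX0 in
-- Cells have unit length, so the L¹ distance to the shifted function is the sum of the jumps. It is
-- bounded by the total variation, and positive because of the shock at cell 0.
theorem godunovU_shift_sub (f : ℝ → ℝ) :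
    Integrable (fun x : ℝ => godunovU f (shockData uL 0 φ) 0 x
      - godunovU f (shockData uL 0 φ) 0 (x - 1)) ∧
    0 < ∫ x : ℝ, |godunovU f (shockData uL 0 φ) 0 x - godunovU f (shockData uL 0 φ) 0 (x - 1)| ∧
    ∫ x : ℝ, |godunovU f (shockData uL 0 φ) 0 x - godunovU f (shockData uL 0 φ) 0 (x - 1)|
      ≤ uL + uL := by
  simp only [godunovU, Nat.floor_zero, Int.floor_sub_one]
  set w := godunovGridU f (shockData uL 0 φ) 0 with hw
  have hmem := godunovGridU_shockData_mem hφ hΦ hΦ0 hma hmL f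
  have hzero := godunovGridU_shockData_nonneg hφ hΦ hΦ0 f
  have hL : 0 ≤ uL := by linarith [hma 0, hmL 0]
  obtain ⟨L, hL0, hconst⟩ := exists_godunovGridU_shockData_const (uL := uL) hX0 f
  have hF : ∀ j ∉ Finset.Icc L 0, w j - w (j - 1) = 0 := by
    intro j hj
    rw [Finset.mem_Icc, not_and_or, not_le, not_le] at hj
    rcases hj with hj | hj
    · rw [hw, hconst j hj, hconst (j - 1) (by omega), sub_self]
    · rw [hw, hzero j (by omega), hzero (j - 1) (by omega), sub_self]
  have hF' : ∀ j ∉ Finset.Icc L 0, |w j - w (j - 1)| = 0 := fun j hj => by rw [hF j hj, abs_zero]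
  have i1 := (integral_step (c := fun j => w j - w (j - 1)) hF).1
  have i2 := (integral_step (c := fun j => |w j - w (j - 1)|) hF').2
  refine ⟨i1, ?_⟩
  rw [i2]
  constructor
  · have h1 : |w 0 - w (0 - 1)| ≤ ∑ j ∈ Finset.Icc L 0, |w j - w (j - 1)| :=
      Finset.single_le_sum (f := fun j => |w j - w (j - 1)|) (fun _ _ => abs_nonneg _)
        (Finset.mem_Icc.2 ⟨hL0.le, le_rfl⟩)
    refine lt_of_lt_of_le ?_ h1
    have h2 := (hmem (0 - 1) (by norm_num)).1
    have h3 : w 0 = 0 := hzero 0 le_rfl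
    rw [abs_pos, h3]
    rw [← hw] at h2
    intro h4
    linarith
  · have h1 := (sum_le_totVar_step w (Finset.Icc L 0)).trans
      (totVar_godunovU_shockData_le hφ hmono hΦ hΦ0 ha hma hmL f)
    exact (ENNReal.ofReal_le_ofReal_iff (by linarith)).1 h1

include hφ hΦ hΦ0 hma hmL in
theorem godunovV_shockData (h0 : 0 < μ) (h1 : μ < 1) (hg0 : g 0 = 0)
    (hg : ∀ u, a ≤ u → u ≤ uL → g u = 0) (lam : ℝ) (N : ℕ) :
    totVar (godunovV (laxFlux μ) lam g (shockData uL 0 φ) (fun _ => 0) N) ≠ ⊤ ∧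
    Integrable (fun x : ℝ => godunovV (laxFlux μ) lam g (shockData uL 0 φ) (fun _ => 0) N x
      - godunovV (laxFlux μ) lam g (shockData uL 0 φ) (fun _ => 0) N (x - 1)) ∧
    ∀ S : Finset ℤ, ENNReal.ofReal (∑ j ∈ S,
        |godunovGridV (laxFlux μ) lam g (shockData uL 0 φ) (fun _ => 0) N j
          - godunovGridV (laxFlux μ) lam g (shockData uL 0 φ) (fun _ => 0) N (j - 1)|)
        ≤ totVar (godunovV (laxFlux μ) lam g (shockData uL 0 φ) (fun _ => 0) N) ∧
      ∑ j ∈ S, |godunovGridV (laxFlux μ) lam g (shockData uL 0 φ) (fun _ => 0) N j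
          - godunovGridV (laxFlux μ) lam g (shockData uL 0 φ) (fun _ => 0) N (j - 1)|
        ≤ ∫ x : ℝ, |godunovV (laxFlux μ) lam g (shockData uL 0 φ) (fun _ => 0) N x
          - godunovV (laxFlux μ) lam g (shockData uL 0 φ) (fun _ => 0) N (x - 1)| := by
  have hz := godunovGridV_eq_zero h0 h1
    (godunovGridU_shockData_mem hφ hΦ hΦ0 hma hmL (laxFlux μ))
    (godunovGridU_shockData_nonneg hφ hΦ hΦ0 (laxFlux μ)) hg0 hg lam N
  have e : godunovV (laxFlux μ) lam g (shockData uL 0 φ) (fun _ => 0) N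
      = fun x : ℝ => godunovGridV (laxFlux μ) lam g (shockData uL 0 φ) (fun _ => 0) N ⌊x⌋ := by
    funext x
    rw [godunovV, Nat.floor_natCast]
  rw [e]
  simp only [Int.floor_sub_one]
  set w := godunovGridV (laxFlux μ) lam g (shockData uL 0 φ) (fun _ => 0) N with hw
  have hF : ∀ j ∉ Finset.Icc 0 ((N : ℤ) + 1), w j - w (j - 1) = 0 := by
    intro j hj
    rw [Finset.mem_Icc, not_and_or, not_le, not_le] at hj
    rw [hz j (by omega), hz (j - 1) (by omega), sub_self]
  have hFS : ∀ S : Finset ℤ, ∀ j ∉ Finset.Icc 0 ((N : ℤ) + 1) ∪ S, |w j - w (j - 1)| = 0 := by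
    intro S j hj
    rw [Finset.mem_union, not_or] at hj
    rw [hF j hj.1, abs_zero]
  refine ⟨totVar_step_ne_top hz, (integral_step (c := fun j => w j - w (j - 1)) hF).1,
    fun S => ⟨sum_le_totVar_step w S, ?_⟩⟩
  rw [(integral_step (c := fun j => |w j - w (j - 1)|) (hFS S)).2]
  exact Finset.sum_le_sum_of_subset_of_nonneg Finset.subset_union_right fun _ _ _ => abs_nonneg _

end ShockData

/-! ### Conclusion -/

theorem ckNorm_le {φ : ℝ → ℝ} {C : ℕ → ℝ} {δ : ℝ} (hC : ∀ i x, |iteratedDeriv i φ x| ≤ δ * C i)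
    (k : ℕ) : ckNorm k φ ≤ ∑ i ∈ Finset.range (k + 1), ENNReal.ofReal (δ * C i) := by
  apply Finset.sum_le_sum
  intro i _
  refine iSup_le fun x => ?_
  rw [Real.enorm_eq_ofReal_abs]
  exact ENNReal.ofReal_le_ofReal (hC i x)

end

theorem mainTheorem2 (μ : ℝ) (hμ : 1 / 2 < μ) (hμ' : μ < 1)
    (lam0 : ℚ) (hlam0 : μ < (lam0 : ℝ)) (hlam0' : (lam0 : ℝ) < 1) :
    -- the unperturbed shock, with left state `uL`, right state `0` and speed `lam0`
    ∃ uL : ℝ, 0 < uL ∧ laxFlux μ uL - laxFlux μ 0 = (lam0 : ℝ) * (uL - 0) ∧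
    -- the flux of the second equation
    ∃ g : ℝ → ℝ, ContDiff ℝ ∞ g ∧ HasCompactSupport g ∧
    -- the perturbations, the times, and the initial data
    ∃ (φ : ℕ → ℝ → ℝ) (T : ℕ → ℝ) (u₀ u₀' : ℕ → ℝ → ℝ),
      (∀ ν, u₀ ν = shockData uL 0 (φ ν)) ∧
      (∀ ν x, u₀' ν x = u₀ ν (x - 1)) ∧
      (∀ ν, ContDiff ℝ ∞ (φ ν)) ∧
      (∀ ν x, 0 < uL + φ ν x) ∧
      Tendsto (fun ν => totVar (φ ν)) atTop (𝓝 0) ∧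
      (∀ k : ℕ, Tendsto (fun ν => ckNorm k (φ ν)) atTop (𝓝 0)) ∧
      Tendsto T atTop atTop ∧
      -- the exact solutions have uniformly bounded total variation
      (∃ C : ℝ≥0, ∀ ν, ∃ U V : ℝ → ℝ → ℝ,
        IsEntropySolution (laxFlux μ) (1 / 2) g (u₀ ν) (fun _ => 0) U V ∧
        ∀ t, 0 ≤ t → totVar (U t) ≤ C ∧ totVar (V t) ≤ C) ∧
      -- the total variation of the Godunov approximations is finite but blows up
      (∀ ν, totVar (godunovV (laxFlux μ) (1 / 2) g (u₀ ν) (fun _ => 0) (T ν)) ≠ ⊤) ∧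
      Tendsto (fun ν => totVar (godunovV (laxFlux μ) (1 / 2) g (u₀ ν) (fun _ => 0) (T ν)))
        atTop (𝓝 ⊤) ∧
      -- the Godunov approximations of the data `u₀'` are shifted by one grid cell
      (∀ ν t x, godunovU (laxFlux μ) (u₀' ν) t x = godunovU (laxFlux μ) (u₀ ν) t (x - 1)) ∧
      (∀ ν t x, godunovV (laxFlux μ) (1 / 2) g (u₀' ν) (fun _ => 0) t x
        = godunovV (laxFlux μ) (1 / 2) g (u₀ ν) (fun _ => 0) t (x - 1)) ∧
      -- the two families are not comparable in `L¹`
      (∀ ν, Integrable (fun x => godunovU (laxFlux μ) (u₀ ν) 0 x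
        - godunovU (laxFlux μ) (u₀' ν) 0 x)) ∧
      (∀ ν, Integrable (fun x => godunovV (laxFlux μ) (1 / 2) g (u₀ ν) (fun _ => 0) (T ν) x
        - godunovV (laxFlux μ) (1 / 2) g (u₀' ν) (fun _ => 0) (T ν) x)) ∧
      Tendsto (fun ν =>
        (∫ x, |godunovV (laxFlux μ) (1 / 2) g (u₀ ν) (fun _ => 0) (T ν) x
          - godunovV (laxFlux μ) (1 / 2) g (u₀' ν) (fun _ => 0) (T ν) x|) /
        (∫ x, |godunovU (laxFlux μ) (u₀ ν) 0 x - godunovU (laxFlux μ) (u₀' ν) 0 x|))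
        atTop atTop := by
  have h0 : 0 < μ := by linarith
  obtain ⟨uL, huL, hf, hsp⟩ := exists_shock_state h0 hμ' hlam0 hlam0'
  have hden : 0 < lam0.den := lam0.den_pos
  obtain ⟨g, g1, g2, Lg, Cg, hgd, hgc, hg⟩ := exists_resonantFlux huL hden
  obtain ⟨c0, hc0, C, hdata⟩ := exists_oscillating_data hμ hμ' hg hf hsp hden
    (Rat.cast_def lam0) hlam0 hlam0'
  have hg2 : 0 < g2 := hg.pos.trans hg.lt
  have hgap := hg.lt_state
  obtain ⟨a, ha⟩ : ∃ a, a = (g2 + uL) / 2 := ⟨_, rfl⟩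
  have hap : 0 < a := by linarith
  have hg0 : g 0 = 0 := by
    by_contra hn
    exact absurd (hg.support 0 hn).1 (not_lt.2 hg.pos.le)
  have hga : ∀ u, a ≤ u → u ≤ uL → g u = 0 := fun u hu _ => by
    by_contra hn
    linarith [(hg.support u hn).2]
  -- The second bound keeps the perturbed left states above a, where g vanishes.
  set δ : ℕ → ℝ := fun ν => min (1 / ((ν : ℝ) + 1)) ((uL - g2) / 2) with hδ
  have hδp : ∀ ν, 0 < δ ν := fun ν => lt_min (by positivity) (by linarith)
  have hδ1 : ∀ ν, δ ν ≤ 1 / ((ν : ℝ) + 1) := fun ν => min_le_left _ _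
  have hδ2 : ∀ ν, δ ν ≤ (uL - g2) / 2 := fun ν => min_le_right _ _
  have hδ0 : Tendsto δ atTop (𝓝 0) :=
    squeeze_zero (fun ν => (hδp ν).le) hδ1 tendsto_one_div_add_atTop_nhds_zero_nat
  -- The ν-th data use K = ν blocks, so the variation is at least ν c0.
  choose φ Φ N S hφ hmono hφδ hφC hN hX hΦ0 hΦ hS using fun ν : ℕ => hdata ν (δ ν) (hδp ν)
  choose X0 hX0 using hX
  have hma : ∀ ν x, a ≤ uL + φ ν x := fun ν x => by linarith [(hφδ ν x).1, hδ2 ν]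
  have hmL : ∀ ν x, uL + φ ν x ≤ uL := fun ν x => by linarith [(hφδ ν x).2]
  have hNν : ∀ ν : ℕ, (ν : ℝ) ≤ N ν := fun ν => by
    have h1 : (ν : ℝ) + 1 ≤ 1 / δ ν := by
      rw [le_one_div (by positivity) (hδp ν)]; exact hδ1 ν
    linarith [hN ν]
  have hV := fun ν => godunovV_shockData (hφ ν).continuous (hΦ ν) (hΦ0 ν) (hma ν) (hmL ν) h0 hμ'
    hg0 hga (1 / 2) (N ν)
  have hU := fun ν => godunovU_shift_sub (hφ ν).continuous (hmono ν) (hΦ ν) (hΦ0 ν) hap (hma ν)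
    (hmL ν) (hX0 ν) (laxFlux μ)
  have hgrow : Tendsto (fun ν : ℕ => (ν : ℝ) * c0) atTop atTop :=
    tendsto_natCast_atTop_atTop.atTop_mul_const hc0
  refine ⟨uL, huL, by rw [laxFlux_zero, hf]; ring, g, hgd, hgc, φ, fun ν => N ν,
    fun ν => shockData uL 0 (φ ν), fun ν x => shockData uL 0 (φ ν) (x - 1), fun _ => rfl,
    fun _ _ => rfl, hφ, fun ν x => hap.trans_le (hma ν x), ?_, fun k => ?_,
    tendsto_atTop_mono hNν tendsto_natCast_atTop_atTop, ⟨(uL + uL).toNNReal, fun ν => ?_⟩,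
    fun ν => (hV ν).1, ?_, fun ν t x => godunovU_shift _ (fun _ => rfl) t x,
    fun ν t x => godunovV_shift _ _ _ (fun _ => rfl) t x, fun ν => ?_, fun ν => ?_, ?_⟩
  · have hle : ∀ ν, totVar (φ ν) ≤ ENNReal.ofReal (δ ν) := fun ν => by
      have := totVar_sub_le (hmono ν) (monotone_const (c := (0 : ℝ))) (a := δ ν) (b := 0)
        (fun x y => by linarith [(hφδ ν x).1, (hφδ ν y).2]) (fun x y => by simp)
      simpa using this
    refine tendsto_of_tendsto_of_tendsto_of_le_of_le tendsto_const_nhds ?_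
      (fun _ => zero_le) hle
    simpa using ENNReal.tendsto_ofReal hδ0
  · refine tendsto_of_tendsto_of_tendsto_of_le_of_le tendsto_const_nhds ?_
      (fun _ => zero_le) fun ν => ckNorm_le (hφC ν) k
    have : Tendsto (fun ν => ∑ i ∈ Finset.range (k + 1), ENNReal.ofReal (δ ν * C i)) atTop
        (𝓝 (∑ i ∈ Finset.range (k + 1), ENNReal.ofReal (0 * C i))) :=
      tendsto_finsetSum _ fun i _ => ENNReal.tendsto_ofReal (hδ0.mul_const (C i))
    simpa using this
  · have hm : Continuous fun x => uL + φ ν x := continuous_const.add (hφ ν).continuous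
    have hmm : Monotone fun x => uL + φ ν x := fun x y hxy => by simpa using hmono ν hxy
    refine ⟨exactSol μ (fun x => uL + φ ν x) (Φ ν), fun _ _ => 0,
      isEntropySolution_exactSol h0 hμ' hm hmm (hΦ ν) (hΦ0 ν) hap (hma ν) (hmL ν) hg0 hga
        (fun _ => rfl) (1 / 2), fun t _ => ⟨?_, ?_⟩⟩
    · exact totVar_exactSol_le h0 hμ' hm hmm (hΦ ν) hap (hma ν) (hmL ν) t
    · have := totVar_sub_le (monotone_const (c := (0 : ℝ))) (monotone_const (c := (0 : ℝ)))
        (a := 0) (b := 0) (fun x y => by simp) (fun x y => by simp)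
      simp only [sub_self, add_zero, ENNReal.ofReal_zero] at this
      exact this.trans zero_le
  · refine tendsto_nhds_top_mono (ENNReal.tendsto_ofReal_atTop.comp hgrow)
      (Eventually.of_forall fun ν => ?_)
    exact (ENNReal.ofReal_le_ofReal (hS ν)).trans ((hV ν).2.2 (S ν)).1
  · simp only [godunovU_shift (laxFlux μ) (u₀ := shockData uL 0 (φ ν)) (fun _ => rfl)]
    exact (hU ν).1
  · simp only [godunovV_shift (laxFlux μ) (1 / 2) g (u₀ := shockData uL 0 (φ ν)) (fun _ => rfl)]
    exact (hV ν).2.1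
  · refine tendsto_atTop_mono (fun ν => ?_) (hgrow.atTop_div_const (by linarith : 0 < uL + uL))
    simp only [godunovU_shift (laxFlux μ) (u₀ := shockData uL 0 (φ ν)) (fun _ => rfl),
      godunovV_shift (laxFlux μ) (1 / 2) g (u₀ := shockData uL 0 (φ ν)) (fun _ => rfl)]
    have k1 := (hS ν).trans ((hV ν).2.2 (S ν)).2
    have k2 : 0 ≤ (ν : ℝ) * c0 := by positivity
    exact div_le_div₀ (k2.trans k1) k1 (hU ν).2.1 (hU ν).2.2
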